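/- **Setting.** Let $T>0$, $Y_0\in\mathbb R$, $Q\ge 1$, $\nu_1>0$, $\nu_j\ge 0$ $(2\le j\le Q)$, $1\ge\alpha_1\ge\dots\ge\alpha_Q>0$. Let $f:(0,T]\times\mathbb R\to\mathbb R$ be uniformly Lipschitz in its second argument: $|f(t,u)-f(t,v)|\le L|u-v|$ for all $t\in(0,T]$, $u,v\in\mathbb R$. Let $Y$ solve the multi-term Caputo equation $$\sum_{j=1}^Q\nu_j\,{}_CD^{\alpha_j}_{0,t}Y(t)=f(t,Y(t)),\quad t\in(0,T],\qquad Y(0)=Y_0,$$ where ${}_CD^{\alpha}_{0,t}Y(t)=\frac1{\Gamma(1-\alpha)}\int_0^t(t-s)^{-\alpha}Y'(s)\,ds$ for $0<\alpha<1$ and ${}_CD^1_{0,t}Y=Y'$. Suppose $$Y(t)-Y(0)=\sum_{k=1}^\infty c_kt^{\sigma_k},\quad t\in[0,T],\qquad 0<\sigma_1<\sigma_2<\cdots,$$ with real constants $c_k$ such that $\sum_k|c_k|\sigma_k^3T^{\sigma_k}<\infty$ (the series and its termwise derivatives up to order three converge absolutely at $T$; finite expansions are included by $c_k=0$). Let $m_1,\dots,m_Q$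 be positive integers with $\sigma_{m_j}\le 2$ for all $j$. **Scheme.** Put $\omega^{(\alpha)}_k=(-1)^k\binom{\alpha}{k}$, $g_0^{(\alpha)}=\frac{2+\alpha}2\omega_0^{(\alpha)}$ and $g_k^{(\alpha)}=\frac{2+\alpha}2\omega_k^{(\alpha)}-\frac\alpha2\omega_{k-1}^{(\alpha)}$ $(k\ge1)$. For $1\le j\le Q$ and $n\ge 1$ let the starting weights $w^{(\alpha_j)}_{n,k}$ $(1\le k\le m_j)$ be the unique solution of $$\sum_{k=1}^{m_j}w^{(\alpha_j)}_{n,k}k^{\sigma_r}=\frac{\Gamma(\sigma_r+1)}{\Gamma(\sigma_r+1-\alpha_j)}n^{\sigma_r-\alpha_j}-\sum_{k=0}^ng^{(\alpha_j)}_{n-k}k^{\sigma_r},\qquad 1\le r\le m_j.$$ Let $\tau=T/n_T$ with a positive integer $n_T$, $t_n=n\tau$, $m=\max_jm_j$. The numbers $y^0,\dots,y^{n_T}$ solve the scheme if $y^0=Y_0$ and, for $m<n\le n_T$, $$\sum_{j=1}^Q\frac{\nu_j}{\tau^{\alpha_j}}\Big[\sum_{k=0}^ng^{(\alpha_j)}_{n-k}(y^k-y^0)+\sum_{k=1}^{m_j}w^{(\alpha_j)}_{n,k}(y^k-y^0)\Big]=f(t_n,y^n);$$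 the starting values $y^1,\dots,y^m$ are arbitrary (obtained from the same equations with $n=1,\dots,m$ or by any other method). **Theorem (Convergence).** There are constants $C>0$ and $\tau_0>0$, independent of $n$, $\tau$ and of the $y^k$, such that whenever $\tau=T/n_T\le\tau_0$ and $y^0,\dots,y^{n_T}$ solve the scheme, then for all $0\le n\le n_T$ $$|Y(t_n)-y^n|\le C\Big(\sum_{k=0}^{m}|Y(t_k)-y^k|+\tau^{\min\{2,\ \min_{1\le j\le Q}(\sigma_{m_j+1}+\alpha_1-\alpha_j)\}}\Big).$$ -/

import Mathlib

open Set Filter MeasureTheory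

namespace MultiTermFODE

noncomputable section

/-! ### The continuous problem -/

/-- The Caputo derivative of order `α ∈ (0, 1]` on `[0, t]`,
`(1 / Γ(1 - α)) ∫₀ᵗ (t - s)^(-α) U'(s) ds`, which for `α = 1` is by definition `U'(t)`
(the fractional integral of order `0` is the identity). The derivatives are taken within `[0, t]`,
so that only the values of `U` on `[0, t]` matter. -/
def caputo (α : ℝ) (U : ℝ → ℝ) (t : ℝ) : ℝ :=
  if α = 1 then derivWithin U (Icc 0 t) t
  else (1 / Real.Gamma (1 - α)) *
    ∫ s in (0 : ℝ)..t, (t - s) ^ (-α) * derivWithin U (Icc 0 t) s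

/-- `Y` is a solution on `[0, T]` of
`∑ j, ν j * caputo (α j) Y t = f t (Y t)`, `t ∈ (0, T]`, `Y 0 = Y₀`. -/
structure IsSolution {Q : ℕ} (ν α : Fin Q → ℝ) (f : ℝ → ℝ → ℝ) (T Y₀ : ℝ) (Y : ℝ → ℝ) :
    Prop where
  init : Y 0 = Y₀
  continuousOn : ContinuousOn Y (Icc 0 T)
  differentiableOn : DifferentiableOn ℝ Y (Ioc 0 T)
  integrable : ∀ j, α j ≠ 1 → ∀ t ∈ Ioc 0 T,
    IntervalIntegrable (fun s => (t - s) ^ (-α j) * derivWithin Y (Icc 0 t) s) volume 0 t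
  equation : ∀ t ∈ Ioc 0 T, ∑ j, ν j * caputo (α j) Y t = f t (Y t)

/-- `Y t - Y 0 = c₁ t^σ₁ + c₂ t^σ₂ + ⋯` on `[0, T]` (indices start at `1`), the series and its
termwise derivatives up to order three being absolutely convergent at `T`. -/
structure HasExpansion (c σ : ℕ → ℝ) (T : ℝ) (Y : ℝ → ℝ) : Prop where
  hasSum : ∀ t ∈ Icc 0 T, HasSum (fun k : ℕ => c (k + 1) * t ^ σ (k + 1)) (Y t - Y 0)
  summable : Summable fun k : ℕ => |c (k + 1)| * σ (k + 1) ^ 3 * T ^ σ (k + 1)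

/-! ### The discrete operators -/

/-- Grünwald–Letnikov weights `ω_k = (-1)^k * binom(α, k)`. -/
def glWeight (α : ℝ) (k : ℕ) : ℝ := (-1) ^ k * Ring.choose α k

/-- Second-order weights `g_k` of the weighted and shifted formula with shifts `(0, -1)`. -/
def wsglWeight (α : ℝ) : ℕ → ℝ
  | 0 => (2 + α) / 2 * glWeight α 0
  | k + 1 => (2 + α) / 2 * glWeight α (k + 1) - α / 2 * glWeight α k

/-- The exponential Vandermonde matrix `k ^ σ_r`, `1 ≤ r, k ≤ m`. -/
def startMatrix (σ : ℕ → ℝ) (m : ℕ) : Matrix (Fin m) (Fin m) ℝ :=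
  fun r k => ((k : ℕ) + 1 : ℝ) ^ σ (r + 1)

/-- Right-hand side of the linear system for the starting weights. -/
def startRhs (α : ℝ) (σ : ℕ → ℝ) (m n : ℕ) : Fin m → ℝ := fun r =>
  Real.Gamma (σ (r + 1) + 1) / Real.Gamma (σ (r + 1) + 1 - α) * (n : ℝ) ^ (σ (r + 1) - α)
    - ∑ k ∈ Finset.range (n + 1), wsglWeight α (n - k) * (k : ℝ) ^ σ (r + 1)

/-- The starting weights at step `n`: the solution of
`∑_{k=1}^m w_{n,k} k^σ_r = startRhs r`, `1 ≤ r ≤ m`; the entry at `k : Fin m` belongs to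
the node `k + 1`. The system is uniquely solvable, see `startWeight_spec`. -/
def startWeight (α : ℝ) (σ : ℕ → ℝ) (m n : ℕ) : Fin m → ℝ :=
  (startMatrix σ m)⁻¹.mulVec (startRhs α σ m n)

/-- The corrected formula `τ^(-α) (∑_{k=0}^n g_{n-k} u_k + ∑_{k=1}^m w_{n,k} u_k)`. -/
def corrected (α : ℝ) (σ : ℕ → ℝ) (m : ℕ) (τ : ℝ) (u : ℕ → ℝ) (n : ℕ) : ℝ :=
  (1 / τ ^ α) * (∑ k ∈ Finset.range (n + 1), wsglWeight α (n - k) * u k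
    + ∑ k : Fin m, startWeight α σ m n k * u (k + 1))

/-- `y 0, …, y N` solves the scheme with step `τ`: `y 0 = Y₀` and
`∑ j, ν j * corrected (α j) σ (m j) τ (y - y 0) n = f (n τ) (y n)` at every step
`max m j < n ≤ N`. The starting values `y 1, …, y (max m j)` are free: they may come from the same
equations or from any other method. -/
structure IsSchemeSolution {Q : ℕ} (ν α : Fin Q → ℝ) (σ : ℕ → ℝ) (m : Fin Q → ℕ)
    (f : ℝ → ℝ → ℝ) (Y₀ τ : ℝ) (N : ℕ) (y : ℕ → ℝ) : Prop where
  init : y 0 = Y₀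
  step : ∀ n, Finset.univ.sup m < n → n ≤ N →
    ∑ j, ν j * corrected (α j) σ (m j) τ (fun k => y k - y 0) n = f (n * τ) (y n)

/-! ### Solvability of the system for the starting weights -/

theorem coeff_eq_zero_of_zeros : ∀ (m : ℕ) (s a x : Fin m → ℝ), StrictMono s → StrictMono x →
    (∀ i, 0 < x i) → (∀ i, ∑ r, a r * x i ^ s r = 0) → a = 0 := by
  intro m
  induction m with
  | zero => intro s a x _ _ _ _; exact Subsingleton.elim _ _
  | succ m ih =>
    intro s a x hs hx hpos hz
    have hz' : ∀ i, ∑ r, a r * x i ^ (s r - s 0) = 0 := by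
      intro i
      have h1 : ∑ r, a r * x i ^ (s r - s 0) = (∑ r, a r * x i ^ s r) / x i ^ s 0 := by
        rw [Finset.sum_div]
        refine Finset.sum_congr rfl fun r _ => ?_
        rw [Real.rpow_sub (hpos i)]
        ring
      rw [h1, hz i, zero_div]
    have hd : ∀ t : ℝ, 0 < t → HasDerivAt (fun t : ℝ => ∑ r, a r * t ^ (s r - s 0))
        (∑ r, a r * ((s r - s 0) * t ^ (s r - s 0 - 1))) t := by
      intro t ht
      refine HasDerivAt.fun_sum fun r _ => ?_
      exact (Real.hasDerivAt_rpow_const (Or.inl ht.ne')).const_mul (a r)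
    have hR : ∀ i : Fin m, ∃ z ∈ Ioo (x i.castSucc) (x i.succ),
        ∑ r, a r * ((s r - s 0) * z ^ (s r - s 0 - 1)) = 0 := by
      intro i
      refine exists_hasDerivAt_eq_zero (f := fun t : ℝ => ∑ r, a r * t ^ (s r - s 0))
        (hx (Fin.castSucc_lt_succ)) ?_ ?_ ?_
      · intro t ht
        exact (hd t ((hpos _).trans_le ht.1)).continuousAt.continuousWithinAt
      · simp only [hz']
      · intro t ht
        exact hd t ((hpos _).trans ht.1)
    choose z hzm hz0 using hR
    have hzs : StrictMono z := by
      intro i j hij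
      have h1 : x i.succ ≤ x j.castSucc := hx.monotone (by
        rw [Fin.le_def]; simp only [Fin.val_succ, Fin.val_castSucc]; exact hij)
      exact ((hzm i).2.trans_le h1).trans (hzm j).1
    have hb := ih (fun r => s r.succ - s 0 - 1) (fun r => a r.succ * (s r.succ - s 0)) z
      (fun i j hij => by
        have := hs (Fin.succ_lt_succ_iff.2 hij)
        simp only; linarith) hzs (fun i => (hpos _).trans (hzm i).1) (fun i => by
        have := hz0 i
        rw [Fin.sum_univ_succ] at this
        simpa [mul_assoc] using this)
    have hsucc : ∀ r : Fin m, a r.succ = 0 := by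
      intro r
      have h1 : a r.succ * (s r.succ - s 0) = 0 := congrFun hb r
      have h2 : s 0 < s r.succ := hs (Fin.succ_pos r)
      exact (mul_eq_zero.1 h1).resolve_right (by linarith)
    have h0 : a 0 = 0 := by
      have := hz' 0
      rw [Fin.sum_univ_succ] at this
      simpa [hsucc] using this
    funext r
    refine Fin.cases h0 hsucc r

theorem startMatrix_det_ne_zero {σ : ℕ → ℝ} (hσ : ∀ k, 1 ≤ k → σ k < σ (k + 1)) (m : ℕ) :
    (startMatrix σ m).det ≠ 0 := by
  intro h
  obtain ⟨v, hv, hv0⟩ := Matrix.exists_vecMul_eq_zero_iff.2 h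
  apply hv
  have hs : StrictMono fun k : ℕ => σ (k + 1) := strictMono_nat_of_lt_succ fun k => hσ _ (by omega)
  refine coeff_eq_zero_of_zeros m (fun r => σ (r + 1)) v (fun k => ((k : ℕ) + 1 : ℝ))
    (fun i j hij => hs hij) (fun i j hij => ?_) (fun i => by positivity) fun i => ?_
  · have : ((i : ℕ) : ℝ) < (j : ℕ) := by exact_mod_cast hij
    simpa using this
  · exact congrFun hv0 i

theorem startWeight_spec {σ : ℕ → ℝ} (hσ : ∀ k, 1 ≤ k → σ k < σ (k + 1)) (α : ℝ) (m n : ℕ)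
    (r : Fin m) :
    ∑ k : Fin m, startWeight α σ m n k * ((k : ℕ) + 1 : ℝ) ^ σ (r + 1) = startRhs α σ m n r := by
  have h : (startMatrix σ m).mulVec (startWeight α σ m n) = startRhs α σ m n := by
    rw [startWeight, Matrix.mulVec_mulVec,
      Matrix.mul_nonsing_inv _ (isUnit_iff_ne_zero.2 (startMatrix_det_ne_zero hσ m)),
      Matrix.one_mulVec]
  rw [← congrFun h r]
  simp only [Matrix.mulVec, dotProduct, startMatrix]
  exact Finset.sum_congr rfl fun k _ => mul_comm _ _

end

end MultiTermFODE

open Set Filter MeasureTheory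

namespace MultiTermFODE

noncomputable section

/-! Let β be the largest order (`α 0`). The error equation is not estimated step by step but after a
fractional summation of order β, that is, after convolution with the coefficients `psi β` of (1 -
z)^(-β). Pointwise, the truncation error near t = 0 is too large; its fractional sum, multiplied by
τ^β, has the right order.

Consistency. The weights have generating function (1 - z)^α (1 + α(1 - z)/2). On t^σ with unit step
the error `powErr` is the integral of σ(n - s)^(σ-1) against the difference of the Caputo kernel and
a step function with values `kap`. By the second-order asymptotics of `psi`, two successive
primitives of this difference decay like l^(-1-α) and l^(-α). Integration by parts gives O(n^(σ-2-α)
+ n^(-1-α)) (`exists_abs_powErr_le`), and the fractional sum is O(1 + n^(σ-2+β-α))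
(`exists_abs_powErrSum_le`). At β = 1, σ = 1 + α a direct summation would produce a logarithm; the
exact identity `powErrSum_one_eq` avoids it. Multiplied by τ^(σ+β-α), the bound has order min(2,
σ+β-α) for nτ ≤ T. All constants grow at most like (1 + σ)^3, so the expansion of Y can be summed
term by term (`exists_truncation_source_le`).

Starting weights. They are fixed linear combinations of the errors `powErr` for σ_1, ..., σ_m. They
annihilate the first m terms of the expansion, and since σ_m ≤ 2 their fractional sums are
O(n^(β-α)), so the starting errors enter the source with a bounded factor
(`exists_start_source_le`).

Stability. After the fractional summation, terms of order β reduce to (1 + β/2)e_n - (β/2)e_{n-1},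
and terms of order α_j < β to convolutions with `psi (β - α_j)`. In the norm max |e_k| x^k with x =
1 - μτ, the two-term expression is bounded below by the norm, while convolution with `psi δ`,
multiplied by τ^δ, has norm at most μ^(-δ). A large fixed μ therefore absorbs all lower-order terms
and the Lipschitz term (`stability_aux`). Equations missing at the first steps are replaced by an
artificial source supported there (`stability`). -/

/-- The power series of `(1 - z) ^ a`. -/
def glSeries (a : ℝ) : PowerSeries ℝ := PowerSeries.mk (glWeight a)

/-- The coefficients of `(1 - z) ^ (-b)`. -/
def psi (b : ℝ) (k : ℕ) : ℝ := glWeight (-b) k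

/-! ### Coefficients of (1 - z)^a: product formulas and elementary bounds -/

theorem glSeries_eq (a : ℝ) :
    glSeries a = PowerSeries.rescale (-1 : ℝ) (PowerSeries.binomialSeries ℝ a) := by
  ext n
  simp [glSeries, glWeight, PowerSeries.coeff_rescale]

theorem glSeries_add (a b : ℝ) : glSeries (a + b) = glSeries a * glSeries b := by
  simp [glSeries_eq]

theorem glSeries_zero : glSeries 0 = 1 := by
  simp [glSeries_eq]

theorem glSeries_one : glSeries 1 = 1 - PowerSeries.X := by
  have h : PowerSeries.binomialSeries ℝ (1 : ℝ) = 1 + PowerSeries.X := by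
    simpa using PowerSeries.binomialSeries_nat (R := ℝ) (A := ℝ) 1
  rw [glSeries_eq, h, map_add, map_one, PowerSeries.rescale_X]
  simp [sub_eq_add_neg]

theorem glSeries_neg_eq (b : ℝ) : glSeries (-b) = PowerSeries.mk (psi b) := rfl

theorem psi_zero (b : ℝ) : psi b 0 = 1 := by simp [psi, glWeight]

theorem psi_succ (b : ℝ) (k : ℕ) : psi b (k + 1) = psi b k * ((b + k) / (k + 1)) := by
  have h : ((k : ℝ) + 1) ≠ 0 := by positivity
  simp only [psi, glWeight, Ring.choose_eq_smul, descPochhammer_succ_right,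
    Polynomial.smeval_mul, Polynomial.smeval_sub, Polynomial.smeval_X, Polynomial.smeval_natCast,
    Nat.factorial_succ, smul_eq_mul]
  push_cast
  field_simp
  simp
  ring

theorem psi_nonneg {b : ℝ} (hb : 0 ≤ b) (k : ℕ) : 0 ≤ psi b k := by
  induction k with
  | zero => simp [psi_zero]
  | succ k ih => rw [psi_succ]; positivity

theorem psi_antitone {b : ℝ} (hb : 0 ≤ b) (hb1 : b ≤ 1) : Antitone (psi b) := by
  refine antitone_nat_of_succ_le fun k => ?_
  rw [psi_succ]
  refine mul_le_of_le_one_right (psi_nonneg hb k) ?_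
  rw [div_le_one (by positivity)]
  linarith

theorem psi_le_one {b : ℝ} (hb : 0 ≤ b) (hb1 : b ≤ 1) (k : ℕ) : psi b k ≤ 1 := by
  simpa [psi_zero] using psi_antitone hb hb1 (Nat.zero_le k)

theorem psi_one (k : ℕ) : psi 1 k = 1 := by
  induction k with
  | zero => simp [psi_zero]
  | succ k ih =>
    rw [psi_succ, ih, one_mul, add_comm]
    exact div_self (by positivity)

theorem coeff_mk_mul_mk (f g : ℕ → ℝ) (n : ℕ) :
    PowerSeries.coeff n (PowerSeries.mk f * PowerSeries.mk g)
      = ∑ k ∈ Finset.range (n + 1), f (n - k) * g k := by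
  rw [mul_comm, PowerSeries.coeff_mul, Finset.Nat.sum_antidiagonal_eq_sum_range_succ_mk]
  simp [mul_comm]

/-- Vandermonde's convolution, from (1 - z)^(-a) (1 - z)^(-b). With a + b = 1 the right side is
constantly 1, which is how most convolution sums are bounded later. -/
theorem sum_psi_mul_psi (a b : ℝ) (n : ℕ) :
    ∑ k ∈ Finset.range (n + 1), psi a (n - k) * psi b k = psi (a + b) n := by
  have h := congrArg (PowerSeries.coeff n) (glSeries_add (-a) (-b))
  rw [glSeries_neg_eq, glSeries_neg_eq, coeff_mk_mul_mk, ← neg_add, glSeries_neg_eq,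
    PowerSeries.coeff_mk] at h
  exact h.symm

/-- Induction, the step being Bernoulli's inequality (1 - 1/(k+1))^(1-b) ≤ 1 - (1-b)/(k+1). It
serves to dominate powers of k by `psi`, so that sums of powers become Vandermonde convolutions. -/
theorem mul_rpow_le_psi {b : ℝ} (hb : 0 < b) (hb1 : b ≤ 1) {k : ℕ} (hk : 1 ≤ k) :
    b * (k : ℝ) ^ (b - 1) ≤ psi b k := by
  induction k, hk using Nat.le_induction with
  | base => simp [psi_succ, psi_zero]
  | succ k hk ih =>
    have hk0 : (0 : ℝ) < k := by exact_mod_cast hk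
    rw [psi_succ]
    have h1 : ((k + 1 : ℕ) : ℝ) ^ (b - 1) ≤ (k : ℝ) ^ (b - 1) * ((b + k) / (k + 1)) := by
      have h2 := rpow_one_add_le_one_add_mul_self (s := -1 / ((k : ℝ) + 1)) (p := 1 - b)
        (by rw [le_div_iff₀ (by positivity)]; linarith) (by linarith) (by linarith)
      have h3 : 1 + -1 / ((k : ℝ) + 1) = k / (k + 1) := by field_simp; ring
      have h4 : 1 + (1 - b) * (-1 / ((k : ℝ) + 1)) = (b + k) / (k + 1) := by field_simp; ring
      rw [h3, h4, Real.div_rpow hk0.le (by positivity)] at h2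
      refine le_trans (le_of_eq ?_) (mul_le_mul_of_nonneg_left h2 (by positivity))
      push_cast
      rw [mul_div_assoc', ← Real.rpow_add hk0, eq_div_iff (by positivity),
        ← Real.rpow_add (by positivity)]
      simp
    calc b * ((k + 1 : ℕ) : ℝ) ^ (b - 1) ≤ b * ((k : ℝ) ^ (b - 1) * ((b + k) / (k + 1))) := by gcongr
      _ = b * (k : ℝ) ^ (b - 1) * ((b + k) / (k + 1)) := by ring
      _ ≤ _ := by gcongr

theorem hasSum_psi_mul_pow (b : ℝ) {x : ℝ} (hx0 : 0 ≤ x) (hx : x < 1) :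
    HasSum (fun k => psi b k * x ^ k) ((1 - x) ^ (-b)) := by
  have h := (Real.one_add_rpow_hasFPowerSeriesOnBall_zero (a := -b)).hasSum (y := -x)
    (by simpa [enorm_eq_nnnorm, abs_of_nonneg hx0, ← NNReal.coe_lt_one] using hx)
  simp only [zero_add, binomialSeries_apply] at h
  have h1 : 1 + -x = 1 - x := by ring
  rw [h1] at h
  have h2 : (fun k => psi b k * x ^ k)
      = fun k => Ring.choose (-b) k • (List.ofFn fun _ : Fin k => -x).prod := by
    funext k
    simp only [psi, glWeight, List.ofFn_const, List.prod_replicate, smul_eq_mul, neg_pow x k]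
    ring
  rw [h2]
  exact h

theorem sum_psi_mul_pow_le {b : ℝ} (hb : 0 ≤ b) {x : ℝ} (hx0 : 0 ≤ x) (hx : x < 1) (n : ℕ) :
    ∑ k ∈ Finset.range n, psi b k * x ^ k ≤ (1 - x) ^ (-b) :=
  sum_le_hasSum _ (fun k _ => mul_nonneg (psi_nonneg hb k) (pow_nonneg hx0 k))
    (hasSum_psi_mul_pow b hx0 hx)

/-! ### Generating function of the weighted and shifted formula; summation by parts -/

theorem mk_wsglWeight (α : ℝ) : PowerSeries.mk (wsglWeight α)
    = glSeries α * (1 + PowerSeries.C (α / 2) * (1 - PowerSeries.X)) := by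
  have h : glSeries α * (1 + PowerSeries.C (α / 2) * (1 - PowerSeries.X))
      = PowerSeries.C ((2 + α) / 2) * glSeries α
        - PowerSeries.C (α / 2) * (glSeries α * PowerSeries.X) := by
    rw [show (2 + α) / 2 = 1 + α / 2 by ring, map_add, map_one]
    ring
  rw [h]
  ext n
  cases n with
  | zero => simp [wsglWeight, glSeries]
  | succ n => simp [wsglWeight, glSeries, PowerSeries.coeff_succ_mul_X]

/-- The coefficients of `z (1 - z) ^ (α - 2) (1 + α (1 - z) / 2)`. -/
def kapSum (α : ℝ) : ℕ → ℝ
  | 0 => 0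
  | l + 1 => psi (2 - α) l + α / 2 * psi (1 - α) l

/-- The coefficients of `(1 - z) ^ (α - 1) (1 + α (1 - z) / 2)`. -/
def kap (α : ℝ) (l : ℕ) : ℝ := kapSum α (l + 1) - kapSum α l

theorem mk_kap (α : ℝ) : PowerSeries.mk (kap α)
    = glSeries (α - 1) * (1 + PowerSeries.C (α / 2) * (1 - PowerSeries.X)) := by
  have h : glSeries (α - 1) = glSeries (α - 2) * (1 - PowerSeries.X) := by
    rw [← glSeries_one, ← glSeries_add]
    congr 1
    ring
  have h2 : PowerSeries.mk (fun l => kapSum α (l + 1))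
      = glSeries (α - 2) + PowerSeries.C (α / 2) * glSeries (α - 1) := by
    ext n
    simp [kapSum, glSeries, psi]
  have h3 : glSeries (α - 1) * (1 + PowerSeries.C (α / 2) * (1 - PowerSeries.X))
      = PowerSeries.mk (fun l => kapSum α (l + 1)) * (1 - PowerSeries.X) := by
    rw [h2, h]
    ring
  rw [h3, mul_sub, mul_one]
  ext n
  cases n with
  | zero => simp [kap, kapSum]
  | succ n => simp [kap, PowerSeries.coeff_succ_mul_X]

theorem abs_kap_le {α : ℝ} (hα : 0 < α) (hα1 : α ≤ 1) (l : ℕ) :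
    |kap α (l + 1)| ≤ 2 * (psi (1 - α) (l + 1) + psi (1 - α) l) ∧
      |kap α 0| ≤ 2 * psi (1 - α) 0 := by
  have h := mk_kap α
  have h1 : glSeries (α - 1) = PowerSeries.mk (psi (1 - α)) := by
    rw [← glSeries_neg_eq]; congr 1; ring
  have h2 : glSeries (α - 1) * (1 + PowerSeries.C (α / 2) * (1 - PowerSeries.X))
      = PowerSeries.C (1 + α / 2) * glSeries (α - 1)
        - PowerSeries.C (α / 2) * (glSeries (α - 1) * PowerSeries.X) := by
    rw [map_add, map_one]
    ring
  rw [h2, h1] at h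
  have hp := fun k => psi_nonneg (b := 1 - α) (by linarith) k
  constructor
  · have h3 := congrArg (PowerSeries.coeff (l + 1)) h
    simp only [PowerSeries.coeff_mk, map_sub, PowerSeries.coeff_C_mul,
      PowerSeries.coeff_succ_mul_X] at h3
    have := hp (l + 1)
    have := hp l
    rw [h3, abs_le]
    constructor <;> nlinarith
  · have h3 := congrArg (PowerSeries.coeff 0) h
    simp [psi_zero] at h3
    rw [h3, psi_zero, abs_le]
    constructor <;> linarith

/-- Summation by parts for the weighted and shifted formula. -/
theorem sum_wsglWeight_mul (α : ℝ) (u : ℕ → ℝ) (hu : u 0 = 0) (n : ℕ) :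
    ∑ k ∈ Finset.range (n + 1), wsglWeight α (n - k) * u k
      = ∑ l ∈ Finset.range n, kap α l * (u (n - l) - u (n - l - 1)) := by
  -- A factor 1 - z moves from the weights to u; as u 0 = 0, it turns u into z times the series of
  -- forward differences.
  have h : PowerSeries.mk (wsglWeight α) * PowerSeries.mk u
      = PowerSeries.X * (PowerSeries.mk (fun k => u (k + 1) - u k) * PowerSeries.mk (kap α)) := by
    have h1 : glSeries α = glSeries (α - 1) * (1 - PowerSeries.X) := by
      rw [← glSeries_one, ← glSeries_add]
      congr 1
      ring
    have h2 : (1 - PowerSeries.X) * PowerSeries.mk u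
        = PowerSeries.X * PowerSeries.mk (fun k => u (k + 1) - u k) := by
      rw [sub_mul, one_mul]
      ext n
      cases n with
      | zero => simp [hu]
      | succ n => simp [PowerSeries.coeff_succ_X_mul]
    rw [mk_wsglWeight, mk_kap, h1]
    linear_combination (glSeries (α - 1) * (1 + PowerSeries.C (α / 2) * (1 - PowerSeries.X))) * h2
  have h3 := congrArg (PowerSeries.coeff n) h
  rw [coeff_mk_mul_mk] at h3
  rw [h3]
  cases n with
  | zero => simp
  | succ n =>
    rw [PowerSeries.coeff_succ_X_mul, coeff_mk_mul_mk]
    refine Finset.sum_congr rfl fun l hl => ?_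
    have hl' : l ≤ n := by simpa [Nat.lt_succ_iff] using hl
    rw [show n + 1 - l = n - l + 1 by omega, Nat.add_sub_cancel]
    ring

/-- The summed form of the weighted and shifted formula. -/
theorem sum_sum_kap_mul (α : ℝ) (u : ℕ → ℝ) (hu : u 0 = 0) (n : ℕ) :
    ∑ k ∈ Finset.range (n + 1), ∑ l ∈ Finset.range k, kap α l * (u (k - l) - u (k - l - 1))
      = ∑ l ∈ Finset.range n, kap α l * u (n - l) := by
  induction n with
  | zero => simp
  | succ n ih =>
    rw [Finset.sum_range_succ, ih]
    have h : ∑ l ∈ Finset.range n, kap α l * u (n - l)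
        = ∑ l ∈ Finset.range (n + 1), kap α l * u (n - l) := by
      rw [Finset.sum_range_succ]
      simp [hu]
    rw [h, ← Finset.sum_add_distrib]
    refine Finset.sum_congr rfl fun l hl => ?_
    have hl' : l ≤ n := by simpa [Nat.lt_succ_iff] using hl
    rw [show n + 1 - l - 1 = n - l by omega]
    ring

/-! ### Second-order asymptotics of the coefficients -/

/-- Mean value inequality on [0, y]. The factor 1/(n+1) of exact integration is given up; iterated,
this yields Taylor remainders. -/
theorem abs_le_of_deriv_bound {f f' : ℝ → ℝ} {C : ℝ} {n : ℕ} (hf0 : f 0 = 0)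
    (hf : ∀ y, 0 ≤ y → HasDerivAt f (f' y) y) (hC : ∀ y ∈ Icc (0 : ℝ) 1, |f' y| ≤ C * y ^ n)
    {y : ℝ} (hy : y ∈ Icc (0 : ℝ) 1) : |f y| ≤ C * y ^ (n + 1) := by
  have hC0 : 0 ≤ C := by
    have := (abs_nonneg _).trans (hC 1 ⟨by norm_num, le_rfl⟩)
    simpa using this
  have h := Convex.norm_image_sub_le_of_norm_hasDerivWithin_le (f := f) (f' := f') (C := C * y ^ n)
    (s := Icc 0 y) (x := 0) (y := y) (fun z hz => (hf z hz.1).hasDerivWithinAt)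
    (fun z hz => (hC z ⟨hz.1, hz.2.trans hy.2⟩).trans (by
      have := hz.1
      have := hz.2
      gcongr)) (convex_Icc 0 y) ⟨le_rfl, hy.1⟩ ⟨hy.1, le_rfl⟩
  rw [hf0, sub_zero, sub_zero, Real.norm_eq_abs, Real.norm_eq_abs, abs_of_nonneg hy.1] at h
  rw [pow_succ, ← mul_assoc]
  exact h

/-- The third derivative b(b-1)(b-2)(1+y)^(b-3) is at most 3·2·1 in absolute value for b in [1, 3],
and is integrated back three times. -/
theorem abs_one_add_rpow_sub_le {b : ℝ} (hb1 : 1 ≤ b) (hb3 : b ≤ 3) {y : ℝ}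
    (hy : y ∈ Icc (0 : ℝ) 1) :
    |(1 + y) ^ b - (1 + b * y + b * (b - 1) / 2 * y ^ 2)| ≤ 6 * y ^ 3 := by
  have hd : ∀ (q : ℝ) (z : ℝ), 0 ≤ z →
      HasDerivAt (fun z : ℝ => (1 + z) ^ q) (q * (1 + z) ^ (q - 1)) z := by
    intro q z hz
    have h1 : HasDerivAt (fun z : ℝ => 1 + z) 1 z := (hasDerivAt_id z).const_add 1
    have := h1.rpow_const (p := q) (Or.inl (by positivity))
    simpa using this
  have h3 : ∀ z ∈ Icc (0 : ℝ) 1, |b * (b - 1) * (b - 2) * (1 + z) ^ (b - 3)| ≤ 6 * z ^ 0 := by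
    intro z hz
    have hz0 := hz.1
    have h0 : 0 ≤ (1 + z) ^ (b - 3) := by positivity
    rw [abs_mul, abs_mul, abs_mul, abs_of_nonneg (by linarith : 0 ≤ b),
      abs_of_nonneg (by linarith : 0 ≤ b - 1), abs_of_nonneg h0]
    have h1 : (1 + z) ^ (b - 3) ≤ 1 :=
      Real.rpow_le_one_of_one_le_of_nonpos (by linarith) (by linarith)
    have h2 : |b - 2| ≤ 1 := abs_le.2 ⟨by linarith, by linarith⟩
    calc b * (b - 1) * |b - 2| * (1 + z) ^ (b - 3) ≤ 3 * 2 * 1 * 1 := by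
          gcongr
          linarith
      _ = 6 * z ^ 0 := by norm_num
  have h2 : ∀ z ∈ Icc (0 : ℝ) 1, |b * (b - 1) * (1 + z) ^ (b - 2) - b * (b - 1)| ≤ 6 * z ^ 1 := by
    intro z hz
    refine abs_le_of_deriv_bound (n := 0)
      (f := fun z => b * (b - 1) * (1 + z) ^ (b - 2) - b * (b - 1)) (by simp) (fun y hy => ?_) h3 hz
    refine (((hd (b - 2) y hy).const_mul (b * (b - 1))).sub_const (b * (b - 1))).congr_deriv ?_
    rw [show b - 2 - 1 = b - 3 by ring]
    ring
  have h1 : ∀ z ∈ Icc (0 : ℝ) 1, |b * (1 + z) ^ (b - 1) - (b + b * (b - 1) * z)| ≤ 6 * z ^ 2 := by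
    intro z hz
    refine abs_le_of_deriv_bound (n := 1)
      (f := fun z => b * (1 + z) ^ (b - 1) - (b + b * (b - 1) * z)) (by simp) (fun y hy => ?_) h2 hz
    refine (((hd (b - 1) y hy).const_mul b).sub
      (((hasDerivAt_id y).const_mul (b * (b - 1))).const_add b)).congr_deriv ?_
    rw [show b - 1 - 1 = b - 2 by ring]
    ring
  refine abs_le_of_deriv_bound (n := 2)
    (f := fun y => (1 + y) ^ b - (1 + b * y + b * (b - 1) / 2 * y ^ 2)) (by simp)
    (fun y hy => ?_) h1 hy
  refine ((hd b y hy).sub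
    ((((hasDerivAt_id y).const_mul b).const_add 1).add
      (((hasDerivAt_id y).pow 2).const_mul (b * (b - 1) / 2)))).congr_deriv ?_
  simp
  ring

/-- The constant (b-1)(2-b)/2 is the one for which the Taylor coefficients up to y² cancel. With y =
1/(k+1), the left side measures the relative increment of the normalised sequence in
`exists_psi_asymp`. -/
theorem abs_ratio_defect_le {b : ℝ} (hb1 : 1 ≤ b) (hb3 : b ≤ 3) {y : ℝ} (hy : y ∈ Icc (0 : ℝ) 1) :
    |(1 + (b - 1) * y) * (1 + (1 + (b - 1) * (2 - b) / 2) * y)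
      - (1 + y) ^ b * (1 + (b - 1) * (2 - b) / 2 * y)| ≤ 15 * y ^ 3 := by
  set c := (b - 1) * (2 - b) / 2 with hc
  have hc1 : -1 ≤ c := by nlinarith
  have hc2 : c ≤ 1 := by nlinarith [sq_nonneg (b - 3 / 2)]
  have h := abs_one_add_rpow_sub_le hb1 hb3 hy
  have hy0 := hy.1
  have e : (1 + (b - 1) * y) * (1 + (1 + c) * y) - (1 + y) ^ b * (1 + c * y)
      = -(((1 + y) ^ b - (1 + b * y + b * (b - 1) / 2 * y ^ 2)) * (1 + c * y))
        - b * (b - 1) / 2 * c * y ^ 3 := by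
    rw [hc]; ring
  rw [e]
  refine (abs_sub _ _).trans ?_
  rw [abs_neg, abs_mul]
  have h1 : |1 + c * y| ≤ 2 := abs_le.2 ⟨by nlinarith [hy.2], by nlinarith [hy.2]⟩
  have h2 : |b * (b - 1) / 2 * c * y ^ 3| ≤ 3 * y ^ 3 := by
    rw [abs_mul, abs_of_nonneg (by positivity : 0 ≤ y ^ 3)]
    gcongr
    rw [abs_mul, abs_of_nonneg (by nlinarith)]
    have : |c| ≤ 1 := abs_le.2 ⟨hc1, hc2⟩
    calc b * (b - 1) / 2 * |c| ≤ 3 * 1 := by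
          gcongr
          nlinarith
      _ = 3 := by norm_num
  calc _ ≤ 6 * y ^ 3 * 2 + 3 * y ^ 3 := by gcongr
    _ = 15 * y ^ 3 := by ring

/-- The increment bound is at most the drop of 2C/(k+1)² from k to k+1, so adding or subtracting
this quantity makes x antitone or monotone, with limit a in both cases. -/
theorem abs_sub_le_of_tendsto {x : ℕ → ℝ} {a C : ℝ} (hx : Tendsto x atTop (nhds a))
    (h : ∀ k : ℕ, |x (k + 1) - x k| ≤ C / ((k : ℝ) + 1) ^ 3) (k : ℕ) :
    |x k - a| ≤ 2 * C / ((k : ℝ) + 1) ^ 2 := by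
  have hC : 0 ≤ C := by
    have := (abs_nonneg _).trans (h 0)
    simpa using this
  have hstep : ∀ k : ℕ, C / ((k : ℝ) + 1) ^ 3
      ≤ 2 * C / ((k : ℝ) + 1) ^ 2 - 2 * C / ((k : ℝ) + 1 + 1) ^ 2 := by
    intro k
    have hk : (0 : ℝ) ≤ k := k.cast_nonneg
    rw [div_sub_div _ _ (by positivity) (by positivity), div_le_div_iff₀ (by positivity)
      (by positivity)]
    have : 0 ≤ C * ((k : ℝ) + 1) ^ 2 := by positivity
    nlinarith [mul_nonneg this (by nlinarith : (0 : ℝ) ≤ 3 * (k + 1) ^ 2 - 1)]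
  have hlim : Tendsto (fun k : ℕ => 2 * C / ((k : ℝ) + 1) ^ 2) atTop (nhds 0) := by
    have h1 : Tendsto (fun k : ℕ => ((k : ℝ) + 1) ^ 2) atTop atTop :=
      (tendsto_pow_atTop (by norm_num)).comp
        (tendsto_atTop_add_const_right _ _ tendsto_natCast_atTop_atTop)
    exact h1.const_div_atTop _
  have hup : a ≤ x k + 2 * C / ((k : ℝ) + 1) ^ 2 := by
    have hanti : Antitone fun k : ℕ => x k + 2 * C / ((k : ℝ) + 1) ^ 2 := by
      refine antitone_nat_of_succ_le fun k => ?_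
      have := (abs_le.1 (h k)).2
      have := hstep k
      push_cast
      linarith
    exact hanti.le_of_tendsto (by simpa using hx.add hlim) k
  have hlow : x k - 2 * C / ((k : ℝ) + 1) ^ 2 ≤ a := by
    have hmono : Monotone fun k : ℕ => x k - 2 * C / ((k : ℝ) + 1) ^ 2 := by
      refine monotone_nat_of_le_succ fun k => ?_
      have := (abs_le.1 (h k)).1
      have := hstep k
      push_cast
      linarith
    exact hmono.ge_of_tendsto (by simpa using hx.sub hlim) k
  rw [abs_le]
  constructor <;> linarith

theorem psi_succ_eq_prod (b : ℝ) (k : ℕ) :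
    psi b (k + 1) = (∏ j ∈ Finset.range (k + 1), (b + j)) / ((k + 1 : ℕ).factorial : ℝ) := by
  induction k with
  | zero => simp [psi_succ, psi_zero]
  | succ k ih =>
    have h1 : ((k + 1 : ℕ).factorial : ℝ) ≠ 0 := by exact_mod_cast (Nat.factorial_pos _).ne'
    rw [psi_succ, ih, Finset.prod_range_succ _ (k + 1), Nat.factorial_succ (k + 1)]
    push_cast
    field_simp

/-- Euler's product for Γ: `psi b (k + 2)` and `Real.GammaSeq b (k + 1)` contain the same product,
and the remaining quotients tend to 1. -/
theorem tendsto_psi_mul_rpow {b : ℝ} (hb : 0 < b) :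
    Tendsto (fun k : ℕ => psi b k * Real.Gamma b * ((k : ℝ) + 1) ^ (1 - b)) atTop (nhds 1) := by
  rw [← tendsto_add_atTop_iff_nat 2]
  have h1 : ∀ k : ℕ, psi b (k + 2) * Real.Gamma b * (((k + 2 : ℕ) : ℝ) + 1) ^ (1 - b)
      = (Real.Gamma b / Real.GammaSeq b (k + 1)) * ((k + 1 : ℝ) / (k + 2))
        * ((k + 1 : ℝ) / (k + 3)) ^ (b - 1) := by
    intro k
    have hk : (0 : ℝ) < k + 1 := by positivity
    have hf : ((k + 1 : ℕ).factorial : ℝ) ≠ 0 := by exact_mod_cast (Nat.factorial_pos _).ne'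
    have hp : ∏ j ∈ Finset.range (k + 2), (b + j) ≠ 0 :=
      Finset.prod_ne_zero_iff.2 fun j _ => by positivity
    rw [psi_succ_eq_prod, Real.GammaSeq, Nat.factorial_succ (k + 1),
      Real.div_rpow (by positivity) (by positivity), show 1 - b = -(b - 1) by ring,
      Real.rpow_neg (by positivity), Real.rpow_sub_one (by positivity)]
    push_cast
    rw [Real.rpow_sub_one (by positivity)]
    have h3 : (k : ℝ) + 2 + 1 = k + 3 := by ring
    have h4 : (k : ℝ) + 1 + 1 = k + 2 := by ring
    rw [h3, h4]
    have h5 : ((k : ℝ) + 1) ^ b ≠ 0 := by positivity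
    have h6 : ((k : ℝ) + 3) ^ b ≠ 0 := by positivity
    field_simp
    rw [Real.rpow_sub_one (by positivity)]
    field_simp
  simp_rw [h1]
  have hG : Real.Gamma b ≠ 0 := (Real.Gamma_pos_of_pos hb).ne'
  have hA : Tendsto (fun k : ℕ => Real.Gamma b / Real.GammaSeq b (k + 1)) atTop (nhds 1) := by
    have := (tendsto_const_nhds (x := Real.Gamma b)).div
      ((tendsto_add_atTop_iff_nat 1).2 (Real.GammaSeq_tendsto_Gamma b)) hG
    rwa [div_self hG] at this
  have hlin : ∀ c : ℝ, Tendsto (fun k : ℕ => (k + 1 : ℝ) / (k + c)) atTop (nhds 1) := by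
    intro c
    have := tendsto_add_mul_div_add_mul_atTop_nhds (1 : ℝ) c 1 (d := 1) one_ne_zero
    simpa [add_comm] using this
  have hB := (hlin 3).rpow_const (p := b - 1) (Or.inl one_ne_zero)
  have := (hA.mul (hlin 2)).mul hB
  simpa using this

theorem exists_psi_le {b : ℝ} (hb : 0 < b) :
    ∃ C > 0, ∀ k : ℕ, psi b k ≤ C * ((k : ℝ) + 1) ^ (b - 1) := by
  obtain ⟨C, hC⟩ := (tendsto_psi_mul_rpow hb).bddAbove_range
  have hG := Real.Gamma_pos_of_pos hb
  refine ⟨max C 1 / Real.Gamma b, by positivity, fun k => ?_⟩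
  have h : psi b k * Real.Gamma b * ((k : ℝ) + 1) ^ (1 - b) ≤ max C 1 :=
    (hC ⟨k, rfl⟩).trans (le_max_left _ _)
  have hk : (0 : ℝ) < (k : ℝ) + 1 := by positivity
  rw [show 1 - b = -(b - 1) by ring, Real.rpow_neg hk.le, ← div_eq_mul_inv,
    div_le_iff₀ (by positivity)] at h
  rw [div_mul_eq_mul_div, le_div_iff₀ hG]
  exact h

/-- The correction factor removes the second term of the asymptotic expansion. The normalised
sequence then moves by O((k+1)^(-3)) per step, hence is within O((k+1)^(-2)) of its limit 1. -/
theorem exists_psi_asymp {b : ℝ} (hb1 : 1 ≤ b) (hb3 : b ≤ 3) :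
    ∃ C > 0, ∀ k : ℕ, |psi b k * (1 + (b - 1) * (2 - b) / 2 / (k + 1))
      - ((k : ℝ) + 1) ^ (b - 1) / Real.Gamma b| ≤ C * ((k : ℝ) + 1) ^ (b - 3) := by
  have hb : 0 < b := by linarith
  have hG := Real.Gamma_pos_of_pos hb
  set c := (b - 1) * (2 - b) / 2 with hc
  obtain ⟨C, hC0, hC⟩ := exists_psi_le hb
  set x : ℕ → ℝ := fun k => psi b k * Real.Gamma b * ((k : ℝ) + 1) ^ (1 - b) * (1 + c / (k + 1))
    with hx
  have hlim : Tendsto x atTop (nhds 1) := by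
    have h1 : Tendsto (fun k : ℕ => 1 + c / ((k : ℝ) + 1)) atTop (nhds (1 + 0)) := by
      refine tendsto_const_nhds.add (Tendsto.const_div_atTop ?_ _)
      exact tendsto_atTop_add_const_right _ _ tendsto_natCast_atTop_atTop
    simpa using (tendsto_psi_mul_rpow hb).mul h1
  have hstep : ∀ k : ℕ, |x (k + 1) - x k| ≤ (C * Real.Gamma b * 15) / ((k : ℝ) + 1) ^ 3 := by
    intro k
    set l : ℝ := (k : ℝ) + 1 with hl
    have hl1 : 1 ≤ l := by simp [hl]
    have hl0 : 0 < l := by linarith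
    have hy : 1 / l ∈ Icc (0 : ℝ) 1 := ⟨by positivity, by rw [div_le_one hl0]; exact hl1⟩
    have h := abs_ratio_defect_le hb1 hb3 hy
    have h1y : (1 + 1 / l) ^ (1 - b) = (1 + 1 / l) / (1 + 1 / l) ^ b := by
      rw [Real.rpow_sub (by positivity), Real.rpow_one]
    have h1yb : 1 ≤ (1 + 1 / l) ^ b := Real.one_le_rpow (by linarith [hy.1]) hb.le
    have hl2 : (l + 1) ^ (1 - b) = l ^ (1 - b) * (1 + 1 / l) ^ (1 - b) := by
      rw [← Real.mul_rpow hl0.le (by positivity)]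
      congr 1
      field_simp
    have e : x (k + 1) - x k = psi b k * Real.Gamma b * l ^ (1 - b) / (1 + 1 / l) ^ b *
        ((1 + (b - 1) * (1 / l)) * (1 + (1 + c) * (1 / l))
          - (1 + 1 / l) ^ b * (1 + c * (1 / l))) := by
      simp only [hx]
      rw [psi_succ]
      push_cast
      rw [← hl, hl2, h1y]
      have : b + k = l + (b - 1) := by rw [hl]; ring
      rw [this]
      have : (1 + 1 / l) ^ b ≠ 0 := by positivity
      field_simp
      ring
    have hW : psi b k * l ^ (1 - b) ≤ C := by
      have := hC k
      rw [← hl] at this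
      rw [show 1 - b = -(b - 1) by ring, Real.rpow_neg hl0.le, ← div_eq_mul_inv,
        div_le_iff₀ (by positivity)]
      exact this
    have hp := psi_nonneg hb.le k
    have hW0 : 0 ≤ psi b k * l ^ (1 - b) := by positivity
    rw [e, abs_mul]
    calc _ ≤ (C * Real.Gamma b) * (15 * (1 / l) ^ 3) := by
          gcongr
          rw [abs_of_nonneg (by positivity)]
          refine (div_le_self (by positivity) h1yb).trans ?_
          nlinarith
      _ = _ := by field_simp
  have hfin := abs_sub_le_of_tendsto hlim hstep
  refine ⟨2 * (C * Real.Gamma b * 15) / Real.Gamma b, by positivity, fun k => ?_⟩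
  have h := hfin k
  have hl0 : (0 : ℝ) < (k : ℝ) + 1 := by positivity
  have e : psi b k * (1 + c / (k + 1)) - ((k : ℝ) + 1) ^ (b - 1) / Real.Gamma b
      = (x k - 1) * (((k : ℝ) + 1) ^ (b - 1) / Real.Gamma b) := by
    simp only [hx]
    rw [show 1 - b = -(b - 1) by ring, Real.rpow_neg hl0.le]
    have : ((k : ℝ) + 1) ^ (b - 1) ≠ 0 := by positivity
    field_simp
  rw [e, abs_mul, abs_of_nonneg (by positivity : 0 ≤ ((k : ℝ) + 1) ^ (b - 1) / Real.Gamma b)]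
  calc _ ≤ 2 * (C * Real.Gamma b * 15) / ((k : ℝ) + 1) ^ 2
        * (((k : ℝ) + 1) ^ (b - 1) / Real.Gamma b) := by gcongr
    _ = _ := by
      rw [show b - 3 = (b - 1) - (2 : ℕ) by push_cast; ring, Real.rpow_sub_natCast hl0.ne']
      ring

/-! ### The Peano kernels of the weighted and shifted formula -/

theorem psi_succ_sub (b : ℝ) (k : ℕ) : psi b (k + 1) - psi b k = psi (b - 1) (k + 1) := by
  have h : glSeries (-(b - 1)) = glSeries (-b) * (1 - PowerSeries.X) := by
    rw [← glSeries_one, ← glSeries_add]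
    congr 1
    ring
  have h2 := congrArg (PowerSeries.coeff (k + 1)) h
  rw [mul_sub, mul_one, map_sub, PowerSeries.coeff_succ_mul_X, glSeries_neg_eq,
    glSeries_neg_eq] at h2
  simpa using h2.symm

/-- Trades order b - 1 for order b at the price of a factor k; this brings the lower-order parts of
the weights into the shape of the correction factor in `exists_psi_asymp`. -/
theorem add_mul_psi_sub_one (b : ℝ) (k : ℕ) : (b - 1 + k) * psi (b - 1) k = (b - 1) * psi b k := by
  induction k with
  | zero => simp [psi_zero]
  | succ k ih =>
    have hk : (k : ℝ) + 1 ≠ 0 := by positivity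
    rw [psi_succ, psi_succ]
    push_cast
    field_simp
    linear_combination (b + k) * ih

/-- The primitive `s ^ (1 - α) / Γ(2 - α)` of the Caputo kernel. -/
def kerInt (α s : ℝ) : ℝ := s ^ (1 - α) / Real.Gamma (2 - α)

/-- The Caputo kernel `s ^ (-α) / Γ(1 - α)`, understood as `0` for `α = 1`. -/
def ker (α s : ℝ) : ℝ := (1 - α) * s ^ (-α) / Real.Gamma (2 - α)

/-- The second primitive of the Caputo kernel. -/
def kerInt₂ (α s : ℝ) : ℝ := s ^ (2 - α) / Real.Gamma (3 - α)

/-- The defect of the summed weights at the nodes. -/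
def defect (α : ℝ) (l : ℕ) : ℝ := kerInt α l - kapSum α l

/-- The integrated defect at the nodes. -/
def defectInt (α : ℝ) (l : ℕ) : ℝ :=
  kerInt₂ α l - ∑ i ∈ Finset.range l, (kapSum α i + kapSum α (i + 1)) / 2

/-- The defect on the cell `[l, l + 1]`. -/
def cellDefect (α : ℝ) (l : ℕ) (s : ℝ) : ℝ := kerInt α s - kapSum α l - kap α l * (s - l)

/-- The integrated defect on the cell `[l, l + 1]`. -/
def cellDefectInt (α : ℝ) (l : ℕ) (s : ℝ) : ℝ :=
  defectInt α l + (kerInt₂ α s - kerInt₂ α l - kapSum α l * (s - l) - kap α l * (s - l) ^ 2 / 2)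

theorem Gamma_two_sub_pos {α : ℝ} (hα1 : α ≤ 1) : 0 < Real.Gamma (2 - α) :=
  Real.Gamma_pos_of_pos (by linarith)

theorem hasDerivAt_kerInt (α : ℝ) {s : ℝ} (hs : 0 < s) : HasDerivAt (kerInt α) (ker α s) s := by
  have h := (Real.hasDerivAt_rpow_const (p := 1 - α) (Or.inl hs.ne')).div_const (Real.Gamma (2 - α))
  rw [show 1 - α - 1 = -α by ring] at h
  exact h

theorem hasDerivAt_kerInt₂ {α : ℝ} (hα1 : α ≤ 1) (s : ℝ) :
    HasDerivAt (kerInt₂ α) (kerInt α s) s := by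
  have h := (Real.hasDerivAt_rpow_const (x := s) (p := 2 - α) (Or.inr (by linarith))).div_const
    (Real.Gamma (3 - α))
  refine h.congr_deriv ?_
  have h1 : (0 : ℝ) < 2 - α := by linarith
  have hG := (Gamma_two_sub_pos hα1).ne'
  rw [show 3 - α = (2 - α) + 1 by ring, Real.Gamma_add_one h1.ne', show 2 - α - 1 = 1 - α by ring,
    kerInt]
  field_simp

theorem hasDerivAt_ker (α : ℝ) {s : ℝ} (hs : 0 < s) :
    HasDerivAt (ker α) ((1 - α) * (-α * s ^ (-α - 1)) / Real.Gamma (2 - α)) s :=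
  ((Real.hasDerivAt_rpow_const (p := -α) (Or.inl hs.ne')).const_mul (1 - α)).div_const _

theorem continuous_kerInt {α : ℝ} (hα1 : α ≤ 1) : Continuous (kerInt α) :=
  (Real.continuous_rpow_const (by linarith)).div_const _

/-- Neighbouring cell functions agree at their common node, here and in the next three lemmas, so
the boundary terms of cellwise integration by parts telescope. -/
theorem cellDefect_left (α : ℝ) (l : ℕ) : cellDefect α l l = defect α l := by
  simp [cellDefect, defect]

theorem cellDefect_right (α : ℝ) (l : ℕ) : cellDefect α l (l + 1) = defect α (l + 1) := by
  simp [cellDefect, defect, kap]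

theorem cellDefectInt_left (α : ℝ) (l : ℕ) : cellDefectInt α l l = defectInt α l := by
  simp [cellDefectInt]

theorem cellDefectInt_right (α : ℝ) (l : ℕ) :
    cellDefectInt α l (l + 1) = defectInt α (l + 1) := by
  simp only [cellDefectInt, defectInt, kap, Finset.sum_range_succ]
  push_cast
  ring

theorem hasDerivAt_cellDefect (α : ℝ) (l : ℕ) {s : ℝ} (hs : 0 < s) :
    HasDerivAt (cellDefect α l) (ker α s - kap α l) s := by
  refine (((hasDerivAt_kerInt α hs).sub_const (kapSum α l)).sub
    (((hasDerivAt_id s).sub_const (l : ℝ)).const_mul (kap α l))).congr_deriv ?_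
  simp

theorem hasDerivAt_cellDefectInt {α : ℝ} (hα1 : α ≤ 1) (l : ℕ) (s : ℝ) :
    HasDerivAt (cellDefectInt α l) (cellDefect α l s) s := by
  have h1 := (hasDerivAt_id s).sub_const (l : ℝ)
  refine (((((hasDerivAt_kerInt₂ hα1 s).sub_const (kerInt₂ α l)).sub
    (h1.const_mul (kapSum α l))).sub (((h1.pow 2).const_mul (kap α l)).div_const 2)).const_add
      (defectInt α l)).congr_deriv ?_
  simp [cellDefect]
  ring

theorem continuous_cellDefect {α : ℝ} (hα1 : α ≤ 1) (l : ℕ) : Continuous (cellDefect α l) := by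
  have := continuous_kerInt hα1
  unfold cellDefect
  fun_prop

theorem continuous_cellDefectInt {α : ℝ} (hα1 : α ≤ 1) (l : ℕ) :
    Continuous (cellDefectInt α l) :=
  continuous_iff_continuousAt.2 fun s => (hasDerivAt_cellDefectInt hα1 l s).continuousAt

theorem rpow_le_of_le_two_mul {q x y : ℝ} (hxy : y ≤ 2 * x) (hy : 0 < y)
    (hq : q ≤ 0) (hq2 : -2 ≤ q) : x ^ q ≤ 4 * y ^ q := by
  have h1 : x ^ q ≤ (y / 2) ^ q := Real.rpow_le_rpow_of_nonpos (by positivity) (by linarith) hq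
  rw [Real.div_rpow hy.le (by norm_num)] at h1
  have h2 : (1 / 4 : ℝ) ≤ 2 ^ q := by
    calc (1 / 4 : ℝ) = 2 ^ (-2 : ℝ) := by
          rw [Real.rpow_neg (by norm_num)]; norm_num
      _ ≤ _ := Real.rpow_le_rpow_of_exponent_le (by norm_num) hq2
  refine h1.trans ?_
  rw [div_le_iff₀ (by positivity)]
  nlinarith [show 0 < y ^ q by positivity]

/-- For α = 1 the formula is BDF2: `kap` has generating function 3/2 - z/2 and all defects vanish
from node 2 on. This replaces the decay l^(-1), whose sum would be logarithmic. -/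
theorem kapSum_one_succ_succ (k : ℕ) : kapSum 1 (k + 2) = 1 := by
  have h : psi 0 (k + 1) = 0 := by
    induction k with
    | zero => simp [psi_succ]
    | succ k ih => rw [psi_succ, ih, zero_mul]
  have h1 : (2 : ℝ) - 1 = 1 := by norm_num
  simp [kapSum, h1, psi_one, h]

theorem kap_one_succ_succ (k : ℕ) : kap 1 (k + 2) = 0 := by
  rw [kap, show k + 2 + 1 = (k + 1) + 2 by ring, kapSum_one_succ_succ, kapSum_one_succ_succ,
    sub_self]

theorem defectInt_one_succ_succ (k : ℕ) : defectInt 1 (k + 2) = 0 := by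
  induction k with
  | zero =>
    have h1 : (2 : ℝ) - 1 = 1 := by norm_num
    have h2 : (3 : ℝ) - 1 = 2 := by norm_num
    have h3 : kapSum 1 2 = 1 := kapSum_one_succ_succ 0
    simp only [defectInt, kerInt₂, Finset.sum_range_succ, Finset.sum_range_zero, h1, h2, zero_add]
    rw [h3]
    simp only [kapSum, sub_self, psi_zero, h1]
    norm_num
  | succ k ih =>
    have h1 : (2 : ℝ) - 1 = 1 := by norm_num
    have h2 : (3 : ℝ) - 1 = 2 := by norm_num
    simp only [defectInt, kerInt₂, h1, h2, Real.rpow_one, Real.Gamma_two] at ih ⊢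
    rw [show k + 1 + 2 = (k + 2) + 1 by ring, Finset.sum_range_succ, kapSum_one_succ_succ,
      kapSum_one_succ_succ (k + 1)]
    push_cast at ih ⊢
    linarith

theorem exists_psi_one_sub_le {α : ℝ} (hα : 0 < α) (hα1 : α ≤ 1) :
    ∃ C > 0, ∀ k : ℕ, psi (1 - α) k ≤ C * ((k : ℝ) + 1) ^ (-α) := by
  rcases hα1.lt_or_eq with h | h
  · obtain ⟨C, hC, hC'⟩ := exists_psi_le (b := 1 - α) (by linarith)
    refine ⟨C, hC, fun k => ?_⟩
    have := hC' k
    rwa [show 1 - α - 1 = -α by ring] at this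
  · refine ⟨1, one_pos, fun k => ?_⟩
    subst h
    cases k with
    | zero => simp [psi_zero]
    | succ k =>
      have h1 := psi_succ_sub 1 k
      rw [psi_one, psi_one, sub_self] at h1
      rw [sub_self, ← h1]
      positivity

/-- Here the shift correction α/2 in the weights pays off. With y = k + 1, `kapSum α (k + 1)` equals
`psi (2 - α) k` times 1 + α(1-α)/(2y), up to O(y^(-1-α)); this is the product that
`exists_psi_asymp` compares with y^(1-α)/Γ(2-α), so the l^(-α) term cancels. -/
theorem exists_defect_le {α : ℝ} (hα : 0 < α) (hα1 : α ≤ 1) :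
    ∃ C > 0, ∀ l : ℕ, |defect α l| ≤ C * ((l : ℝ) + 1) ^ (-1 - α) := by
  obtain ⟨C1, hC1, h1⟩ := exists_psi_asymp (b := 2 - α) (by linarith) (by linarith)
  obtain ⟨C2, hC2, h2⟩ := exists_psi_one_sub_le hα hα1
  refine ⟨4 * (C1 + C2) + |defect α 0|, by positivity, fun l => ?_⟩
  cases l with
  | zero =>
    simp only [Nat.cast_zero, zero_add, Real.one_rpow, mul_one]
    linarith
  | succ k =>
    set y : ℝ := (k : ℝ) + 1 with hy
    have hy0 : 0 < y := by positivity
    have hcmp : y ^ (-1 - α) ≤ 4 * (((k + 1 : ℕ) : ℝ) + 1) ^ (-1 - α) :=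
      rpow_le_of_le_two_mul (by push_cast; simp only [hy]; linarith [k.cast_nonneg (α := ℝ)])
        (by positivity) (by linarith) (by linarith)
    have ha := h1 k
    rw [show (2 - α - 1) = 1 - α by ring, show 2 - (2 - α) = α by ring,
      show 2 - α - 3 = -1 - α by ring, ← hy] at ha
    have hb := h2 k
    rw [← hy] at hb
    have hrel := add_mul_psi_sub_one (2 - α) k
    rw [show 2 - α - 1 = 1 - α by ring] at hrel
    have e : defect α (k + 1) = -(psi (2 - α) k * (1 + (1 - α) * α / 2 / y)
        - y ^ (1 - α) / Real.Gamma (2 - α)) - (α ^ 2 / 2 * psi (1 - α) k) / y := by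
      simp only [defect, kerInt, kapSum]
      push_cast
      rw [← hy]
      have h3 : (y - α) * psi (1 - α) k = (1 - α) * psi (2 - α) k := by
        rw [← hrel, hy]; ring
      have h4 : psi (1 - α) k = ((1 - α) * psi (2 - α) k + α * psi (1 - α) k) / y := by
        rw [← h3]; field_simp; ring
      field_simp at h4 ⊢
      linear_combination (-α) * h4
    rw [e]
    have hp := psi_nonneg (b := 1 - α) (by linarith) k
    have h5 : |(α ^ 2 / 2 * psi (1 - α) k) / y| ≤ C2 * y ^ (-1 - α) := by
      rw [abs_of_nonneg (by positivity), show -1 - α = -α - 1 by ring, Real.rpow_sub_one hy0.ne',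
        ← mul_div_assoc]
      refine div_le_div_of_nonneg_right (le_trans ?_ hb) hy0.le
      have : α ^ 2 / 2 ≤ 1 := by nlinarith
      nlinarith
    calc _ ≤ C1 * y ^ (-1 - α) + C2 * y ^ (-1 - α) := by
          refine (abs_sub _ _).trans ?_
          rw [abs_neg]
          exact add_le_add ha h5
      _ = (C1 + C2) * y ^ (-1 - α) := by ring
      _ ≤ (C1 + C2) * (4 * (((k + 1 : ℕ) : ℝ) + 1) ^ (-1 - α)) := by gcongr
      _ = (4 * (C1 + C2)) * (((k + 1 : ℕ) : ℝ) + 1) ^ (-1 - α) := by ring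
      _ ≤ _ := by
        gcongr
        exact le_add_of_nonneg_right (abs_nonneg _)

theorem sum_kapSum (α : ℝ) (k : ℕ) :
    ∑ i ∈ Finset.range (k + 1), (kapSum α i + kapSum α (i + 1)) / 2
      = psi (3 - α) k - (1 - α) / 2 * psi (2 - α) k - α / 4 * psi (1 - α) k := by
  induction k with
  | zero =>
    simp [kapSum, psi_zero]
    ring
  | succ k ih =>
    rw [Finset.sum_range_succ, ih]
    have h3 := psi_succ_sub (3 - α) k
    have h2 := psi_succ_sub (2 - α) k
    rw [show 3 - α - 1 = 2 - α by ring] at h3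
    rw [show 2 - α - 1 = 1 - α by ring] at h2
    simp only [kapSum]
    linear_combination -h3 + (1 - α) / 2 * h2 - h2 / 2

/-- The same comparison one order higher. The closed form `sum_kapSum` has no additive constant; the
terms of order l^(2-α) and l^(1-α) cancel, and what remains decays. -/
theorem exists_defectInt_le {α : ℝ} (hα : 0 < α) (hα1 : α ≤ 1) :
    ∃ C > 0, ∀ l : ℕ, |defectInt α l| ≤ C * ((l : ℝ) + 1) ^ (-α) := by
  obtain ⟨C1, hC1, h1⟩ := exists_psi_asymp (b := 3 - α) (by linarith) (by linarith)
  obtain ⟨C2, hC2, h2⟩ := exists_psi_one_sub_le hα hα1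
  obtain ⟨C3, hC3, h3⟩ := exists_psi_le (b := 2 - α) (by linarith)
  refine ⟨4 * (C1 + C2 + C3) + |defectInt α 0|, by positivity, fun l => ?_⟩
  cases l with
  | zero =>
    simp only [Nat.cast_zero, zero_add, Real.one_rpow, mul_one]
    linarith
  | succ k =>
    set y : ℝ := (k : ℝ) + 1 with hy
    have hy0 : 0 < y := by positivity
    have hcmp : y ^ (-α) ≤ 4 * (((k + 1 : ℕ) : ℝ) + 1) ^ (-α) :=
      rpow_le_of_le_two_mul (by push_cast; simp only [hy]; linarith [k.cast_nonneg (α := ℝ)])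
        (by positivity) (by linarith) (by linarith)
    have ha := h1 k
    rw [show (3 - α - 1) = 2 - α by ring, show 2 - (3 - α) = α - 1 by ring,
      show 3 - α - 3 = -α by ring, ← hy] at ha
    have hb := h2 k
    have hc := h3 k
    rw [← hy] at hb
    rw [← hy, show 2 - α - 1 = 1 - α by ring] at hc
    have hrel := add_mul_psi_sub_one (3 - α) k
    rw [show 3 - α - 1 = 2 - α by ring] at hrel
    have e : defectInt α (k + 1) = -(psi (3 - α) k * (1 + (2 - α) * (α - 1) / 2 / y)
        - y ^ (2 - α) / Real.Gamma (3 - α)) - ((1 - α) ^ 2 / 2 * psi (2 - α) k) / y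
        + α / 4 * psi (1 - α) k := by
      simp only [defectInt, kerInt₂, sum_kapSum]
      push_cast
      rw [← hy]
      have h3 : (y + (1 - α)) * psi (2 - α) k = (2 - α) * psi (3 - α) k := by
        rw [← hrel, hy]; ring
      have h4 : psi (2 - α) k
          = ((2 - α) * psi (3 - α) k - (1 - α) * psi (2 - α) k) / y := by
        rw [← h3]; field_simp; ring
      field_simp at h4 ⊢
      linear_combination (4 * (1 - α)) * h4
    rw [e]
    have hp := psi_nonneg (b := 1 - α) (by linarith) k
    have hp2 := psi_nonneg (b := 2 - α) (by linarith) k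
    have h5 : |((1 - α) ^ 2 / 2 * psi (2 - α) k) / y| ≤ C3 * y ^ (-α) := by
      rw [abs_of_nonneg (by positivity), show -α = (1 - α) - 1 by ring, Real.rpow_sub_one hy0.ne',
        ← mul_div_assoc]
      refine div_le_div_of_nonneg_right (le_trans ?_ hc) hy0.le
      have : (1 - α) ^ 2 / 2 ≤ 1 := by nlinarith
      nlinarith
    have h6 : |α / 4 * psi (1 - α) k| ≤ C2 * y ^ (-α) := by
      rw [abs_of_nonneg (by positivity)]
      refine le_trans ?_ hb
      nlinarith
    calc _ ≤ C1 * y ^ (-α) + C3 * y ^ (-α) + C2 * y ^ (-α) := by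
          refine (abs_add_le _ _).trans (add_le_add ((abs_sub _ _).trans ?_) h6)
          rw [abs_neg]
          exact add_le_add ha h5
      _ = (C1 + C2 + C3) * y ^ (-α) := by ring
      _ ≤ (C1 + C2 + C3) * (4 * (((k + 1 : ℕ) : ℝ) + 1) ^ (-α)) := by gcongr
      _ = (4 * (C1 + C2 + C3)) * (((k + 1 : ℕ) : ℝ) + 1) ^ (-α) := by ring
      _ ≤ _ := by
        gcongr
        exact le_add_of_nonneg_right (abs_nonneg _)

/-- `kap α l` is a value of `ker α` inside the cell plus a difference of two nodal defects, and `ker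
α` varies by O(l^(-1-α)) over the cell. The cell l = 0 is excluded because of the singularity at 0.
-/
theorem exists_abs_ker_sub_kap_le {α : ℝ} (hα : 0 < α) (hα1 : α ≤ 1) :
    ∃ C > 0, ∀ l : ℕ, 1 ≤ l → ∀ s ∈ Icc (l : ℝ) (l + 1),
      |ker α s - kap α l| ≤ C * ((l : ℝ) + 1) ^ (-1 - α) := by
  obtain ⟨C, hC, hd⟩ := exists_defect_le hα hα1
  have hG := Gamma_two_sub_pos hα1
  refine ⟨4 / Real.Gamma (2 - α) + 2 * C, by positivity, fun l hl s hs => ?_⟩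
  have hl0 : (0 : ℝ) < l := by exact_mod_cast hl
  have hl1 : (1 : ℝ) ≤ l := by exact_mod_cast hl
  have hanti : ∀ x y : ℝ, (l : ℝ) ≤ x → x ≤ y → ker α y ≤ ker α x := by
    intro x y hx hxy
    have h1 : 0 ≤ 1 - α := by linarith
    have := Real.rpow_le_rpow_of_nonpos (by linarith) hxy (by linarith : -α ≤ 0)
    unfold ker
    gcongr
  obtain ⟨ξ, hξ, hξe⟩ := exists_hasDerivAt_eq_slope (kerInt α) (ker α)
    (lt_add_one (l : ℝ)) (continuous_kerInt hα1).continuousOn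
    (fun x hx => hasDerivAt_kerInt α (hl0.trans hx.1))
  have hdec : ker α l - ker α (l + 1) ≤ 4 / Real.Gamma (2 - α) * ((l : ℝ) + 1) ^ (-1 - α) := by
    obtain ⟨η, hη, hηe⟩ := exists_hasDerivAt_eq_slope (ker α) _ (lt_add_one (l : ℝ))
      (fun x hx => (hasDerivAt_ker α (hl0.trans_le hx.1)).continuousAt.continuousWithinAt)
      (fun x hx => hasDerivAt_ker α (hl0.trans hx.1))
    have h1 : η ^ (-α - 1) ≤ 4 * ((l : ℝ) + 1) ^ (-1 - α) := by
      rw [show -α - 1 = -1 - α by ring]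
      exact rpow_le_of_le_two_mul (by linarith [hη.1]) (by positivity) (by linarith)
        (by linarith)
    have h2 : 0 ≤ η ^ (-α - 1) := Real.rpow_nonneg (hl0.trans hη.1).le _
    have h3 : (1 - α) * α ≤ 1 := by nlinarith
    have h4 : ker α l - ker α (l + 1)
        = (1 - α) * α * η ^ (-α - 1) / Real.Gamma (2 - α) := by
      rw [show (l : ℝ) + 1 - l = 1 by ring, div_one] at hηe
      linarith [show (1 - α) * (-α * η ^ (-α - 1)) / Real.Gamma (2 - α)
        = -((1 - α) * α * η ^ (-α - 1) / Real.Gamma (2 - α)) by ring]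
    rw [h4, div_mul_eq_mul_div]
    refine div_le_div_of_nonneg_right ?_ hG.le
    exact (mul_le_of_le_one_left h2 h3).trans h1
  have hk : kap α l = ker α ξ - defect α (l + 1) + defect α l := by
    rw [hξe]
    simp only [kap, defect]
    push_cast
    ring
  have hξ1 := hanti ξ (l + 1) hξ.1.le hξ.2.le
  have hξ2 := hanti l ξ le_rfl hξ.1.le
  have hs1 := hanti s (l + 1) hs.1 hs.2
  have hs2 := hanti l s le_rfl hs.1
  have hd1 := abs_le.1 (hd l)
  have hd2 : |defect α (l + 1)| ≤ C * ((l : ℝ) + 1) ^ (-1 - α) := by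
    refine (hd (l + 1)).trans ?_
    push_cast
    have := Real.rpow_le_rpow_of_nonpos (by positivity) (by linarith : (l : ℝ) + 1 ≤ l + 1 + 1)
      (by linarith : -1 - α ≤ 0)
    gcongr
  have hd3 := abs_le.1 hd2
  rw [hk, abs_le]
  constructor <;> linarith

theorem exists_cellDefect_le {α : ℝ} (hα : 0 < α) (hα1 : α ≤ 1) :
    ∃ C > 0, ∀ l : ℕ, ∀ s ∈ Icc (l : ℝ) (l + 1),
      |cellDefect α l s| ≤ C * ((l : ℝ) + 1) ^ (-1 - α) := by
  obtain ⟨C, hC, hd⟩ := exists_defect_le hα hα1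
  obtain ⟨C', hC', hk⟩ := exists_abs_ker_sub_kap_le hα hα1
  -- On the first cell the derivative may be unbounded near 0, so compactness replaces the mean
  -- value inequality.
  obtain ⟨B, hB⟩ := isCompact_Icc.exists_bound_of_continuousOn
    (continuous_cellDefect hα1 0).continuousOn (s := Icc (0 : ℝ) 1)
  refine ⟨C + C' + |B|, by positivity, fun l s hs => ?_⟩
  have hp : 0 ≤ ((l : ℝ) + 1) ^ (-1 - α) := by positivity
  rcases Nat.eq_zero_or_pos l with rfl | hl
  · have := hB s (by simpa using hs)
    simp only [Nat.cast_zero, zero_add, Real.one_rpow, mul_one]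
    rw [Real.norm_eq_abs] at this
    linarith [le_abs_self B]
  · have hl0 : (0 : ℝ) < l := by exact_mod_cast hl
    have h := Convex.norm_image_sub_le_of_norm_hasDerivWithin_le (f := cellDefect α l)
      (s := Icc (l : ℝ) (l + 1)) (x := l) (y := s)
      (fun z hz => (hasDerivAt_cellDefect α l (hl0.trans_le hz.1)).hasDerivWithinAt)
      (fun z hz => hk l hl z hz) (convex_Icc _ _) ⟨le_rfl, by linarith⟩ hs
    rw [cellDefect_left, Real.norm_eq_abs, Real.norm_eq_abs,
      abs_of_nonneg (by linarith [hs.1] : 0 ≤ s - l)] at h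
    have h2 : C' * ((l : ℝ) + 1) ^ (-1 - α) * (s - l) ≤ C' * ((l : ℝ) + 1) ^ (-1 - α) :=
      mul_le_of_le_one_right (by positivity) (by linarith [hs.2])
    have h3 := abs_sub_abs_le_abs_sub (cellDefect α l s) (defect α l)
    have h4 := hd l
    nlinarith [mul_nonneg (abs_nonneg B) hp]

theorem exists_cellDefectInt_le {α : ℝ} (hα : 0 < α) (hα1 : α ≤ 1) :
    ∃ C > 0, ∀ l : ℕ, ∀ s ∈ Icc (l : ℝ) (l + 1),
      |cellDefectInt α l s| ≤ C * ((l : ℝ) + 1) ^ (-α) := by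
  obtain ⟨C, hC, hd⟩ := exists_defectInt_le hα hα1
  obtain ⟨C', hC', hk⟩ := exists_cellDefect_le hα hα1
  refine ⟨C + C', by positivity, fun l s hs => ?_⟩
  have h := Convex.norm_image_sub_le_of_norm_hasDerivWithin_le (f := cellDefectInt α l)
    (s := Icc (l : ℝ) (l + 1)) (x := l) (y := s)
    (fun z _ => (hasDerivAt_cellDefectInt hα1 l z).hasDerivWithinAt)
    (fun z hz => hk l z hz) (convex_Icc _ _) ⟨le_rfl, by linarith⟩ hs
  rw [cellDefectInt_left, Real.norm_eq_abs, Real.norm_eq_abs,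
    abs_of_nonneg (by linarith [hs.1] : 0 ≤ s - l)] at h
  have h2 : C' * ((l : ℝ) + 1) ^ (-1 - α) * (s - l) ≤ C' * ((l : ℝ) + 1) ^ (-1 - α) :=
    mul_le_of_le_one_right (by positivity) (by linarith [hs.2])
  have h5 : ((l : ℝ) + 1) ^ (-1 - α) ≤ ((l : ℝ) + 1) ^ (-α) :=
    Real.rpow_le_rpow_of_exponent_le (by linarith [l.cast_nonneg (α := ℝ)]) (by linarith)
  have h3 := abs_sub_abs_le_abs_sub (cellDefectInt α l s) (defectInt α l)
  have h4 := hd l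
  nlinarith

theorem sum_psi (b : ℝ) (n : ℕ) : ∑ k ∈ Finset.range (n + 1), psi b k = psi (b + 1) n := by
  have h := sum_psi_mul_psi 1 b n
  simp only [psi_one, one_mul] at h
  rw [h, add_comm]

/-- For α < 1 the powers l^(-α) are dominated by `psi (1 - α)`, whose partial sums are `psi (2 -
α)`. For α = 1 only two cells contribute. The majorant `h` lets both cases share one statement. -/
theorem exists_sum_cellDefectInt_le {α : ℝ} (hα : 0 < α) (hα1 : α ≤ 1) :
    ∃ C > 0, ∃ h : ℕ → ℝ, (∀ l : ℕ, ∀ s ∈ Icc (l : ℝ) (l + 1), |cellDefectInt α l s| ≤ h l) ∧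
      ∀ p : ℕ, ∑ l ∈ Finset.range (p + 1), h l ≤ C * ((p : ℝ) + 1) ^ (1 - α) := by
  obtain ⟨C, hC, hd⟩ := exists_cellDefectInt_le hα hα1
  rcases hα1.lt_or_eq with h1 | h1
  · obtain ⟨C2, hC2, h2⟩ := exists_psi_le (b := 2 - α) (by linarith)
    have hα2 : 0 < 1 - α := by linarith
    refine ⟨C * (1 / (1 - α)) * C2 * 2, by positivity,
      fun l => C * ((l : ℝ) + 1) ^ (-α), hd, fun p => ?_⟩
    have h3 : ∀ l : ℕ, ((l : ℝ) + 1) ^ (-α) ≤ 1 / (1 - α) * psi (1 - α) (l + 1) := by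
      intro l
      have h := mul_rpow_le_psi hα2 (by linarith) (Nat.succ_le_succ (Nat.zero_le l))
      rw [one_div, ← div_eq_inv_mul, le_div_iff₀ hα2, mul_comm]
      simpa using h
    have h4 : ∑ l ∈ Finset.range (p + 1), psi (1 - α) (l + 1) ≤ psi (2 - α) (p + 1) := by
      have h := sum_psi (1 - α) (p + 1)
      rw [Finset.sum_range_succ', show 1 - α + 1 = 2 - α by ring] at h
      rw [← h]
      exact le_add_of_nonneg_right (psi_nonneg hα2.le 0)
    have h5 : psi (2 - α) (p + 1) ≤ C2 * (2 * ((p : ℝ) + 1) ^ (1 - α)) := by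
      refine (h2 (p + 1)).trans ?_
      rw [show 2 - α - 1 = 1 - α by ring]
      push_cast
      gcongr
      calc ((p : ℝ) + 1 + 1) ^ (1 - α) ≤ (2 * ((p : ℝ) + 1)) ^ (1 - α) := by
            gcongr; linarith [p.cast_nonneg (α := ℝ)]
        _ = 2 ^ (1 - α) * ((p : ℝ) + 1) ^ (1 - α) := by
            rw [Real.mul_rpow (by norm_num) (by positivity)]
        _ ≤ 2 * ((p : ℝ) + 1) ^ (1 - α) := by
            gcongr
            calc (2 : ℝ) ^ (1 - α) ≤ 2 ^ (1 : ℝ) :=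
                  Real.rpow_le_rpow_of_exponent_le (by norm_num) (by linarith)
              _ = 2 := by simp
    rw [← Finset.mul_sum]
    calc _ ≤ C * ∑ l ∈ Finset.range (p + 1), 1 / (1 - α) * psi (1 - α) (l + 1) := by
          gcongr with l _
          exact h3 l
      _ = C * (1 / (1 - α)) * ∑ l ∈ Finset.range (p + 1), psi (1 - α) (l + 1) := by
          rw [← Finset.mul_sum]; ring
      _ ≤ C * (1 / (1 - α)) * (C2 * (2 * ((p : ℝ) + 1) ^ (1 - α))) := by
          gcongr
          exact h4.trans h5
      _ = _ := by ring
  · subst h1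
    refine ⟨2 * C, by positivity, fun l => if l < 2 then C else 0, fun l s hs => ?_, fun p => ?_⟩
    · rcases Nat.lt_or_ge l 2 with hl | hl
      · simp only [hl, if_true]
        refine (hd l s hs).trans (mul_le_of_le_one_right hC.le ?_)
        exact Real.rpow_le_one_of_one_le_of_nonpos (by linarith [l.cast_nonneg (α := ℝ)])
          (by norm_num)
      · obtain ⟨k, rfl⟩ := Nat.exists_eq_add_of_le' hl
        have hk : ¬ k + 2 < 2 := by omega
        simp only [hk, if_false]
        have h1 : (2 : ℝ) - 1 = 1 := by norm_num
        have h2 : (3 : ℝ) - 1 = 2 := by norm_num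
        simp only [cellDefectInt, defectInt_one_succ_succ, kapSum_one_succ_succ,
          kap_one_succ_succ, kerInt₂, h1, h2, Real.rpow_one, Real.Gamma_two]
        simp
    · simp only [sub_self, Real.rpow_zero, mul_one]
      rw [← Finset.sum_filter, Finset.sum_const, nsmul_eq_mul]
      gcongr
      have : ((Finset.range (p + 1)).filter (· < 2)).card ≤ (Finset.range 2).card :=
        Finset.card_le_card fun x hx => by
          simp only [Finset.mem_filter, Finset.mem_range] at hx ⊢
          exact hx.2
      simp only [Finset.card_range] at this
      exact_mod_cast this

/-! ### Truncation error of the uncorrected formula for a power -/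

theorem integral_rpow_mul_sub_rpow {a b x : ℝ} (ha : 0 < a) (hb : 0 < b) (hx : 0 < x) :
    ∫ s in (0 : ℝ)..x, s ^ (a - 1) * (x - s) ^ (b - 1)
      = x ^ (a + b - 1) * (Real.Gamma a * Real.Gamma b / Real.Gamma (a + b)) := by
  have h := Complex.betaIntegral_scaled (a : ℂ) (b : ℂ) hx
  rw [Complex.betaIntegral_eq_Gamma_mul_div _ _ (by simpa using ha) (by simpa using hb)] at h
  have h1 : ∫ s in (0 : ℝ)..x, (s : ℂ) ^ ((a : ℂ) - 1) * ((x : ℂ) - s) ^ ((b : ℂ) - 1)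
      = ∫ s in (0 : ℝ)..x, ((s ^ (a - 1) * (x - s) ^ (b - 1) : ℝ) : ℂ) := by
    refine intervalIntegral.integral_congr fun s hs => ?_
    rw [uIcc_of_le hx.le] at hs
    rw [Complex.ofReal_mul, Complex.ofReal_cpow hs.1, Complex.ofReal_cpow (by linarith [hs.2])]
    push_cast
    rfl
  rw [h1, intervalIntegral.integral_ofReal] at h
  apply Complex.ofReal_injective
  rw [h, Complex.ofReal_mul, Complex.ofReal_cpow hx.le]
  push_cast
  rw [Complex.Gamma_ofReal, Complex.Gamma_ofReal, ← Complex.ofReal_add, Complex.Gamma_ofReal]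

/-- The integral of a non-integrable function is 0 by convention, whereas the Beta integral is
positive. -/
theorem intervalIntegrable_rpow_mul_sub_rpow {a b x : ℝ} (ha : 0 < a) (hb : 0 < b) (hx : 0 < x) :
    IntervalIntegrable (fun s => s ^ (a - 1) * (x - s) ^ (b - 1)) volume 0 x := by
  apply intervalIntegral.intervalIntegrable_of_integral_ne_zero
  rw [integral_rpow_mul_sub_rpow ha hb hx]
  have h1 := Real.Gamma_pos_of_pos ha
  have h2 := Real.Gamma_pos_of_pos hb
  have h3 := Real.Gamma_pos_of_pos (add_pos ha hb)
  positivity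

/-- The Caputo derivative of order `α` of `t ^ σ` minus its weighted and shifted approximation
with unit step, at `n`. -/
def powErr (α σ : ℝ) (n : ℕ) : ℝ :=
  Real.Gamma (σ + 1) / Real.Gamma (σ + 1 - α) * (n : ℝ) ^ (σ - α)
    - ∑ k ∈ Finset.range (n + 1), wsglWeight α (n - k) * (k : ℝ) ^ σ

/-- For α < 1 this is the Beta integral and `kerInt α 0` is 0. For α = 1 the kernel is 0 and `kerInt
1 0` is 0^0/Γ(1) = 1, so the boundary term stands for the Dirac mass at lag 0. -/
theorem caputo_rpow_eq {α σ x : ℝ} (hα1 : α ≤ 1) (hσ : 0 < σ) (hx : 0 < x) :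
    Real.Gamma (σ + 1) / Real.Gamma (σ + 1 - α) * x ^ (σ - α)
      = kerInt α 0 * (σ * x ^ (σ - 1)) + ∫ s in (0 : ℝ)..x, ker α s * (σ * (x - s) ^ (σ - 1)) := by
  rcases hα1.lt_or_eq with h | rfl
  · have hG := (Real.Gamma_pos_of_pos (by linarith : 0 < 1 - α)).ne'
    have hb := integral_rpow_mul_sub_rpow (a := 1 - α) (b := σ) (by linarith) hσ hx
    have h1 : ∀ s, ker α s * (σ * (x - s) ^ (σ - 1))
        = σ / Real.Gamma (1 - α) * (s ^ (1 - α - 1) * (x - s) ^ (σ - 1)) := by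
      intro s
      rw [ker, show 2 - α = (1 - α) + 1 by ring, Real.Gamma_add_one (by linarith : 1 - α ≠ 0),
        show 1 - α - 1 = -α by ring]
      have : 1 - α ≠ 0 := by linarith
      field_simp
    simp_rw [h1]
    rw [intervalIntegral.integral_const_mul, hb, kerInt, Real.zero_rpow (by linarith),
      Real.Gamma_add_one hσ.ne', show 1 - α + σ - 1 = σ - α by ring,
      show 1 - α + σ = σ + 1 - α by ring]
    field_simp
    ring
  · have hG := (Real.Gamma_pos_of_pos hσ).ne'
    have h2 : (2 : ℝ) - 1 = 1 := by norm_num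
    simp [ker, kerInt, h2, Real.Gamma_add_one hσ.ne', hG]

theorem intervalIntegrable_ker {α : ℝ} (hα1 : α ≤ 1) (a b : ℝ) :
    IntervalIntegrable (ker α) volume a b := by
  rcases hα1.lt_or_eq with h | rfl
  · exact ((intervalIntegral.intervalIntegrable_rpow' (by linarith)).const_mul (1 - α)).div_const _
  · have : ker 1 = fun _ => 0 := by
      funext s
      simp [ker]
    rw [this]
    exact intervalIntegrable_const

theorem intervalIntegrable_ker_mul {α σ x : ℝ} (hα1 : α ≤ 1) (hσ : 0 < σ) (hx : 0 < x) :
    IntervalIntegrable (fun s => ker α s * (σ * (x - s) ^ (σ - 1))) volume 0 x := by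
  rcases hα1.lt_or_eq with h | rfl
  · have hb := (intervalIntegrable_rpow_mul_sub_rpow (a := 1 - α) (b := σ) (by linarith) hσ
      hx).const_mul ((1 - α) * σ / Real.Gamma (2 - α))
    refine hb.congr_ae (Eventually.of_forall fun s => ?_)
    simp only [ker]
    rw [show 1 - α - 1 = -α by ring]
    ring
  · simp [ker]

theorem integral_mul_sub_rpow {σ : ℝ} (hσ : 0 < σ) (x a b : ℝ) :
    ∫ s in a..b, σ * (x - s) ^ (σ - 1) = (x - a) ^ σ - (x - b) ^ σ := by
  rw [intervalIntegral.integral_const_mul,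
    intervalIntegral.integral_comp_sub_left (fun s => s ^ (σ - 1)) x,
    integral_rpow (Or.inl (by linarith))]
  rw [sub_add_cancel]
  field_simp

theorem intervalIntegrable_mul_sub_rpow {σ : ℝ} (hσ : 0 < σ) (x a b : ℝ) :
    IntervalIntegrable (fun s => σ * (x - s) ^ (σ - 1)) volume a b := by
  have h := (intervalIntegral.intervalIntegrable_rpow' (a := x - a) (b := x - b) (r := σ - 1)
    (by linarith)).comp_sub_left x
  simp only [sub_sub_cancel] at h
  exact h.const_mul σ

/-- After summation by parts, increments of t^σ are integrals of its derivative over unit cells. The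
variable s is the time lag n - t: the kernel is singular at s = 0 and the power at s = n. -/
theorem powErr_eq_sum_integral {α σ : ℝ} (hα1 : α ≤ 1) (hσ : 0 < σ) {n : ℕ} (hn : 1 ≤ n) :
    powErr α σ n = kerInt α 0 * (σ * (n : ℝ) ^ (σ - 1))
      + ∑ l ∈ Finset.range n, ∫ s in (l : ℝ)..(l + 1),
        (σ * ((n : ℝ) - s) ^ (σ - 1)) * (ker α s - kap α l) := by
  have hn0 : (0 : ℝ) < n := by exact_mod_cast hn
  have hsub : ∀ l < n, uIcc (l : ℝ) ((l : ℝ) + 1) ⊆ uIcc 0 (n : ℝ) := by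
    intro l hl
    have h1 : (l : ℝ) + 1 ≤ n := by exact_mod_cast hl
    rw [uIcc_of_le (by linarith), uIcc_of_le hn0.le]
    exact Icc_subset_Icc l.cast_nonneg h1
  have hint : ∀ l < n, IntervalIntegrable
      (fun s => ker α s * (σ * ((n : ℝ) - s) ^ (σ - 1))) volume l ((l : ℝ) + 1) := fun l hl =>
    (intervalIntegrable_ker_mul hα1 hσ hn0).mono_set (hsub l hl)
  have hsplit := intervalIntegral.sum_integral_adjacent_intervals (μ := volume) (n := n)
    (f := fun s => ker α s * (σ * ((n : ℝ) - s) ^ (σ - 1))) (a := fun l : ℕ => (l : ℝ))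
    (fun l hl => by push_cast; exact hint l hl)
  push_cast at hsplit
  rw [powErr, caputo_rpow_eq hα1 hσ hn0,
    sum_wsglWeight_mul α (fun k => (k : ℝ) ^ σ) (by simp [hσ.ne']), ← hsplit, add_sub_assoc,
    ← Finset.sum_sub_distrib]
  congr 1
  refine Finset.sum_congr rfl fun l hl => ?_
  have hl' := Finset.mem_range.1 hl
  have h2 : ∀ s : ℝ, (σ * ((n : ℝ) - s) ^ (σ - 1)) * (ker α s - kap α l)
      = ker α s * (σ * ((n : ℝ) - s) ^ (σ - 1)) - kap α l * (σ * ((n : ℝ) - s) ^ (σ - 1)) :=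
    fun s => by ring
  simp_rw [h2]
  rw [intervalIntegral.integral_sub (hint l hl')
    ((intervalIntegrable_mul_sub_rpow hσ _ _ _).const_mul _),
    intervalIntegral.integral_const_mul, integral_mul_sub_rpow hσ, Nat.sub_sub,
    Nat.cast_sub hl'.le, Nat.cast_sub (by omega)]
  push_cast
  rfl

/-- Cellwise integration by parts with telescoping node terms. Differentiability of G is asked only
for s > 0, because the kernel is singular at 0. -/
theorem sum_integral_mul_deriv {G g : ℕ → ℝ → ℝ} {γ : ℕ → ℝ} {v v' : ℝ → ℝ} {p : ℕ}
    (hG : ∀ l, Continuous (G l)) (hl : ∀ l : ℕ, G l l = γ l) (hr : ∀ l : ℕ, G l (l + 1) = γ (l + 1))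
    (hd : ∀ (l : ℕ) {s : ℝ}, 0 < s → HasDerivAt (G l) (g l s) s)
    (hg : ∀ (l : ℕ) (a b : ℝ), IntervalIntegrable (g l) volume a b)
    (hv : ∀ s ∈ Icc (0 : ℝ) p, HasDerivAt v (v' s) s) (hv' : ContinuousOn v' (Icc (0 : ℝ) p)) :
    ∑ l ∈ Finset.range p, ∫ s in (l : ℝ)..(l + 1), v s * g l s
      = v p * γ p - v 0 * γ 0 - ∑ l ∈ Finset.range p, ∫ s in (l : ℝ)..(l + 1), v' s * G l s := by
  have h1 : ∀ l ∈ Finset.range p, ∫ s in (l : ℝ)..(l + 1), v s * g l s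
      = (v (l + 1 : ℕ) * γ (l + 1) - v l * γ l) - ∫ s in (l : ℝ)..(l + 1), v' s * G l s := by
    intro l hlp
    have hlp' : ((l : ℝ) + 1) ≤ p := by exact_mod_cast Finset.mem_range.1 hlp
    have hle : (l : ℝ) ≤ l + 1 := by linarith
    have hl0 : (0 : ℝ) ≤ l := l.cast_nonneg
    have hsub : Icc (l : ℝ) (l + 1) ⊆ Icc (0 : ℝ) p := Icc_subset_Icc hl0 hlp'
    have h := intervalIntegral.integral_mul_deriv_eq_deriv_mul_of_hasDerivAt
      (a := (l : ℝ)) (b := l + 1) (u := v) (v := G l) (u' := v') (v' := g l)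
      (by
        rw [uIcc_of_le hle]
        exact fun s hs => (hv s (hsub hs)).continuousAt.continuousWithinAt)
      (hG l).continuousOn
      (by
        rw [min_eq_left hle, max_eq_right hle]
        exact fun s hs => hv s (hsub (Ioo_subset_Icc_self hs)))
      (by
        rw [min_eq_left hle, max_eq_right hle]
        exact fun s hs => hd l (hl0.trans_lt hs.1))
      (by
        refine ContinuousOn.intervalIntegrable ?_
        rw [uIcc_of_le hle]
        exact hv'.mono hsub)
      (hg l _ _)
    rw [h, hl, hr]
    push_cast
    ring
  rw [Finset.sum_congr rfl h1, Finset.sum_sub_distrib,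
    Finset.sum_range_sub (fun l : ℕ => v l * γ l)]
  simp

theorem hasDerivAt_sub_rpow (x q : ℝ) {s : ℝ} (hs : s < x) :
    HasDerivAt (fun s => (x - s) ^ q) (-(q * (x - s) ^ (q - 1))) s := by
  have h := ((hasDerivAt_id s).const_sub x).rpow_const (p := q) (Or.inl (sub_pos.2 hs).ne')
  refine h.congr_deriv ?_
  simp

theorem continuousOn_sub_rpow {x : ℝ} (q : ℝ) {p : ℝ} (hp : p < x) :
    ContinuousOn (fun s => (x - s) ^ q) (Icc 0 p) := fun _ hs =>
  (hasDerivAt_sub_rpow x q (hs.2.trans_lt hp)).continuousAt.continuousWithinAt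

/-- One integration by parts on all cells but the last, where (N+1-s)^(σ-1) is singular if σ < 1.
The boundary term at s = 0 cancels the `kerInt α 0` term, since `kapSum α 0` is 0. -/
theorem powErr_succ_eq {α σ : ℝ} (hα1 : α ≤ 1) (hσ : 0 < σ) (N : ℕ) :
    powErr α σ (N + 1) = σ * defect α N
      + (∑ l ∈ Finset.range N, ∫ s in (l : ℝ)..(l + 1),
        (σ * (σ - 1) * ((N : ℝ) + 1 - s) ^ (σ - 2)) * cellDefect α l s)
      + ∫ s in (N : ℝ)..(N + 1), (σ * ((N : ℝ) + 1 - s) ^ (σ - 1)) * (ker α s - kap α N) := by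
  have h := sum_integral_mul_deriv (G := cellDefect α) (g := fun l s => ker α s - kap α l)
    (γ := defect α) (v := fun s => σ * ((N : ℝ) + 1 - s) ^ (σ - 1))
    (v' := fun s => -(σ * (σ - 1) * ((N : ℝ) + 1 - s) ^ (σ - 2))) (p := N)
    (continuous_cellDefect hα1) (cellDefect_left α) (cellDefect_right α)
    (hasDerivAt_cellDefect α)
    (fun l a b => (intervalIntegrable_ker hα1 a b).sub intervalIntegrable_const)
    (fun s hs => by
      refine ((hasDerivAt_sub_rpow ((N : ℝ) + 1) (σ - 1)
        (by linarith [hs.2])).const_mul σ).congr_deriv ?_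
      rw [show σ - 1 - 1 = σ - 2 by ring]
      ring)
    (((continuousOn_sub_rpow (x := (N : ℝ) + 1) (σ - 2)
      (lt_add_one _)).const_smul (σ * (σ - 1))).neg)
  rw [powErr_eq_sum_integral hα1 hσ (by omega), Finset.sum_range_succ]
  push_cast
  rw [h]
  simp only [neg_mul, intervalIntegral.integral_neg, Finset.sum_neg_distrib, defect, kapSum,
    sub_zero, Nat.cast_zero]
  rw [show (N : ℝ) + 1 - N = 1 by ring, Real.one_rpow]
  ring

theorem sum_integral_cellDefect_eq {α σ : ℝ} (hα1 : α ≤ 1) {N p : ℕ} (hp : p ≤ N) :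
    ∑ l ∈ Finset.range p, ∫ s in (l : ℝ)..(l + 1),
        (σ * (σ - 1) * ((N : ℝ) + 1 - s) ^ (σ - 2)) * cellDefect α l s
      = σ * (σ - 1) * ((N : ℝ) + 1 - p) ^ (σ - 2) * defectInt α p
        + ∑ l ∈ Finset.range p, ∫ s in (l : ℝ)..(l + 1),
          (σ * (σ - 1) * (σ - 2) * ((N : ℝ) + 1 - s) ^ (σ - 3)) * cellDefectInt α l s := by
  have hpN : (p : ℝ) < N + 1 := by exact_mod_cast Nat.lt_succ_of_le hp
  have h := sum_integral_mul_deriv (G := cellDefectInt α) (g := cellDefect α)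
    (γ := defectInt α) (v := fun s => σ * (σ - 1) * ((N : ℝ) + 1 - s) ^ (σ - 2))
    (v' := fun s => -(σ * (σ - 1) * (σ - 2) * ((N : ℝ) + 1 - s) ^ (σ - 3))) (p := p)
    (continuous_cellDefectInt hα1) (cellDefectInt_left α) (cellDefectInt_right α)
    (fun l _ _ => hasDerivAt_cellDefectInt hα1 l _)
    (fun l a b => (continuous_cellDefect hα1 l).intervalIntegrable a b)
    (fun s hs => by
      refine ((hasDerivAt_sub_rpow ((N : ℝ) + 1) (σ - 2)
        (hs.2.trans_lt hpN)).const_mul (σ * (σ - 1))).congr_deriv ?_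
      rw [show σ - 2 - 1 = σ - 3 by ring]
      ring)
    (((continuousOn_sub_rpow (x := (N : ℝ) + 1) (σ - 3)
      hpN).const_smul (σ * (σ - 1) * (σ - 2))).neg)
  rw [h]
  have h0 : defectInt α 0 = 0 := by
    simp [defectInt, kerInt₂, Real.zero_rpow (by linarith : 2 - α ≠ 0)]
  simp only [neg_mul, intervalIntegral.integral_neg, Finset.sum_neg_distrib, h0]
  ring

theorem rpow_le_eight_mul {x y q : ℝ} (hy : 0 < y) (h1 : y / 2 ≤ x) (h2 : x ≤ y) (hq : -3 ≤ q) :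
    x ^ q ≤ 8 * y ^ q := by
  have hx : 0 < x := by linarith
  rcases le_total 0 q with h | h
  · have := Real.rpow_le_rpow hx.le h2 h
    have : 0 ≤ y ^ q := by positivity
    linarith
  · have h3 : x ^ q ≤ (y / 2) ^ q := Real.rpow_le_rpow_of_nonpos (by positivity) h1 h
    rw [Real.div_rpow hy.le (by norm_num)] at h3
    have h4 : (1 / 8 : ℝ) ≤ 2 ^ q := by
      calc (1 / 8 : ℝ) = 2 ^ (-3 : ℝ) := by
            rw [Real.rpow_neg (by norm_num)]; norm_num
        _ ≤ _ := Real.rpow_le_rpow_of_exponent_le (by norm_num) hq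
    refine h3.trans ?_
    rw [div_le_iff₀ (by positivity)]
    nlinarith [show 0 < y ^ q by positivity]

/-- Log-convexity of Γ at σ + 1 = α(σ+2-α) + (1-α)(σ+1-α) bounds the quotient by (σ+1-α)^α. -/
theorem Gamma_div_Gamma_le {α σ : ℝ} (hα : 0 < α) (hα1 : α ≤ 1) (hσ : 0 < σ) :
    |Real.Gamma (σ + 1) / Real.Gamma (σ + 1 - α)| ≤ 1 + σ := by
  have h0 : 0 < σ + 1 - α := by linarith
  have hG := Real.Gamma_pos_of_pos h0
  have hG1 := Real.Gamma_pos_of_pos (by linarith : 0 < σ + 1)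
  rw [abs_of_nonneg (by positivity), div_le_iff₀ hG]
  rcases hα1.lt_or_eq with h | rfl
  · have h1 := Real.Gamma_mul_add_mul_le_rpow_Gamma_mul_rpow_Gamma (s := σ + 2 - α)
      (t := σ + 1 - α) (a := α) (b := 1 - α) (by linarith) h0 hα (by linarith) (by ring)
    rw [show α * (σ + 2 - α) + (1 - α) * (σ + 1 - α) = σ + 1 by ring,
      show σ + 2 - α = (σ + 1 - α) + 1 by ring, Real.Gamma_add_one h0.ne',
      Real.mul_rpow h0.le hG.le, mul_assoc, ← Real.rpow_add hG,
      show α + (1 - α) = 1 by ring, Real.rpow_one] at h1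
    refine h1.trans ?_
    gcongr
    calc (σ + 1 - α) ^ α ≤ (1 + σ) ^ α := by gcongr; linarith
      _ ≤ (1 + σ) ^ (1 : ℝ) := Real.rpow_le_rpow_of_exponent_le (by linarith) hα1
      _ = 1 + σ := by simp
  · rw [Real.Gamma_add_one hσ.ne', show σ + 1 - 1 = σ by ring]
    nlinarith [Real.Gamma_pos_of_pos hσ]

/-- Keeping |σ - 1| as a factor makes the formula valid at σ = 1 and the later bounds uniform near
it. -/
theorem mul_integral_sub_rpow {σ x a b : ℝ} (hab : a ≤ b) (hb : b < x) :
    |σ - 1| * ∫ s in a..b, (x - s) ^ (σ - 2) = |(x - a) ^ (σ - 1) - (x - b) ^ (σ - 1)| := by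
  have hcont : ContinuousOn (fun s => (x - s) ^ (σ - 2)) (uIcc a b) := by
    rw [uIcc_of_le hab]
    exact fun s hs =>
      (hasDerivAt_sub_rpow x _ (hs.2.trans_lt hb)).continuousAt.continuousWithinAt
  have h : ∫ s in a..b, (σ - 1) * (x - s) ^ (σ - 2)
      = -(x - b) ^ (σ - 1) - -(x - a) ^ (σ - 1) := by
    refine intervalIntegral.integral_eq_sub_of_hasDerivAt (f := fun s => -(x - s) ^ (σ - 1))
      (fun s hs => ?_) (hcont.intervalIntegrable.const_mul (σ - 1))
    rw [uIcc_of_le hab] at hs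
    refine (hasDerivAt_sub_rpow x (σ - 1) (hs.2.trans_lt hb)).neg.congr_deriv ?_
    rw [neg_neg, show σ - 1 - 1 = σ - 2 by ring]
  have h0 : 0 ≤ ∫ s in a..b, (x - s) ^ (σ - 2) :=
    intervalIntegral.integral_nonneg hab fun s hs => Real.rpow_nonneg (by linarith [hs.2]) _
  rw [intervalIntegral.integral_const_mul] at h
  calc _ = |(σ - 1) * ∫ s in a..b, (x - s) ^ (σ - 2)| := by rw [abs_mul, abs_of_nonneg h0]
    _ = _ := by rw [h]; congr 1; ring

theorem abs_integral_le_integral {f g : ℝ → ℝ} {a b : ℝ} (hab : a ≤ b)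
    (h : ∀ s ∈ Ioc a b, |f s| ≤ g s) (hg : IntervalIntegrable g volume a b) :
    |∫ s in a..b, f s| ≤ ∫ s in a..b, g s :=
  intervalIntegral.norm_integral_le_of_norm_le (f := f) hab (Eventually.of_forall h) hg

/-- The cells are split at p = ⌊n/2⌋. For s ≤ p the powers of n - s are comparable to those of n,
and a second integration by parts gives n^(σ-2) n^(-α) at the boundary and n^(σ-3) n^(1-α) inside.
From p up to the last cell the cell defect is already O(n^(-1-α)) and multiplies the variation of
(n-s)^(σ-1), at most n^(σ-1) + 1. On the last cell the kernel difference itself is O(n^(-1-α)). The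
cubic factor comes from σ(σ-1)(σ-2). -/
theorem exists_abs_powErr_le {α : ℝ} (hα : 0 < α) (hα1 : α ≤ 1) :
    ∃ C > 0, ∀ σ > 0, ∀ n : ℕ, 1 ≤ n →
      |powErr α σ n| ≤ C * (1 + σ) ^ 3 * ((n : ℝ) ^ (σ - 2 - α) + (n : ℝ) ^ (-1 - α)) := by
  obtain ⟨C1, hC1, h1⟩ := exists_defect_le hα hα1
  obtain ⟨C2, hC2, h2⟩ := exists_defectInt_le hα hα1
  obtain ⟨C3, hC3, h3⟩ := exists_cellDefect_le hα hα1
  obtain ⟨C4, hC4, hh, h4, h4s⟩ := exists_sum_cellDefectInt_le hα hα1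
  obtain ⟨C5, hC5, h5⟩ := exists_abs_ker_sub_kap_le hα hα1
  refine ⟨3 + C1 + 32 * C2 + 16 * C4 + 4 * C3 + C5, by positivity, fun σ hσ n hn => ?_⟩
  have hW : (1 : ℝ) ≤ (1 + σ) ^ 3 := one_le_pow₀ (by linarith)
  have hW1 : 1 + σ ≤ (1 + σ) ^ 3 := le_self_pow₀ (by linarith) (by norm_num)
  have hσ1 : |σ - 1| ≤ 1 + σ := abs_le.2 ⟨by linarith, by linarith⟩
  have hσ2 : |σ - 2| ≤ 2 * (1 + σ) := abs_le.2 ⟨by linarith, by linarith⟩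
  obtain ⟨N, rfl⟩ := Nat.exists_eq_add_of_le' hn
  rcases Nat.eq_zero_or_pos N with rfl | hN
  · have hG := Gamma_div_Gamma_le hα hα1 hσ
    have e : powErr α σ (0 + 1)
        = Real.Gamma (σ + 1) / Real.Gamma (σ + 1 - α) - (2 + α) / 2 := by
      simp [powErr, Finset.sum_range_succ, wsglWeight, glWeight, Real.zero_rpow hσ.ne']
    rw [e]
    simp only [zero_add, Nat.cast_one, Real.one_rpow]
    have := abs_sub (Real.Gamma (σ + 1) / Real.Gamma (σ + 1 - α)) ((2 + α) / 2)
    rw [abs_of_pos (by positivity : 0 < (2 + α) / 2)] at this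
    have h6 : 0 ≤ (C1 + 32 * C2 + 16 * C4 + 4 * C3 + C5) * (1 + σ) ^ 3 := by positivity
    nlinarith
  rw [powErr_succ_eq hα1 hσ]
  set x : ℝ := (N : ℝ) + 1 with hx
  have hx0 : 0 < x := by positivity
  have hxn : ((N + 1 : ℕ) : ℝ) = x := by push_cast; rfl
  rw [hxn]
  set A := x ^ (σ - 2 - α) with hA
  set B := x ^ (-1 - α) with hB
  have hA0 : 0 < A := by positivity
  have hB0 : 0 < B := by positivity
  set W := (1 + σ) ^ 3 with hWdef
  have hW0 : 0 < W := by positivity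
  obtain ⟨p, hp⟩ : ∃ p, p = (N + 1) / 2 := ⟨_, rfl⟩
  have hpN : p ≤ N := by omega
  have hp1 : 1 ≤ p := by omega
  have hpx : (p : ℝ) ≤ x / 2 := by
    have : 2 * p ≤ N + 1 := by omega
    have : (2 : ℝ) * p ≤ N + 1 := by exact_mod_cast this
    rw [hx]; linarith
  have hpx2 : x ≤ 2 * ((p : ℝ) + 1) := by
    have : N + 1 ≤ 2 * (p + 1) := by omega
    rw [hx]
    exact_mod_cast this
  have b1 : |σ * defect α N| ≤ C1 * W * B := by
    rw [abs_mul, abs_of_pos hσ]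
    calc σ * |defect α N| ≤ W * (C1 * B) := by
          gcongr
          · linarith
          · exact h1 N
      _ = _ := by ring
  have b2 : |σ * (σ - 1) * (x - p) ^ (σ - 2) * defectInt α p| ≤ 32 * C2 * W * A := by
    have hq : (x - p) ^ (σ - 2) ≤ 8 * x ^ (σ - 2) :=
      rpow_le_eight_mul hx0 (by linarith) (by linarith [p.cast_nonneg (α := ℝ)]) (by linarith)
    have hq0 : 0 ≤ (x - p) ^ (σ - 2) := Real.rpow_nonneg (by linarith) _
    have hH : |defectInt α p| ≤ C2 * (4 * x ^ (-α)) := by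
      refine (h2 p).trans ?_
      gcongr
      exact rpow_le_of_le_two_mul hpx2 hx0 (by linarith) (by linarith)
    rw [abs_mul, abs_mul, abs_mul, abs_of_pos hσ, abs_of_nonneg hq0]
    calc σ * |σ - 1| * (x - p) ^ (σ - 2) * |defectInt α p|
        ≤ W * (8 * x ^ (σ - 2)) * (C2 * (4 * x ^ (-α))) := by
          gcongr
          calc σ * |σ - 1| ≤ (1 + σ) * (1 + σ) := by gcongr; linarith
            _ ≤ W := by rw [hWdef]; nlinarith [sq_nonneg (1 + σ)]
      _ = 32 * C2 * W * (x ^ (σ - 2) * x ^ (-α)) := by ring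
      _ = _ := by rw [← Real.rpow_add hx0, ← sub_eq_add_neg]
  have b3 : |∑ l ∈ Finset.range p, ∫ s in (l : ℝ)..(l + 1),
      (σ * (σ - 1) * (σ - 2) * (x - s) ^ (σ - 3)) * cellDefectInt α l s| ≤ 16 * C4 * W * A := by
    have hcell : ∀ l ∈ Finset.range p, |∫ s in (l : ℝ)..(l + 1),
        (σ * (σ - 1) * (σ - 2) * (x - s) ^ (σ - 3)) * cellDefectInt α l s|
          ≤ 16 * W * x ^ (σ - 3) * hh l := by
      intro l hl
      have hlp : (l : ℝ) + 1 ≤ p := by exact_mod_cast Finset.mem_range.1 hl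
      have := intervalIntegral.norm_integral_le_of_norm_le_const (a := (l : ℝ)) (b := l + 1)
        (C := 16 * W * x ^ (σ - 3) * hh l)
        (f := fun s => (σ * (σ - 1) * (σ - 2) * (x - s) ^ (σ - 3)) * cellDefectInt α l s)
        (fun s hs => by
          rw [uIoc_of_le (by linarith)] at hs
          have hs' := h4 l s ⟨hs.1.le, hs.2⟩
          have hl0 : (0 : ℝ) ≤ l := l.cast_nonneg
          have hq : (x - s) ^ (σ - 3) ≤ 8 * x ^ (σ - 3) :=
            rpow_le_eight_mul hx0 (by linarith [hs.2]) (by linarith [hs.1]) (by linarith)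
          have hq0 : 0 ≤ (x - s) ^ (σ - 3) := Real.rpow_nonneg (by linarith [hs.2]) _
          rw [Real.norm_eq_abs, abs_mul, abs_mul, abs_mul, abs_mul, abs_of_pos hσ,
            abs_of_nonneg hq0]
          have hc : σ * |σ - 1| * |σ - 2| ≤ 2 * W := by
            calc σ * |σ - 1| * |σ - 2| ≤ (1 + σ) * (1 + σ) * (2 * (1 + σ)) := by
                  gcongr; linarith
              _ = 2 * W := by rw [hWdef]; ring
          calc σ * |σ - 1| * |σ - 2| * (x - s) ^ (σ - 3) * |cellDefectInt α l s|
              ≤ 2 * W * (8 * x ^ (σ - 3)) * hh l := by gcongr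
            _ = _ := by ring)
      simpa using this
    obtain ⟨q, rfl⟩ := Nat.exists_eq_add_of_le' hp1
    calc _ ≤ ∑ l ∈ Finset.range (q + 1), 16 * W * x ^ (σ - 3) * hh l :=
          (Finset.abs_sum_le_sum_abs _ _).trans (Finset.sum_le_sum hcell)
      _ = 16 * W * x ^ (σ - 3) * ∑ l ∈ Finset.range (q + 1), hh l := by rw [Finset.mul_sum]
      _ ≤ 16 * W * x ^ (σ - 3) * (C4 * x ^ (1 - α)) := by
          gcongr
          refine (h4s q).trans ?_
          gcongr
          push_cast at hpx
          linarith
      _ = 16 * C4 * W * (x ^ (σ - 3) * x ^ (1 - α)) := by ring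
      _ = _ := by rw [← Real.rpow_add hx0, hA]; ring_nf
  have b4 : |∑ l ∈ Finset.Ico p N, ∫ s in (l : ℝ)..(l + 1),
      (σ * (σ - 1) * (x - s) ^ (σ - 2)) * cellDefect α l s| ≤ 4 * C3 * W * (A + B) := by
    have hii : ∀ a b : ℝ, a ≤ b → b ≤ N →
        IntervalIntegrable (fun s => (x - s) ^ (σ - 2)) volume a b := by
      intro a b hab hb
      refine ContinuousOn.intervalIntegrable ?_
      rw [uIcc_of_le hab]
      exact fun s hs => (hasDerivAt_sub_rpow x _
        (by linarith [hs.2])).continuousAt.continuousWithinAt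
    have hcell : ∀ l ∈ Finset.Ico p N, |∫ s in (l : ℝ)..(l + 1),
        (σ * (σ - 1) * (x - s) ^ (σ - 2)) * cellDefect α l s|
          ≤ σ * |σ - 1| * (C3 * (4 * B)) * ∫ s in (l : ℝ)..(l + 1), (x - s) ^ (σ - 2) := by
      intro l hl
      rw [Finset.mem_Ico] at hl
      have hlp : (p : ℝ) ≤ l := by exact_mod_cast hl.1
      have hlN : (l : ℝ) + 1 ≤ N := by exact_mod_cast hl.2
      rw [← intervalIntegral.integral_const_mul]
      have hle : (l : ℝ) ≤ l + 1 := by linarith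
      refine abs_integral_le_integral hle (fun s hs => ?_) ((hii _ _ hle hlN).const_mul _)
      have hq0 : 0 ≤ (x - s) ^ (σ - 2) := Real.rpow_nonneg (by linarith [hs.2]) _
      rw [abs_mul, abs_mul, abs_mul, abs_of_pos hσ, abs_of_nonneg hq0]
      have hF : |cellDefect α l s| ≤ C3 * (4 * B) := by
        refine (h3 l s ⟨hs.1.le, hs.2⟩).trans ?_
        gcongr
        exact rpow_le_of_le_two_mul (by linarith) hx0 (by linarith) (by linarith)
      calc _ ≤ σ * |σ - 1| * (x - s) ^ (σ - 2) * (C3 * (4 * B)) := by gcongr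
        _ = _ := by ring
    have hsum : ∑ l ∈ Finset.Ico p N, ∫ s in (l : ℝ)..(l + 1), (x - s) ^ (σ - 2)
        = ∫ s in (p : ℝ)..N, (x - s) ^ (σ - 2) := by
      have := intervalIntegral.sum_integral_adjacent_intervals_Ico (μ := volume)
        (f := fun s => (x - s) ^ (σ - 2)) (a := fun l : ℕ => (l : ℝ)) hpN
        (fun l hl => by
          have : (l : ℝ) + 1 ≤ N := by exact_mod_cast hl.2
          exact hii _ _ (by push_cast; linarith) (by push_cast; exact this))
      push_cast at this
      exact this
    have hpN' : (p : ℝ) ≤ N := by exact_mod_cast hpN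
    have hint := mul_integral_sub_rpow (σ := σ) hpN' (by linarith : (N : ℝ) < x)
    have hval : |(x - p) ^ (σ - 1) - (x - N) ^ (σ - 1)| ≤ x ^ (σ - 1) + 1 := by
      have h6 : x - N = 1 := by rw [hx]; ring
      have h7 : 1 ≤ x - p := by linarith
      have h8 : 0 ≤ (x - p) ^ (σ - 1) := Real.rpow_nonneg (by linarith) _
      have h9 : (x - p) ^ (σ - 1) ≤ x ^ (σ - 1) + 1 := by
        rcases le_total 0 (σ - 1) with h | h
        · have := Real.rpow_le_rpow (by linarith) (by linarith [p.cast_nonneg (α := ℝ)] :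
            x - p ≤ x) h
          linarith
        · have := Real.rpow_le_one_of_one_le_of_nonpos h7 h
          have : 0 ≤ x ^ (σ - 1) := by positivity
          linarith
      rw [h6, Real.one_rpow, abs_le]
      have : 0 ≤ x ^ (σ - 1) := by positivity
      constructor <;> linarith
    calc _ ≤ ∑ l ∈ Finset.Ico p N, σ * |σ - 1| * (C3 * (4 * B))
            * ∫ s in (l : ℝ)..(l + 1), (x - s) ^ (σ - 2) :=
          (Finset.abs_sum_le_sum_abs _ _).trans (Finset.sum_le_sum hcell)
      _ = σ * (C3 * (4 * B)) * (|σ - 1| * ∫ s in (p : ℝ)..N, (x - s) ^ (σ - 2)) := by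
          rw [← Finset.mul_sum, hsum]; ring
      _ ≤ W * (C3 * (4 * B)) * (x ^ (σ - 1) + 1) := by
          rw [hint]
          gcongr
          linarith
      _ = 4 * C3 * W * (x ^ (-1 - α) * x ^ (σ - 1) + B) := by rw [hB]; ring
      _ = _ := by rw [← Real.rpow_add hx0, hA]; ring_nf
  have b5 : |∫ s in (N : ℝ)..x, (σ * (x - s) ^ (σ - 1)) * (ker α s - kap α N)|
      ≤ C5 * W * B := by
    have hbd : |∫ s in (N : ℝ)..x, (σ * (x - s) ^ (σ - 1)) * (ker α s - kap α N)|
        ≤ ∫ s in (N : ℝ)..x, C5 * B * (σ * (x - s) ^ (σ - 1)) := by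
      have hle : (N : ℝ) ≤ x := by rw [hx]; linarith
      refine abs_integral_le_integral hle (fun s hs => ?_)
        ((intervalIntegrable_mul_sub_rpow hσ _ _ _).const_mul _)
      have hq0 : 0 ≤ (x - s) ^ (σ - 1) := Real.rpow_nonneg (by linarith [hs.2]) _
      rw [abs_mul, abs_mul, abs_of_pos hσ, abs_of_nonneg hq0, mul_comm]
      gcongr
      exact h5 N hN s ⟨hs.1.le, hs.2⟩
    refine hbd.trans ?_
    rw [intervalIntegral.integral_const_mul, integral_mul_sub_rpow hσ, sub_self,
      Real.zero_rpow hσ.ne', show x - N = 1 by rw [hx]; ring, Real.one_rpow, sub_zero, mul_one]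
    calc C5 * B = C5 * 1 * B := by ring
      _ ≤ C5 * W * B := by gcongr
  rw [Finset.range_eq_Ico, ← Finset.sum_Ico_consecutive _ (Nat.zero_le p) hpN,
    ← Finset.range_eq_Ico, sum_integral_cellDefect_eq hα1 hpN]
  rw [← hx]
  have htri : ∀ a b c d e : ℝ, |a + (b + c + d) + e| ≤ |a| + |b| + |c| + |d| + |e| := by
    intro a b c d e
    have i1 := abs_add_le (a + (b + c + d)) e
    have i2 := abs_add_le a (b + c + d)
    have i3 := abs_add_le (b + c) d
    have i4 := abs_add_le b c
    linarith
  refine (htri _ _ _ _ _).trans ?_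
  have hWA : 0 ≤ W * A := by positivity
  have hWB : 0 ≤ W * B := by positivity
  have e1 : 0 ≤ (3 + C1 + C5) * (W * A) + (3 + 32 * C2 + 16 * C4) * (W * B) := by positivity
  linarith

/-! ### Fractional sums of the truncation error of a power -/

/-- The fractional sum of order `β` of the truncation errors `powErr α σ 1, …, powErr α σ n`. -/
def powErrSum (β α σ : ℝ) (n : ℕ) : ℝ :=
  ∑ k ∈ Finset.range n, psi β (n - 1 - k) * powErr α σ (k + 1)

theorem rpow_le_one_add_rpow {x y : ℝ} (hx : 1 ≤ x) (hxy : x ≤ y) (e : ℝ) :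
    x ^ e ≤ 1 + y ^ e := by
  have h0 : 0 ≤ y ^ e := Real.rpow_nonneg (by linarith) _
  rcases le_total e 0 with h | h
  · have := Real.rpow_le_one_of_one_le_of_nonpos hx h
    linarith
  · have := Real.rpow_le_rpow (by linarith) hxy h
    linarith

theorem sum_psi_mul_psi_shift_le {a b : ℝ} (ha : 0 ≤ a) (hb : 0 ≤ b) (n : ℕ) :
    ∑ k ∈ Finset.range n, psi a (n - 1 - k) * psi b (k + 1) ≤ psi (a + b) n := by
  have h := sum_psi_mul_psi a b n
  rw [Finset.sum_range_succ'] at h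
  rw [← h]
  have h1 : ∑ k ∈ Finset.range n, psi a (n - 1 - k) * psi b (k + 1)
      = ∑ k ∈ Finset.range n, psi a (n - (k + 1)) * psi b (k + 1) :=
    Finset.sum_congr rfl fun k _ => by rw [Nat.sub_sub, add_comm 1 k]
  rw [h1]
  exact le_add_of_nonneg_right (mul_nonneg (psi_nonneg ha _) (psi_nonneg hb _))

/-- Both powers in the bound for `powErr` are at most M k^(-β) with M = 1 + n^(σ-2+β-α). Now k^(-β)
is dominated by `psi (1 - β) k` over 1 - β, whose convolution with `psi β` is at most 1. The
constant degenerates as β → 1. -/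
theorem exists_abs_powErrSum_le_of_lt {α β : ℝ} (hα : 0 < α) (hαβ : α ≤ β) (hβ : β < 1) :
    ∃ C > 0, ∀ σ > 0, ∀ n : ℕ, 1 ≤ n →
      |powErrSum β α σ n| ≤ C * (1 + σ) ^ 3 * (1 + (n : ℝ) ^ (σ - 2 + β - α)) := by
  obtain ⟨C, hC, h⟩ := exists_abs_powErr_le hα (by linarith)
  have hβ1 : 0 < 1 - β := by linarith
  have hβ0 : 0 < β := by linarith
  refine ⟨2 * C * (1 / (1 - β)), by positivity, fun σ hσ n hn => ?_⟩
  set M := 1 + (n : ℝ) ^ (σ - 2 + β - α) with hM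
  have hM0 : 1 ≤ M := le_add_of_nonneg_right (by positivity)
  have hterm : ∀ k ∈ Finset.range n, |psi β (n - 1 - k) * powErr α σ (k + 1)|
      ≤ 2 * C * (1 / (1 - β)) * (1 + σ) ^ 3 * M * (psi β (n - 1 - k) * psi (1 - β) (k + 1)) := by
    intro k hk
    have hkn : ((k + 1 : ℕ) : ℝ) ≤ n := by exact_mod_cast Finset.mem_range.1 hk
    set y : ℝ := ((k + 1 : ℕ) : ℝ) with hy
    have hy1 : 1 ≤ y := by rw [hy]; push_cast; linarith [k.cast_nonneg (α := ℝ)]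
    have hy0 : 0 < y := by linarith
    have h1 := h σ hσ (k + 1) (by omega)
    rw [← hy] at h1
    have h2 : y ^ (σ - 2 - α) ≤ M * y ^ (-β) := by
      rw [show σ - 2 - α = (σ - 2 + β - α) + -β by ring, Real.rpow_add hy0]
      gcongr
      exact rpow_le_one_add_rpow hy1 hkn _
    have h3 : y ^ (-1 - α) ≤ M * y ^ (-β) := by
      calc y ^ (-1 - α) ≤ y ^ (-β) := Real.rpow_le_rpow_of_exponent_le hy1 (by linarith)
        _ ≤ _ := le_mul_of_one_le_left (by positivity) hM0
    have h4 : y ^ (-β) ≤ 1 / (1 - β) * psi (1 - β) (k + 1) := by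
      have := mul_rpow_le_psi hβ1 (by linarith) (show 1 ≤ k + 1 by omega)
      rw [show 1 - β - 1 = -β by ring] at this
      rw [one_div, ← div_eq_inv_mul, le_div_iff₀ hβ1, mul_comm]
      exact this
    have hp := psi_nonneg hβ0.le (n - 1 - k)
    rw [abs_mul, abs_of_nonneg hp]
    calc _ ≤ psi β (n - 1 - k) * (C * (1 + σ) ^ 3 * (M * y ^ (-β) + M * y ^ (-β))) := by
          gcongr
          refine h1.trans ?_
          gcongr
      _ = 2 * C * (1 + σ) ^ 3 * M * (psi β (n - 1 - k) * y ^ (-β)) := by ring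
      _ ≤ 2 * C * (1 + σ) ^ 3 * M *
          (psi β (n - 1 - k) * (1 / (1 - β) * psi (1 - β) (k + 1))) := by gcongr
      _ = _ := by ring
  calc _ ≤ ∑ k ∈ Finset.range n, 2 * C * (1 / (1 - β)) * (1 + σ) ^ 3 * M *
          (psi β (n - 1 - k) * psi (1 - β) (k + 1)) :=
        (Finset.abs_sum_le_sum_abs _ _).trans (Finset.sum_le_sum hterm)
    _ = 2 * C * (1 / (1 - β)) * (1 + σ) ^ 3 * M *
          ∑ k ∈ Finset.range n, psi β (n - 1 - k) * psi (1 - β) (k + 1) := by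
        rw [Finset.mul_sum]
    _ ≤ 2 * C * (1 / (1 - β)) * (1 + σ) ^ 3 * M * 1 := by
        gcongr
        refine (sum_psi_mul_psi_shift_le hβ0.le hβ1.le n).trans ?_
        rw [add_sub_cancel, psi_one]
    _ = _ := by ring

theorem exists_sum_rpow_le {η : ℝ} (hη : 0 < η) (hη1 : η ≤ 1) :
    ∃ C > 0, ∀ n : ℕ, 1 ≤ n →
      ∑ k ∈ Finset.range n, ((k + 1 : ℕ) : ℝ) ^ (η - 1) ≤ C * (n : ℝ) ^ η := by
  obtain ⟨C, hC, h⟩ := exists_psi_le (b := η + 1) (by linarith)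
  refine ⟨1 / η * (C * 2), by positivity, fun n hn => ?_⟩
  have hn1 : (1 : ℝ) ≤ n := by exact_mod_cast hn
  calc ∑ k ∈ Finset.range n, ((k + 1 : ℕ) : ℝ) ^ (η - 1)
      ≤ ∑ k ∈ Finset.range n, 1 / η * (psi 1 (n - 1 - k) * psi η (k + 1)) := by
        refine Finset.sum_le_sum fun k _ => ?_
        rw [psi_one, one_mul, one_div, ← div_eq_inv_mul, le_div_iff₀ hη, mul_comm]
        exact mul_rpow_le_psi hη hη1 (by omega)
    _ = 1 / η * ∑ k ∈ Finset.range n, psi 1 (n - 1 - k) * psi η (k + 1) := by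
        rw [Finset.mul_sum]
    _ ≤ 1 / η * psi (1 + η) n := by
        gcongr
        exact sum_psi_mul_psi_shift_le zero_le_one hη.le n
    _ ≤ 1 / η * (C * (2 * (n : ℝ) ^ η)) := by
        gcongr
        rw [add_comm]
        refine (h n).trans ?_
        rw [add_sub_cancel_right]
        gcongr
        calc ((n : ℝ) + 1) ^ η ≤ (2 * (n : ℝ)) ^ η := by gcongr; linarith
          _ = 2 ^ η * (n : ℝ) ^ η := Real.mul_rpow (by norm_num) (by positivity)
          _ ≤ 2 * (n : ℝ) ^ η := by
            gcongr
            calc (2 : ℝ) ^ η ≤ 2 ^ (1 : ℝ) :=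
                  Real.rpow_le_rpow_of_exponent_le (by norm_num) hη1
              _ = 2 := by simp
    _ = _ := by ring

/-- For β = 1 the bounds on `powErr` can be summed directly unless the exponent σ-2-α is near -1,
where a logarithm appears. Distance α/2 keeps the constants uniform in σ. -/
theorem exists_abs_sum_powErr_le_of_far {α : ℝ} (hα : 0 < α) (hα1 : α ≤ 1) :
    ∃ C > 0, ∀ σ > 0, α / 2 ≤ |σ - 1 - α| → ∀ n : ℕ, 1 ≤ n →
      |powErrSum 1 α σ n| ≤ C * (1 + σ) ^ 3 * (1 + (n : ℝ) ^ (σ - 1 - α)) := by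
  obtain ⟨C, hC, h⟩ := exists_abs_powErr_le hα hα1
  obtain ⟨D, hD, hs⟩ := exists_sum_rpow_le (η := α / 2) (by positivity) (by linarith)
  have hsum : Summable fun k : ℕ => ((k + 1 : ℕ) : ℝ) ^ (-1 - α / 2) :=
    (summable_nat_add_iff 1).2 (Real.summable_nat_rpow.2 (by linarith))
  set E := ∑' k : ℕ, ((k + 1 : ℕ) : ℝ) ^ (-1 - α / 2) with hE
  have hE0 : 0 ≤ E := tsum_nonneg fun k => by positivity
  have hEn : ∀ n, ∑ k ∈ Finset.range n, ((k + 1 : ℕ) : ℝ) ^ (-1 - α / 2) ≤ E := fun n =>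
    hsum.sum_le_tsum _ fun k _ => by positivity
  refine ⟨C * (2 * E + D), by positivity, fun σ hσ hfar n hn => ?_⟩
  have hn1 : (1 : ℝ) ≤ n := by exact_mod_cast hn
  have hP0 : 0 ≤ (n : ℝ) ^ (σ - 1 - α) := by positivity
  have hA : ∑ k ∈ Finset.range n, ((k + 1 : ℕ) : ℝ) ^ (σ - 2 - α)
      ≤ E + D * (n : ℝ) ^ (σ - 1 - α) := by
    rcases le_abs.1 hfar with h1 | h1
    · calc ∑ k ∈ Finset.range n, ((k + 1 : ℕ) : ℝ) ^ (σ - 2 - α)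
          ≤ ∑ k ∈ Finset.range n, (n : ℝ) ^ (σ - 1 - α - α / 2)
              * ((k + 1 : ℕ) : ℝ) ^ (α / 2 - 1) := by
            refine Finset.sum_le_sum fun k hk => ?_
            have hkn : ((k + 1 : ℕ) : ℝ) ≤ n := by exact_mod_cast Finset.mem_range.1 hk
            have hk0 : (0 : ℝ) < ((k + 1 : ℕ) : ℝ) := by positivity
            rw [show σ - 2 - α = (σ - 1 - α - α / 2) + (α / 2 - 1) by ring, Real.rpow_add hk0]
            gcongr
        _ ≤ (n : ℝ) ^ (σ - 1 - α - α / 2) * (D * (n : ℝ) ^ (α / 2)) := by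
            rw [← Finset.mul_sum]
            gcongr
            exact hs n hn
        _ = D * (n : ℝ) ^ (σ - 1 - α) := by
            rw [mul_left_comm, ← Real.rpow_add (by linarith)]
            congr 2
            ring
        _ ≤ _ := by linarith
    · calc _ ≤ ∑ k ∈ Finset.range n, ((k + 1 : ℕ) : ℝ) ^ (-1 - α / 2) := by
            refine Finset.sum_le_sum fun k _ => ?_
            exact Real.rpow_le_rpow_of_exponent_le
              (by push_cast; linarith [k.cast_nonneg (α := ℝ)]) (by linarith)
        _ ≤ E := hEn n
        _ ≤ _ := le_add_of_nonneg_right (by positivity)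
  have hB : ∑ k ∈ Finset.range n, ((k + 1 : ℕ) : ℝ) ^ (-1 - α) ≤ E := by
    refine le_trans (Finset.sum_le_sum fun k _ => ?_) (hEn n)
    exact Real.rpow_le_rpow_of_exponent_le
      (by push_cast; linarith [k.cast_nonneg (α := ℝ)]) (by linarith)
  calc |powErrSum 1 α σ n| ≤ ∑ k ∈ Finset.range n, C * (1 + σ) ^ 3 *
          (((k + 1 : ℕ) : ℝ) ^ (σ - 2 - α) + ((k + 1 : ℕ) : ℝ) ^ (-1 - α)) := by
        refine (Finset.abs_sum_le_sum_abs _ _).trans (Finset.sum_le_sum fun k _ => ?_)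
        rw [psi_one, one_mul]
        exact h σ hσ (k + 1) (by omega)
    _ = C * (1 + σ) ^ 3 * (∑ k ∈ Finset.range n, ((k + 1 : ℕ) : ℝ) ^ (σ - 2 - α)
          + ∑ k ∈ Finset.range n, ((k + 1 : ℕ) : ℝ) ^ (-1 - α)) := by
        rw [← Finset.mul_sum, Finset.sum_add_distrib]
    _ ≤ C * (1 + σ) ^ 3 * ((E + D * (n : ℝ) ^ (σ - 1 - α)) + E) := by gcongr
    _ ≤ C * (1 + σ) ^ 3 * ((2 * E + D) * (1 + (n : ℝ) ^ (σ - 1 - α))) := by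
        gcongr
        nlinarith [mul_nonneg hE0 hP0]
    _ = _ := by ring

/-- The error of the trapezoidal rule on `[k, k + 1]`. -/
def trapErr (a : ℝ) (k : ℕ) : ℝ :=
  (((k : ℝ) + 1) ^ (a + 1) - (k : ℝ) ^ (a + 1)) / (a + 1) - ((k : ℝ) ^ a + ((k : ℝ) + 1) ^ a) / 2

/-- The trapezoidal rule is exact on affine functions, so the tangent at k may be subtracted. What
is left has derivative at most D, because the derivative of s^a is monotone. -/
theorem abs_trapErr_le {a : ℝ} (ha : 0 < a) {k : ℕ} (hk : 1 ≤ k ∨ 1 ≤ a) :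
    |trapErr a k| ≤ 2 * |a * ((k : ℝ) + 1) ^ (a - 1) - a * (k : ℝ) ^ (a - 1)| := by
  set D := |a * ((k : ℝ) + 1) ^ (a - 1) - a * (k : ℝ) ^ (a - 1)| with hD
  set c := a * (k : ℝ) ^ (a - 1) with hc
  have hk0 : (0 : ℝ) ≤ k := k.cast_nonneg
  have hder : ∀ s ∈ Icc (k : ℝ) (k + 1),
      HasDerivAt (fun s : ℝ => s ^ a - c * s) (a * s ^ (a - 1) - c) s := by
    intro s hs
    refine ((Real.hasDerivAt_rpow_const ?_).sub ((hasDerivAt_id s).const_mul c)).congr_deriv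
      (by simp)
    refine hk.imp (fun h => ?_) id
    have : (1 : ℝ) ≤ k := by exact_mod_cast h
    linarith [hs.1]
  have hbd : ∀ s ∈ Icc (k : ℝ) (k + 1), |a * s ^ (a - 1) - c| ≤ D := by
    intro s hs
    rw [hD, hc, ← mul_sub, ← mul_sub, abs_mul, abs_mul]
    refine mul_le_mul_of_nonneg_left ?_ (abs_nonneg a)
    rcases le_total 1 a with h | h
    · have h1 := Real.rpow_le_rpow hk0 hs.1 (by linarith : 0 ≤ a - 1)
      have h2 := Real.rpow_le_rpow (hk0.trans hs.1) hs.2 (by linarith : 0 ≤ a - 1)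
      rw [abs_of_nonneg (by linarith), abs_of_nonneg (by linarith)]
      linarith
    · rcases hk with hk1 | hk1
      · have hk2 : (0 : ℝ) < k := by exact_mod_cast hk1
        have h1 := Real.rpow_le_rpow_of_nonpos hk2 hs.1 (by linarith : a - 1 ≤ 0)
        have h2 := Real.rpow_le_rpow_of_nonpos (hk2.trans_le hs.1) hs.2 (by linarith : a - 1 ≤ 0)
        rw [abs_of_nonpos (by linarith), abs_of_nonpos (by linarith)]
        linarith
      · have : a = 1 := le_antisymm h hk1
        simp [this]
  have hlin : ∀ s ∈ Icc (k : ℝ) (k + 1), |(s ^ a - c * s) - ((k : ℝ) ^ a - c * k)| ≤ D := by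
    intro s hs
    have h := Convex.norm_image_sub_le_of_norm_hasDerivWithin_le
      (f := fun s : ℝ => s ^ a - c * s) (s := Icc (k : ℝ) (k + 1)) (x := k) (y := s)
      (fun z hz => (hder z hz).hasDerivWithinAt) hbd (convex_Icc _ _) ⟨le_rfl, by linarith⟩ hs
    rw [Real.norm_eq_abs, Real.norm_eq_abs, abs_of_nonneg (by linarith [hs.1] : 0 ≤ s - k)] at h
    exact h.trans (mul_le_of_le_one_right (abs_nonneg _) (by linarith [hs.2]))
  have hint : |∫ s in (k : ℝ)..(k + 1), ((s ^ a - c * s) - ((k : ℝ) ^ a - c * k))| ≤ D := by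
    have := intervalIntegral.norm_integral_le_of_norm_le_const (a := (k : ℝ)) (b := k + 1) (C := D)
      (f := fun s => ((s ^ a - c * s) - ((k : ℝ) ^ a - c * k))) (fun s hs => by
        rw [uIoc_of_le (by linarith)] at hs
        exact hlin s ⟨hs.1.le, hs.2⟩)
    simpa using this
  have hi1 : IntervalIntegrable (fun s : ℝ => s ^ a) volume k (k + 1) :=
    intervalIntegral.intervalIntegrable_rpow' (by linarith)
  have hi2 : IntervalIntegrable (fun s : ℝ => c * s) volume k (k + 1) :=
    (continuous_const.mul continuous_id).intervalIntegrable _ _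
  rw [intervalIntegral.integral_sub (hi1.sub hi2) intervalIntegrable_const,
    intervalIntegral.integral_sub hi1 hi2, integral_rpow (Or.inl (by linarith)),
    intervalIntegral.integral_const_mul, integral_id, intervalIntegral.integral_const] at hint
  have hend := hlin (k + 1) ⟨by linarith, le_rfl⟩
  rw [abs_le] at hint hend
  simp only [smul_eq_mul] at hint
  rw [trapErr, abs_le]
  constructor <;> nlinarith

theorem powErr_eq {α σ : ℝ} (hσ : 0 < σ) (n : ℕ) :
    powErr α σ n = Real.Gamma (σ + 1) / Real.Gamma (σ + 1 - α) * (n : ℝ) ^ (σ - α)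
      - ∑ l ∈ Finset.range n, kap α l * (((n - l : ℕ) : ℝ) ^ σ - ((n - l - 1 : ℕ) : ℝ) ^ σ) := by
  rw [powErr, sum_wsglWeight_mul α (fun k => (k : ℝ) ^ σ) (by simp [hσ.ne'])]

theorem sum_trapErr {a : ℝ} (ha : 0 < a) (n : ℕ) :
    ∑ k ∈ Finset.range n, trapErr a k = (n : ℝ) ^ (a + 1) / (a + 1)
      - ∑ k ∈ Finset.range n, ((k + 1 : ℕ) : ℝ) ^ a + (n : ℝ) ^ a / 2 := by
  induction n with
  | zero => simp [Real.zero_rpow ha.ne', Real.zero_rpow (by linarith : a + 1 ≠ 0)]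
  | succ n ih =>
    rw [Finset.sum_range_succ, ih, Finset.sum_range_succ, trapErr]
    push_cast
    ring

/-- Full summation of the formula leaves `kap` against (n-l)^σ. Up to `trapErr`, this node value is
a backward difference of t^(σ+1)/(σ+1) plus half a backward difference of t^σ, that is, the formula
applied to these two powers. The main powers of n cancel, so only errors at step n and trapezoidal
errors remain. -/
theorem powErrSum_one_eq {α σ : ℝ} (hασ : α < σ) (hα : 0 < α) (n : ℕ) :
    powErrSum 1 α σ n = -(Real.Gamma (σ + 1) / Real.Gamma (σ + 1 - α)
        * ∑ k ∈ Finset.range n, trapErr (σ - α) k)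
      + powErr α (σ + 1) n / (σ + 1) + powErr α σ n / 2
      + ∑ l ∈ Finset.range n, kap α l * trapErr σ (n - l - 1) := by
  have hσ : 0 < σ := by linarith
  have ha : 0 < σ - α := by linarith
  have h1 : powErrSum 1 α σ n = Real.Gamma (σ + 1) / Real.Gamma (σ + 1 - α)
        * ∑ k ∈ Finset.range n, ((k + 1 : ℕ) : ℝ) ^ (σ - α)
      - ∑ l ∈ Finset.range n, kap α l * ((n - l : ℕ) : ℝ) ^ σ := by
    have h := sum_sum_kap_mul α (fun k => (k : ℝ) ^ σ) (by simp [hσ.ne']) n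
    rw [Finset.sum_range_succ', Finset.sum_range_zero, add_zero] at h
    rw [← h, Finset.mul_sum, ← Finset.sum_sub_distrib, powErrSum]
    refine Finset.sum_congr rfl fun k _ => ?_
    rw [psi_one, one_mul, powErr_eq hσ]
  have h2 : ∑ l ∈ Finset.range n, kap α l * trapErr σ (n - l - 1)
      = (∑ l ∈ Finset.range n, kap α l *
          (((n - l : ℕ) : ℝ) ^ (σ + 1) - ((n - l - 1 : ℕ) : ℝ) ^ (σ + 1))) / (σ + 1)
        + (∑ l ∈ Finset.range n, kap α l *
          (((n - l : ℕ) : ℝ) ^ σ - ((n - l - 1 : ℕ) : ℝ) ^ σ)) / 2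
        - ∑ l ∈ Finset.range n, kap α l * ((n - l : ℕ) : ℝ) ^ σ := by
    rw [Finset.sum_div, Finset.sum_div, ← Finset.sum_add_distrib, ← Finset.sum_sub_distrib]
    refine Finset.sum_congr rfl fun l hl => ?_
    have hl' := Finset.mem_range.1 hl
    have hc : ((n - l - 1 : ℕ) : ℝ) + 1 = ((n - l : ℕ) : ℝ) := by
      have : n - l - 1 + 1 = n - l := by omega
      exact_mod_cast this
    rw [trapErr, hc]
    ring
  have hG : Real.Gamma (σ + 1 + 1) / Real.Gamma (σ + 1 + 1 - α)
      = Real.Gamma (σ + 1) / Real.Gamma (σ + 1 - α) * ((σ + 1) / (σ - α + 1)) := by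
    rw [Real.Gamma_add_one (by linarith : σ + 1 ≠ 0),
      show σ + 1 + 1 - α = (σ + 1 - α) + 1 by ring,
      Real.Gamma_add_one (by linarith : σ + 1 - α ≠ 0), show σ + 1 - α = σ - α + 1 by ring]
    have : σ - α + 1 ≠ 0 := by linarith
    field_simp
  rw [h1, h2, sum_trapErr ha, powErr_eq hσ, powErr_eq (by linarith : 0 < σ + 1), hG,
    show σ + 1 - α = σ - α + 1 by ring]
  have e1 : σ + 1 ≠ 0 := by linarith
  have e2 : σ - α + 1 ≠ 0 := by linarith
  field_simp
  ring

theorem abs_trapErr_zero_le {a : ℝ} (ha : 0 < a) : |trapErr a 0| ≤ 1 := by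
  have h1 : 1 / (a + 1) ≤ 1 := by rw [div_le_one (by linarith)]; linarith
  have h2 : 0 < 1 / (a + 1) := by positivity
  simp only [trapErr, Nat.cast_zero, zero_add, Real.one_rpow, Real.zero_rpow ha.ne',
    Real.zero_rpow (by linarith : a + 1 ≠ 0), sub_zero]
  rw [abs_le]
  constructor <;> linarith

/-- Past the first cell each error is at most twice the variation of the monotone derivative, so the
bounds telescope; no logarithm arises, even near a = 1. -/
theorem abs_sum_trapErr_le {a : ℝ} (ha : 0 < a) {n : ℕ} (hn : 1 ≤ n) :
    |∑ k ∈ Finset.range n, trapErr a k| ≤ 1 + 2 * a * (1 + (n : ℝ) ^ (a - 1)) := by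
  obtain ⟨N, rfl⟩ := Nat.exists_eq_add_of_le' hn
  rw [Finset.sum_range_succ']
  have h0 := abs_trapErr_zero_le ha
  have htel : ∑ k ∈ Finset.range N, (((k + 1 : ℕ) : ℝ) + 1) ^ (a - 1)
      = ∑ k ∈ Finset.range N, ((k + 1 + 1 : ℕ) : ℝ) ^ (a - 1) := by
    push_cast; rfl
  have hmain : ∑ k ∈ Finset.range N, |trapErr a (k + 1)|
      ≤ 2 * |a * ((N + 1 : ℕ) : ℝ) ^ (a - 1) - a| := by
    have hs : ∀ k : ℕ, |trapErr a (k + 1)|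
        ≤ 2 * |a * ((k + 1 + 1 : ℕ) : ℝ) ^ (a - 1) - a * ((k + 1 : ℕ) : ℝ) ^ (a - 1)| := by
      intro k
      have := abs_trapErr_le ha (k := k + 1) (Or.inl (by omega))
      push_cast at this ⊢
      exact this
    have hsum := Finset.sum_range_sub (fun k : ℕ => a * ((k + 1 : ℕ) : ℝ) ^ (a - 1)) N
    simp only [zero_add, Nat.cast_one, Real.one_rpow, mul_one] at hsum
    rw [← hsum]
    refine (Finset.sum_le_sum fun k _ => hs k).trans (le_of_eq ?_)
    rw [← Finset.mul_sum]
    congr 1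
    rcases le_total 1 a with h | h
    · rw [Finset.abs_sum_of_nonneg]
      · refine Finset.sum_congr rfl fun k _ => abs_of_nonneg ?_
        rw [sub_nonneg]
        gcongr
        linarith
      · intro k _
        rw [sub_nonneg]
        gcongr
        linarith
    · have hneg : ∀ k : ℕ,
          a * ((k + 1 + 1 : ℕ) : ℝ) ^ (a - 1) - a * ((k + 1 : ℕ) : ℝ) ^ (a - 1) ≤ 0 := by
        intro k
        rw [sub_nonpos]
        refine mul_le_mul_of_nonneg_left ?_ ha.le
        refine Real.rpow_le_rpow_of_nonpos (by positivity) ?_ (by linarith)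
        push_cast
        linarith
      rw [abs_of_nonpos (Finset.sum_nonpos fun k _ => hneg k), ← Finset.sum_neg_distrib]
      exact Finset.sum_congr rfl fun k _ => abs_of_nonpos (hneg k)
  have hfin : |a * ((N + 1 : ℕ) : ℝ) ^ (a - 1) - a| ≤ a * (1 + ((N + 1 : ℕ) : ℝ) ^ (a - 1)) := by
    have : 0 ≤ ((N + 1 : ℕ) : ℝ) ^ (a - 1) := by positivity
    have h2 : 0 ≤ a * ((N + 1 : ℕ) : ℝ) ^ (a - 1) := by positivity
    rw [abs_le]
    constructor <;> nlinarith
  calc _ ≤ ∑ k ∈ Finset.range N, |trapErr a (k + 1)| + |trapErr a 0| :=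
        (abs_add_le _ _).trans (add_le_add (Finset.abs_sum_le_sum_abs _ _) le_rfl)
    _ ≤ 2 * (a * (1 + ((N + 1 : ℕ) : ℝ) ^ (a - 1))) + 1 := by
        linarith
    _ = _ := by ring

theorem abs_trapErr_le_rpow {σ : ℝ} (h1 : 1 < σ) (h3 : σ ≤ 3) (k : ℕ) :
    |trapErr σ k| ≤ 96 * ((k : ℝ) + 1) ^ (σ - 2) := by
  rcases Nat.eq_zero_or_pos k with rfl | hk
  · have := abs_trapErr_zero_le (a := σ) (by linarith)
    simp only [Nat.cast_zero, zero_add, Real.one_rpow]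
    linarith
  have hk1 : (1 : ℝ) ≤ k := by exact_mod_cast hk
  refine (abs_trapErr_le (by linarith) (Or.inl hk)).trans ?_
  obtain ⟨ξ, hξ, he⟩ := exists_hasDerivAt_eq_slope (fun s : ℝ => σ * s ^ (σ - 1))
    (fun s => σ * ((σ - 1) * s ^ (σ - 1 - 1))) (lt_add_one (k : ℝ))
    (fun s hs => ((Real.hasDerivAt_rpow_const (Or.inl (by linarith [hs.1]))).const_mul
      σ).continuousAt.continuousWithinAt)
    (fun s hs => (Real.hasDerivAt_rpow_const (Or.inl (by linarith [hs.1]))).const_mul σ)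
  rw [show (k : ℝ) + 1 - k = 1 by ring, div_one] at he
  rw [← he]
  have hb : ξ ^ (σ - 1 - 1) ≤ 8 * ((k : ℝ) + 1) ^ (σ - 2) := by
    rw [show σ - 1 - 1 = σ - 2 by ring]
    exact rpow_le_eight_mul (by linarith) (by linarith [hξ.1]) hξ.2.le (by linarith)
  have hb0 : 0 ≤ ξ ^ (σ - 1 - 1) := Real.rpow_nonneg (by linarith [hξ.1]) _
  have hs1 : 0 ≤ σ - 1 := by linarith
  rw [abs_of_nonneg (by positivity)]
  -- The constant is 96 = 2·3·2·8.
  calc 2 * (σ * ((σ - 1) * ξ ^ (σ - 1 - 1)))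
      ≤ 2 * (3 * (2 * (8 * ((k : ℝ) + 1) ^ (σ - 2)))) := by
        gcongr
        linarith
    _ = _ := by ring

/-- Splitting (j+1)^(σ-2) = (j+1)^(σ-1-α) (j+1)^(α-1), the last factor is dominated by `psi α`,
while `kap` is dominated by two shifts of `psi (1 - α)`. Each convolution is at most 1. -/
theorem abs_sum_kap_mul_trapErr_le {α σ : ℝ} (hα : 0 < α) (hα1 : α ≤ 1) (h1 : 1 < σ)
    (h3 : σ ≤ 3) {n : ℕ} (hn : 1 ≤ n) :
    |∑ l ∈ Finset.range n, kap α l * trapErr σ (n - l - 1)|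
      ≤ 384 / α * (1 + (n : ℝ) ^ (σ - 1 - α)) := by
  set M := 96 / α * (1 + (n : ℝ) ^ (σ - 1 - α)) with hM
  have hM0 : 0 ≤ M := by positivity
  have hα0 : 0 ≤ 1 - α := by linarith
  have htrap : ∀ j < n, |trapErr σ j| ≤ M * psi α (j + 1) := by
    intro j hj
    have hjn : ((j + 1 : ℕ) : ℝ) ≤ n := by exact_mod_cast hj
    have hj1 : (1 : ℝ) ≤ ((j + 1 : ℕ) : ℝ) := by push_cast; linarith [j.cast_nonneg (α := ℝ)]
    have hp := mul_rpow_le_psi hα hα1 (show 1 ≤ j + 1 by omega)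
    have ha := rpow_le_one_add_rpow hj1 hjn (σ - 1 - α)
    have e : ((j : ℝ) + 1) ^ (σ - 2)
        = ((j + 1 : ℕ) : ℝ) ^ (σ - 1 - α) * ((j + 1 : ℕ) : ℝ) ^ (α - 1) := by
      rw [← Real.rpow_add (by linarith)]
      push_cast
      congr 1
      ring
    calc |trapErr σ j| ≤ 96 * ((j : ℝ) + 1) ^ (σ - 2) := abs_trapErr_le_rpow h1 h3 j
      _ ≤ 96 * ((1 + (n : ℝ) ^ (σ - 1 - α)) * (psi α (j + 1) / α)) := by
          rw [e]
          gcongr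
          rw [le_div_iff₀ hα, mul_comm]
          exact hp
      _ = _ := by rw [hM]; ring
  have hkap : ∀ l, |kap α l| ≤ 2 * psi (1 - α) l
      + 2 * (if l = 0 then 0 else psi (1 - α) (l - 1)) := by
    intro l
    cases l with
    | zero => simpa using (abs_kap_le hα hα1 0).2
    | succ l =>
      have := (abs_kap_le hα hα1 l).1
      simp only [Nat.succ_ne_zero, if_false, Nat.add_sub_cancel]
      linarith
  have hA : ∑ l ∈ Finset.range n, psi (1 - α) l * psi α (n - l) ≤ 1 := by
    have h := sum_psi_mul_psi α (1 - α) n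
    rw [add_sub_cancel, psi_one, Finset.sum_range_succ] at h
    have h' : ∑ l ∈ Finset.range n, psi (1 - α) l * psi α (n - l)
        = ∑ l ∈ Finset.range n, psi α (n - l) * psi (1 - α) l :=
      Finset.sum_congr rfl fun l _ => mul_comm _ _
    have := mul_nonneg (psi_nonneg hα.le (n - n)) (psi_nonneg hα0 n)
    linarith
  have hB : ∑ l ∈ Finset.range n, (if l = 0 then 0 else psi (1 - α) (l - 1)) * psi α (n - l)
      ≤ 1 := by
    obtain ⟨N, rfl⟩ := Nat.exists_eq_add_of_le' hn
    rw [Finset.sum_range_succ']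
    simp only [Nat.add_sub_cancel, Nat.add_eq_zero_iff, one_ne_zero, and_false, if_false, if_true,
      zero_mul, add_zero, Nat.add_sub_add_right]
    have h := sum_psi_mul_psi α (1 - α) N
    rw [add_sub_cancel, psi_one, Finset.sum_range_succ] at h
    have h' : ∑ l ∈ Finset.range N, psi (1 - α) l * psi α (N - l)
        = ∑ l ∈ Finset.range N, psi α (N - l) * psi (1 - α) l :=
      Finset.sum_congr rfl fun l _ => mul_comm _ _
    have := mul_nonneg (psi_nonneg hα.le (N - N)) (psi_nonneg hα0 N)
    linarith
  calc _ ≤ ∑ l ∈ Finset.range n, (2 * psi (1 - α) l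
          + 2 * (if l = 0 then 0 else psi (1 - α) (l - 1))) * (M * psi α (n - l)) := by
        refine (Finset.abs_sum_le_sum_abs _ _).trans (Finset.sum_le_sum fun l hl => ?_)
        have hl' := Finset.mem_range.1 hl
        have ht := htrap (n - l - 1) (by omega)
        rw [show n - l - 1 + 1 = n - l by omega] at ht
        rw [abs_mul]
        exact mul_le_mul (hkap l) ht (abs_nonneg _) ((abs_nonneg _).trans (hkap l))
    _ = 2 * M * ∑ l ∈ Finset.range n, psi (1 - α) l * psi α (n - l)
        + 2 * M * ∑ l ∈ Finset.range n,
          (if l = 0 then 0 else psi (1 - α) (l - 1)) * psi α (n - l) := by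
        rw [Finset.mul_sum, Finset.mul_sum, ← Finset.sum_add_distrib]
        exact Finset.sum_congr rfl fun l _ => by ring
    _ ≤ 2 * M * 1 + 2 * M * 1 := by gcongr
    _ = _ := by rw [hM]; ring

/-- The critical window: here 1 < σ ≤ 3 and σ > α, and each of the four terms of `powErrSum_one_eq`
is bounded uniformly across σ = 1 + α. -/
theorem exists_abs_sum_powErr_le_of_near {α : ℝ} (hα : 0 < α) (hα1 : α ≤ 1) :
    ∃ C > 0, ∀ σ > 0, |σ - 1 - α| < α / 2 → ∀ n : ℕ, 1 ≤ n →
      |powErrSum 1 α σ n| ≤ C * (1 + σ) ^ 3 * (1 + (n : ℝ) ^ (σ - 1 - α)) := by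
  obtain ⟨C, hC, h⟩ := exists_abs_powErr_le hα hα1
  refine ⟨28 + 9 * C + 384 / α, by positivity, fun σ hσ hnear n hn => ?_⟩
  rw [abs_lt] at hnear
  have hn1 : (1 : ℝ) ≤ n := by exact_mod_cast hn
  have hσ1 : 1 < σ := by linarith
  have hσ3 : σ ≤ 3 := by linarith
  set X := 1 + (n : ℝ) ^ (σ - 1 - α) with hX
  have hP0 : 0 ≤ (n : ℝ) ^ (σ - 1 - α) := by positivity
  have hX1 : 1 ≤ X := by linarith
  set W := (1 + σ) ^ 3 with hW
  have hW1 : 1 + σ ≤ W := le_self_pow₀ (by linarith) (by norm_num)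
  have hW0 : 0 ≤ W := by positivity
  have t1 : |Real.Gamma (σ + 1) / Real.Gamma (σ + 1 - α)
      * ∑ k ∈ Finset.range n, trapErr (σ - α) k| ≤ W * (7 * X) := by
    rw [abs_mul]
    have hs := abs_sum_trapErr_le (a := σ - α) (by linarith) hn
    rw [show σ - α - 1 = σ - 1 - α by ring, ← hX] at hs
    have : 2 * (σ - α) * X ≤ 6 * X := by gcongr; linarith
    gcongr
    · exact (Gamma_div_Gamma_le hα hα1 hσ).trans hW1
    · linarith
  have hneg : (n : ℝ) ^ (-1 - α) ≤ 1 :=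
    Real.rpow_le_one_of_one_le_of_nonpos hn1 (by linarith)
  have t2 : |powErr α (σ + 1) n / (σ + 1)| ≤ 8 * C * W * X := by
    have h2 := h (σ + 1) (by linarith) n hn
    rw [show σ + 1 - 2 - α = σ - 1 - α by ring] at h2
    rw [abs_div, abs_of_pos (by linarith : 0 < σ + 1)]
    have hW2 : (1 + (σ + 1)) ^ 3 ≤ 8 * W := by
      calc (1 + (σ + 1)) ^ 3 ≤ (2 * (1 + σ)) ^ 3 := by gcongr; linarith
        _ = 8 * W := by rw [hW]; ring
    calc _ ≤ |powErr α (σ + 1) n| := div_le_self (abs_nonneg _) (by linarith)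
      _ ≤ C * (8 * W) * ((n : ℝ) ^ (σ - 1 - α) + 1) := by
          refine h2.trans ?_
          gcongr
      _ = _ := by rw [hX]; ring
  have t3 : |powErr α σ n / 2| ≤ C * W * X := by
    have h2 := h σ hσ n hn
    have h4 : (n : ℝ) ^ (σ - 2 - α) ≤ (n : ℝ) ^ (σ - 1 - α) :=
      Real.rpow_le_rpow_of_exponent_le hn1 (by linarith)
    rw [abs_div, abs_of_pos (by norm_num : (0 : ℝ) < 2)]
    calc _ ≤ |powErr α σ n| := div_le_self (abs_nonneg _) (by norm_num)
      _ ≤ C * W * ((n : ℝ) ^ (σ - 1 - α) + 1) := by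
          refine h2.trans ?_
          gcongr
      _ = _ := by rw [hX]; ring
  have t4 := abs_sum_kap_mul_trapErr_le hα hα1 hσ1 hσ3 hn
  rw [powErrSum_one_eq (by linarith) hα]
  refine (abs_add_le _ _).trans ?_
  refine (add_le_add ((abs_add_le _ _).trans (add_le_add ((abs_add_le _ _).trans
    (add_le_add (le_of_eq (abs_neg _)) le_rfl)) le_rfl)) le_rfl).trans ?_
  have h5 : 384 / α * X ≤ 384 / α * W * X := by
    have : 1 ≤ W := by linarith
    calc 384 / α * X = 384 / α * 1 * X := by ring
      _ ≤ _ := by gcongr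
  have h6 : 0 ≤ W * X := by positivity
  linarith

theorem exists_abs_powErrSum_le {α β : ℝ} (hα : 0 < α) (hαβ : α ≤ β) (hβ : β ≤ 1) :
    ∃ C > 0, ∀ σ > 0, ∀ n : ℕ, 1 ≤ n →
      |powErrSum β α σ n| ≤ C * (1 + σ) ^ 3 * (1 + (n : ℝ) ^ (σ - 2 + β - α)) := by
  rcases hβ.lt_or_eq with h | rfl
  · exact exists_abs_powErrSum_le_of_lt hα hαβ h
  · obtain ⟨C1, hC1, h1⟩ := exists_abs_sum_powErr_le_of_far hα hαβ
    obtain ⟨C2, hC2, h2⟩ := exists_abs_sum_powErr_le_of_near hα hαβ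
    refine ⟨max C1 C2, by positivity, fun σ hσ n hn => ?_⟩
    rw [show σ - 2 + 1 - α = σ - 1 - α by ring]
    rcases le_or_gt (α / 2) |σ - 1 - α| with h | h
    · refine (h1 σ hσ h n hn).trans ?_
      gcongr
      exact le_max_left _ _
    · refine (h2 σ hσ h n hn).trans ?_
      gcongr
      exact le_max_right _ _

/-! ### The Caputo derivative of an expansion in powers -/

/-- As σ_k ≥ σ_1 > 0, the quantity 1 + σ_k is at most (1/σ_1 + 1) σ_k. -/
theorem HasExpansion.summable_one_add {c σ : ℕ → ℝ} {T : ℝ} {Y : ℝ → ℝ} (hT : 0 < T)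
    (hσ_pos : ∀ k, 1 ≤ k → 0 < σ k) (hσ_lt : ∀ k, 1 ≤ k → σ k < σ (k + 1))
    (hexp : HasExpansion c σ T Y) :
    Summable fun k : ℕ => |c (k + 1)| * (1 + σ (k + 1)) ^ 3 * T ^ σ (k + 1) := by
  have hmono : ∀ k : ℕ, σ 1 ≤ σ (k + 1) := by
    intro k
    exact (strictMono_nat_of_lt_succ (f := fun k => σ (k + 1)) fun k => hσ_lt _
      (by omega)).monotone (Nat.zero_le k)
  have h1 := hσ_pos 1 le_rfl
  refine Summable.of_nonneg_of_le (fun k => ?_) (fun k => ?_)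
    (hexp.summable.mul_left ((1 / σ 1 + 1) ^ 3))
  · have := hσ_pos (k + 1) (by omega)
    positivity
  · have h2 := hσ_pos (k + 1) (by omega)
    have h3 : 1 + σ (k + 1) ≤ (1 / σ 1 + 1) * σ (k + 1) := by
      have : 1 ≤ 1 / σ 1 * σ (k + 1) := by
        rw [one_div, ← div_eq_inv_mul, le_div_iff₀ h1, one_mul]
        exact hmono k
      linarith
    calc |c (k + 1)| * (1 + σ (k + 1)) ^ 3 * T ^ σ (k + 1)
        ≤ |c (k + 1)| * ((1 / σ 1 + 1) * σ (k + 1)) ^ 3 * T ^ σ (k + 1) := by gcongr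
      _ = _ := by ring

section Series

variable {a S : ℕ → ℝ} {T : ℝ}

/-- The termwise derivative of `∑ a_k t ^ S_k`. -/
def serDeriv (a S : ℕ → ℝ) (s : ℝ) : ℝ := ∑' k, a k * (S k * s ^ (S k - 1))

theorem abs_serDeriv_term_le (hS : ∀ k, 0 < S k) {ε : ℝ} (hε : 0 < ε) (k : ℕ) {s : ℝ}
    (hs : s ∈ Icc ε T) :
    ‖a k * (S k * s ^ (S k - 1))‖ ≤ |a k| * (1 + S k) ^ 3 * T ^ S k * (1 / ε) := by
  have hs0 : 0 < s := hε.trans_le hs.1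
  have hk := hS k
  rw [Real.norm_eq_abs, abs_mul, abs_mul, abs_of_pos hk, abs_of_nonneg (by positivity :
    0 ≤ s ^ (S k - 1)), Real.rpow_sub_one hs0.ne']
  have h1 : S k ≤ (1 + S k) ^ 3 := by
    have : 1 + S k ≤ (1 + S k) ^ 3 := le_self_pow₀ (by linarith) (by norm_num)
    linarith
  have h2 : s ^ S k ≤ T ^ S k := Real.rpow_le_rpow hs0.le hs.2 hk.le
  have hT0 : 0 ≤ T ^ S k := le_trans (by positivity) h2
  calc |a k| * (S k * (s ^ S k / s)) ≤ |a k| * ((1 + S k) ^ 3 * (T ^ S k / ε)) := by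
        gcongr
        exact hs.1
    _ = _ := by ring

theorem continuousOn_serDeriv (hS : ∀ k, 0 < S k)
    (hsum : Summable fun k => |a k| * (1 + S k) ^ 3 * T ^ S k) :
    ContinuousOn (serDeriv a S) (Ioc 0 T) := by
  intro t ht
  have h : ContinuousOn (serDeriv a S) (Icc (t / 2) T) := by
    refine continuousOn_tsum (fun k => ?_) (hsum.mul_right (1 / (t / 2)))
      (fun k s hs => abs_serDeriv_term_le hS (by linarith [ht.1]) k hs)
    intro s hs
    have : 0 < s := by linarith [hs.1, ht.1]
    exact ((Real.continuousAt_rpow_const _ _ (Or.inl this.ne')).const_mul _).const_mul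
      _ |>.continuousWithinAt
  refine (h t ⟨by linarith [ht.1], ht.2⟩).mono_of_mem_nhdsWithin ?_
  refine mem_nhdsWithin.2 ⟨Ioi (t / 2), isOpen_Ioi, by simp [ht.1], ?_⟩
  rintro s ⟨hs1, hs2⟩
  exact ⟨le_of_lt hs1, hs2.2⟩

theorem hasDerivAt_of_hasSum {Y : ℝ → ℝ} (hS : ∀ k, 0 < S k)
    (hsum : Summable fun k => |a k| * (1 + S k) ^ 3 * T ^ S k)
    (hY : ∀ t ∈ Icc 0 T, HasSum (fun k => a k * t ^ S k) (Y t - Y 0)) {t : ℝ}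
    (ht : t ∈ Ioo 0 T) : HasDerivAt Y (serDeriv a S t) t := by
  have hmem : t ∈ Ioo (t / 2) T := ⟨by linarith [ht.1], ht.2⟩
  have h := hasDerivAt_tsum_of_isPreconnected (g := fun k z => a k * z ^ S k)
    (g' := fun k z => a k * (S k * z ^ (S k - 1))) (t := Ioo (t / 2) T) (y₀ := t) (y := t)
    (hsum.mul_right (1 / (t / 2))) isOpen_Ioo isPreconnected_Ioo
    (fun k z hz => (Real.hasDerivAt_rpow_const
      (Or.inl (by linarith [hz.1, ht.1] : (0 : ℝ) < z).ne')).const_mul (a k))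
    (fun k z hz => abs_serDeriv_term_le hS (by linarith [ht.1]) k (Ioo_subset_Icc_self hz))
    hmem (hY t (Ioo_subset_Icc_self ht)).summable hmem
  have h2 := h.add_const (Y 0)
  refine h2.congr_of_eventuallyEq ?_
  filter_upwards [Ioo_mem_nhds ht.1 ht.2] with z hz
  rw [(hY z (Ioo_subset_Icc_self hz)).tsum_eq]
  ring

/-- Needed when t = T, where Y has only a one-sided derivative: the derivative on (0, t) has a limit
at t, and Y is continuous there. -/
theorem derivWithin_right_end {Y : ℝ → ℝ} (hS : ∀ k, 0 < S k)
    (hsum : Summable fun k => |a k| * (1 + S k) ^ 3 * T ^ S k)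
    (hY : ∀ t ∈ Icc 0 T, HasSum (fun k => a k * t ^ S k) (Y t - Y 0))
    (hYc : ContinuousOn Y (Icc 0 T)) {t : ℝ} (ht : t ∈ Ioc 0 T) :
    derivWithin Y (Icc 0 t) t = serDeriv a S t := by
  have hder : ∀ s ∈ Ioo 0 t, HasDerivAt Y (serDeriv a S s) s := fun s hs =>
    hasDerivAt_of_hasSum hS hsum hY ⟨hs.1, hs.2.trans_le ht.2⟩
  have h : HasDerivWithinAt Y (serDeriv a S t) (Iic t) t := by
    refine hasDerivWithinAt_Iic_of_tendsto_deriv (s := Ioo 0 t)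
      (fun s hs => (hder s hs).differentiableAt.differentiableWithinAt)
      ((hYc t ⟨ht.1.le, ht.2⟩).mono fun s hs => ⟨hs.1.le, hs.2.le.trans ht.2⟩)
      (Ioo_mem_nhdsLT ht.1) ?_
    have h1 : Tendsto (serDeriv a S) (nhdsWithin t (Ioo 0 t)) (nhds (serDeriv a S t)) :=
      (continuousOn_serDeriv hS hsum t ht).mono_left
        (nhdsWithin_mono _ fun s hs => ⟨hs.1, hs.2.le.trans ht.2⟩)
    rw [← nhdsWithin_Ioo_eq_nhdsLT ht.1]
    refine h1.congr' ?_
    filter_upwards [self_mem_nhdsWithin] with s hs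
    exact (hder s hs).deriv.symm
  exact (h.mono Icc_subset_Iic_self).derivWithin
    (uniqueDiffOn_Icc ht.1 t ⟨ht.1.le, le_rfl⟩)

/-- For α < 1 sum and integral are exchanged by absolute convergence: the L¹ norms of the terms are
Beta integrals, and `Gamma_div_Gamma_le` makes them summable. For α = 1 the derivative at the right
end is the termwise one. -/
theorem hasSum_caputo {α : ℝ} (hα : 0 < α) (hα1 : α ≤ 1) {Y : ℝ → ℝ} (hS : ∀ k, 0 < S k)
    (hsum : Summable fun k => |a k| * (1 + S k) ^ 3 * T ^ S k)
    (hY : ∀ t ∈ Icc 0 T, HasSum (fun k => a k * t ^ S k) (Y t - Y 0))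
    (hYc : ContinuousOn Y (Icc 0 T)) {t : ℝ} (ht : t ∈ Ioc 0 T) :
    HasSum (fun k => a k * (Real.Gamma (S k + 1) / Real.Gamma (S k + 1 - α) * t ^ (S k - α)))
      (caputo α Y t) := by
  rcases hα1.lt_or_eq with h1 | rfl
  · have hα0 : 0 < 1 - α := by linarith
    have hG := Real.Gamma_pos_of_pos hα0
    set F : ℕ → ℝ → ℝ := fun k s => (t - s) ^ (-α) * (a k * (S k * s ^ (S k - 1))) with hF
    have hFe : ∀ k s, F k s = a k * S k * (s ^ (S k - 1) * (t - s) ^ (1 - α - 1)) := by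
      intro k s
      rw [show 1 - α - 1 = -α by ring, hF]
      ring
    have hval : ∀ k, ∫ s in (0 : ℝ)..t, s ^ (S k - 1) * (t - s) ^ (1 - α - 1)
        = t ^ (S k - α) * (Real.Gamma (S k) * Real.Gamma (1 - α) / Real.Gamma (S k + 1 - α)) := by
      intro k
      rw [integral_rpow_mul_sub_rpow (hS k) hα0 ht.1, show S k + (1 - α) - 1 = S k - α by ring,
        show S k + (1 - α) = S k + 1 - α by ring]
    have hint : ∀ k, IntervalIntegrable (F k) volume 0 t := by
      intro k
      simp only [funext (hFe k)]
      exact (intervalIntegrable_rpow_mul_sub_rpow (hS k) hα0 ht.1).const_mul _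
    have hnorm : ∀ k, ∫ s in Ioc 0 t, ‖F k s‖ = |a k| * Real.Gamma (1 - α)
        * (Real.Gamma (S k + 1) / Real.Gamma (S k + 1 - α)) * t ^ (S k - α) := by
      intro k
      have e : ∫ s in Ioc 0 t, ‖F k s‖
          = ∫ s in Ioc 0 t, |a k| * S k * (s ^ (S k - 1) * (t - s) ^ (1 - α - 1)) := by
        refine setIntegral_congr_fun measurableSet_Ioc fun s hs => ?_
        have p1 : 0 ≤ s ^ (S k - 1) := Real.rpow_nonneg hs.1.le _
        have p2 : 0 ≤ (t - s) ^ (1 - α - 1) := Real.rpow_nonneg (by linarith [hs.2]) _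
        simp only [hFe]
        rw [Real.norm_eq_abs, abs_mul, abs_mul, abs_of_pos (hS k),
          abs_of_nonneg (mul_nonneg p1 p2)]
      rw [e, ← intervalIntegral.integral_of_le ht.1.le, intervalIntegral.integral_const_mul,
        hval, Real.Gamma_add_one (hS k).ne']
      ring
    have hle : ∀ k, t ^ (S k - α) ≤ T ^ S k * t ^ (-α) := by
      intro k
      rw [show S k - α = S k + -α by ring, Real.rpow_add ht.1]
      have := Real.rpow_le_rpow ht.1.le ht.2 (hS k).le
      have : 0 ≤ t ^ (-α) := Real.rpow_nonneg ht.1.le _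
      gcongr
    have hFs : Summable fun k => ∫ s in Ioc 0 t, ‖F k s‖ := by
      refine Summable.of_nonneg_of_le (fun k => integral_nonneg fun s => norm_nonneg _)
        (fun k => ?_) (hsum.mul_right (Real.Gamma (1 - α) * t ^ (-α)))
      rw [hnorm k]
      have hk := hS k
      have g1 : Real.Gamma (S k + 1) / Real.Gamma (S k + 1 - α) ≤ (1 + S k) ^ 3 :=
        ((le_abs_self _).trans (Gamma_div_Gamma_le hα hα1 hk)).trans
          (le_self_pow₀ (by linarith) (by norm_num))
      have g2 : 0 ≤ t ^ (S k - α) := Real.rpow_nonneg ht.1.le _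
      calc _ ≤ |a k| * Real.Gamma (1 - α) * (1 + S k) ^ 3 * (T ^ S k * t ^ (-α)) := by
            gcongr
            exact hle k
        _ = _ := by ring
    have hmain := hasSum_integral_of_summable_integral_norm
      (fun k => (intervalIntegrable_iff_integrableOn_Ioc_of_le ht.1.le).1 (hint k)) hFs
    have hcap : caputo α Y t
        = 1 / Real.Gamma (1 - α) * ∫ s in Ioc 0 t, ∑' k, F k s := by
      rw [caputo, if_neg h1.ne, intervalIntegral.integral_of_le ht.1.le, integral_Ioc_eq_integral_Ioo,
        integral_Ioc_eq_integral_Ioo]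
      congr 1
      refine setIntegral_congr_fun measurableSet_Ioo fun s hs => ?_
      have hd := hasDerivAt_of_hasSum hS hsum hY (t := s) ⟨hs.1, hs.2.trans_le ht.2⟩
      simp only [hF]
      rw [tsum_mul_left, derivWithin_of_mem_nhds (Icc_mem_nhds hs.1 hs.2), hd.deriv]
      rfl
    rw [hcap]
    have e : (fun k => a k * (Real.Gamma (S k + 1) / Real.Gamma (S k + 1 - α) * t ^ (S k - α)))
        = fun k => 1 / Real.Gamma (1 - α) * ∫ s in Ioc 0 t, F k s := by
      funext k
      rw [← intervalIntegral.integral_of_le ht.1.le]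
      simp only [hFe]
      rw [intervalIntegral.integral_const_mul, hval, Real.Gamma_add_one (hS k).ne']
      field_simp
    rw [e]
    exact hmain.mul_left (1 / Real.Gamma (1 - α))
  · rw [caputo, if_pos rfl, derivWithin_right_end hS hsum hY hYc ht]
    have hs : Summable fun k => a k * (S k * t ^ (S k - 1)) :=
      Summable.of_norm_bounded (hsum.mul_right (1 / t))
        fun k => abs_serDeriv_term_le hS ht.1 k ⟨le_rfl, ht.2⟩
    have e : (fun k => a k * (Real.Gamma (S k + 1) / Real.Gamma (S k + 1 - 1) * t ^ (S k - 1)))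
        = fun k => a k * (S k * t ^ (S k - 1)) := by
      funext k
      have hG := (Real.Gamma_pos_of_pos (hS k)).ne'
      rw [show S k + 1 - 1 = S k by ring, Real.Gamma_add_one (hS k).ne']
      field_simp
    rw [e]
    exact hs.hasSum

end Series

/-! ### Stability -/

/-- The fractional sum of order `β` of `s 1, …, s n`. -/
def fracSum (β : ℝ) (s : ℕ → ℝ) (n : ℕ) : ℝ :=
  ∑ k ∈ Finset.range n, psi β (n - 1 - k) * s (k + 1)

theorem fracSum_add (β : ℝ) (s s' : ℕ → ℝ) (n : ℕ) :
    fracSum β (fun k => s k + s' k) n = fracSum β s n + fracSum β s' n := by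
  simp only [fracSum, mul_add, Finset.sum_add_distrib]

theorem fracSum_sum {ι : Type*} (I : Finset ι) (β : ℝ) (b : ι → ℝ) (s : ι → ℕ → ℝ) (n : ℕ) :
    fracSum β (fun k => ∑ j ∈ I, b j * s j k) n = ∑ j ∈ I, b j * fracSum β (s j) n := by
  simp only [fracSum, Finset.mul_sum]
  rw [Finset.sum_comm]
  exact Finset.sum_congr rfl fun j _ => Finset.sum_congr rfl fun k _ => by ring

/-- The weighted and shifted sum `∑_{k=0}^n g_{n-k} e_k`. -/
def wsglSum (α : ℝ) (e : ℕ → ℝ) (n : ℕ) : ℝ :=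
  ∑ k ∈ Finset.range (n + 1), wsglWeight α (n - k) * e k

/-- The product (1-z)^(-β) (1-z)^α (1 + α(1-z)/2), its last factor acting on e. At k = 0 the
truncated index k - 1 is 0, harmless because e 0 = 0. For α = β the kernel `psi 0` is a delta. -/
theorem fracSum_wsglSum (α β : ℝ) {e : ℕ → ℝ} (he : e 0 = 0) (n : ℕ) :
    fracSum β (wsglSum α e) n = ∑ k ∈ Finset.range (n + 1),
      psi (β - α) (n - k) * ((1 + α / 2) * e k - α / 2 * e (k - 1)) := by
  have h0 : wsglSum α e 0 = 0 := by simp [wsglSum, he]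
  have h1 : fracSum β (wsglSum α e) n
      = PowerSeries.coeff n (PowerSeries.mk (psi β) * PowerSeries.mk (wsglSum α e)) := by
    rw [coeff_mk_mul_mk, Finset.sum_range_succ', h0, mul_zero, add_zero, fracSum]
    refine Finset.sum_congr rfl fun k _ => ?_
    rw [show n - 1 - k = n - (k + 1) by omega]
  have h2 : PowerSeries.mk (wsglSum α e)
      = PowerSeries.mk (wsglWeight α) * PowerSeries.mk e := by
    ext k
    rw [coeff_mk_mul_mk, PowerSeries.coeff_mk, wsglSum]
  have h3 : (1 + PowerSeries.C (α / 2) * (1 - PowerSeries.X)) * PowerSeries.mk e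
      = PowerSeries.mk fun k => (1 + α / 2) * e k - α / 2 * e (k - 1) := by
    rw [show (1 + PowerSeries.C (α / 2) * (1 - PowerSeries.X)) * PowerSeries.mk e
      = PowerSeries.C (1 + α / 2) * PowerSeries.mk e
        - PowerSeries.C (α / 2) * (PowerSeries.X * PowerSeries.mk e) by
      rw [map_add, map_one]; ring]
    ext k
    cases k with
    | zero => simp [he]
    | succ k => simp only [map_sub, PowerSeries.coeff_C_mul, PowerSeries.coeff_succ_X_mul,
        PowerSeries.coeff_mk, Nat.add_sub_cancel]
  rw [h1, h2, mk_wsglWeight, ← glSeries_neg_eq, mul_assoc, h3, ← mul_assoc, ← glSeries_add,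
    show -β + α = -(β - α) by ring, glSeries_neg_eq, coeff_mk_mul_mk]

theorem psi_zero_succ (k : ℕ) : psi 0 (k + 1) = 0 := by
  induction k with
  | zero => simp [psi_succ, psi_zero]
  | succ k ih => rw [psi_succ, ih, zero_mul]

theorem sum_psi_zero_mul (u : ℕ → ℝ) (n : ℕ) :
    ∑ k ∈ Finset.range (n + 1), psi 0 (n - k) * u k = u n := by
  rw [Finset.sum_range_succ, Finset.sum_eq_zero, zero_add, Nat.sub_self, psi_zero, one_mul]
  intro k hk
  rw [show n - k = n - k - 1 + 1 by have := Finset.mem_range.1 hk; omega, psi_zero_succ, zero_mul]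

/-- Inversion of the fractional sum. -/
theorem eq_sum_glWeight_mul_fracSum (β : ℝ) (s : ℕ → ℝ) (n : ℕ) :
    s (n + 1) = ∑ k ∈ Finset.range (n + 1), glWeight β (n - k) * fracSum β s (k + 1) := by
  have h : PowerSeries.mk (fun k => fracSum β s (k + 1))
      = PowerSeries.mk (psi β) * PowerSeries.mk fun k => s (k + 1) := by
    ext k
    rw [coeff_mk_mul_mk, PowerSeries.coeff_mk, fracSum]
    rfl
  rw [← coeff_mk_mul_mk (glWeight β) (fun k => fracSum β s (k + 1)), h, ← mul_assoc]
  have h2 : PowerSeries.mk (glWeight β) * PowerSeries.mk (psi β) = 1 := by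
    rw [← glSeries_neg_eq]
    change glSeries β * glSeries (-β) = 1
    rw [← glSeries_add, add_neg_cancel, glSeries_zero]
  rw [h2, one_mul, PowerSeries.coeff_mk]

/-- A kernel bound in a geometrically weighted sup norm. -/
theorem abs_sum_psi_mul_mul_pow_le {δ x S : ℝ} (hδ : 0 ≤ δ) (hx0 : 0 ≤ x) (hx1 : x < 1)
    {u : ℕ → ℝ} {n : ℕ} (hu : ∀ k ≤ n, |u k| * x ^ k ≤ S) :
    |∑ k ∈ Finset.range (n + 1), psi δ (n - k) * u k| * x ^ n ≤ (1 - x) ^ (-δ) * S := by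
  have hS : 0 ≤ S := le_trans (by positivity) (hu 0 (Nat.zero_le _))
  calc |∑ k ∈ Finset.range (n + 1), psi δ (n - k) * u k| * x ^ n
      ≤ (∑ k ∈ Finset.range (n + 1), psi δ (n - k) * |u k|) * x ^ n := by
        refine mul_le_mul_of_nonneg_right ((Finset.abs_sum_le_sum_abs _ _).trans
          (le_of_eq (Finset.sum_congr rfl fun k _ => ?_))) (pow_nonneg hx0 n)
        rw [abs_mul, abs_of_nonneg (psi_nonneg hδ _)]
    _ = ∑ k ∈ Finset.range (n + 1), psi δ (n - k) * x ^ (n - k) * (|u k| * x ^ k) := by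
        rw [Finset.sum_mul]
        refine Finset.sum_congr rfl fun k hk => ?_
        have hk' : k ≤ n := by simpa [Nat.lt_succ_iff] using hk
        rw [← pow_sub_mul_pow x hk']
        ring
    _ ≤ ∑ k ∈ Finset.range (n + 1), psi δ (n - k) * x ^ (n - k) * S := by
        refine Finset.sum_le_sum fun k hk => mul_le_mul_of_nonneg_left (hu k ?_)
          (mul_nonneg (psi_nonneg hδ _) (pow_nonneg hx0 _))
        simpa [Nat.lt_succ_iff] using hk
    _ = (∑ k ∈ Finset.range (n + 1), psi δ k * x ^ k) * S := by
        rw [← Finset.sum_mul, ← Finset.sum_range_reflect (fun k => psi δ k * x ^ k) (n + 1)]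
        simp
    _ ≤ _ := mul_le_mul_of_nonneg_right (sum_psi_mul_pow_le hδ hx0 hx1 _) hS

theorem exists_small_rpow_sum {ι : Type*} (I : Finset ι) (b δ : ι → ℝ) (hδ : ∀ i ∈ I, 0 < δ i)
    (K : ℝ) {β : ℝ} (hβ : 0 < β) {ε : ℝ} (hε : 0 < ε) :
    ∃ μ : ℝ, 0 < μ ∧ ∑ i ∈ I, b i * μ ^ (-δ i) + K * μ ^ (-β) ≤ ε := by
  have h : Tendsto (fun μ : ℝ => ∑ i ∈ I, b i * μ ^ (-δ i) + K * μ ^ (-β)) atTop (nhds 0) := by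
    have : Tendsto (fun μ : ℝ => ∑ i ∈ I, b i * μ ^ (-δ i) + K * μ ^ (-β)) atTop
        (nhds (∑ i ∈ I, b i * 0 + K * 0)) :=
      (tendsto_finsetSum _ fun i hi => (tendsto_rpow_neg_atTop (hδ i hi)).const_mul _).add
        ((tendsto_rpow_neg_atTop hβ).const_mul _)
    simpa using this
  obtain ⟨μ, h1, h2⟩ := ((h.eventually (Iio_mem_nhds hε)).and (eventually_gt_atTop 0)).exists
  exact ⟨μ, h2, le_of_lt h1⟩

theorem fracSum_eq_sum (β : ℝ) {s : ℕ → ℝ} (hs : s 0 = 0) (n : ℕ) :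
    fracSum β s n = ∑ k ∈ Finset.range (n + 1), psi β (n - k) * s k := by
  rw [Finset.sum_range_succ', hs, mul_zero, add_zero, fracSum]
  refine Finset.sum_congr rfl fun k _ => ?_
  rw [show n - 1 - k = n - (k + 1) by omega]

theorem inv_one_sub_pow_le {y : ℝ} (hy0 : 0 ≤ y) (hy : y ≤ 1 / 2) (n : ℕ) :
    1 ≤ Real.exp (2 * (n * y)) * (1 - y) ^ n := by
  have h : 1 ≤ Real.exp (2 * y) * (1 - y) := by
    have h1 : 1 + 2 * y ≤ Real.exp (2 * y) := by linarith [Real.add_one_le_exp (2 * y)]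
    nlinarith
  calc (1 : ℝ) = 1 ^ n := (one_pow n).symm
    _ ≤ (Real.exp (2 * y) * (1 - y)) ^ n := by gcongr
    _ = _ := by
      rw [mul_pow, ← Real.exp_nat_mul]
      ring_nf

/-- A maximum argument in the norm max |e_k| x^k, x = 1 - μτ, takes the place of a discrete Gronwall
inequality. The source enters only through its fractional sums, so it need not be small pointwise.
-/
theorem stability_aux {Q : ℕ} [NeZero Q] {ν α : Fin Q → ℝ} (hν₁ : 0 < ν 0) (hν : ∀ j, 0 ≤ ν j)
    (hα_anti : Antitone α) (hα : ∀ j, 0 < α j ∧ α j ≤ 1) {T K : ℝ} (hK : 0 ≤ K) :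
    ∃ C > 0, ∃ τ₀ > 0, ∀ τ : ℝ, 0 < τ → τ ≤ τ₀ → ∀ N : ℕ, N * τ ≤ T →
      ∀ (e s : ℕ → ℝ) (M : ℝ), e 0 = 0 →
      (∀ n, 1 ≤ n → n ≤ N → |∑ j, ν j * (1 / τ ^ α j) * wsglSum (α j) e n - s n| ≤ K * |e n|) →
      (∀ n ≤ N, τ ^ α 0 * |fracSum (α 0) s n| ≤ M) → ∀ n ≤ N, |e n| ≤ C * M := by
  classical
  set β := α 0 with hβ
  have hβ0 : 0 < β := (hα 0).1
  have hαβ : ∀ j, α j ≤ β := fun j => hα_anti (Fin.zero_le j)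
  set J := Finset.univ.filter fun j => α j = β with hJ
  set Λ : ℝ := ∑ j ∈ J, ν j with hΛ
  have hΛ0 : 0 < Λ := Finset.sum_pos' (fun j _ => hν j) ⟨0, by simp [hJ, hβ], hν₁⟩
  set J' := Finset.univ.filter fun j => ¬ α j = β with hJ'
  have hJ'lt : ∀ j ∈ J', 0 < β - α j := fun j hj =>
    sub_pos.2 (lt_of_le_of_ne (hαβ j) (Finset.mem_filter.1 hj).2)
  -- μ is so large that lower-order and Lipschitz terms together cost at most half of Λ, the total
  -- coefficient of the leading order. The step restriction gives μτ ≤ 1/2, so that undoing the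
  -- weight x^k costs at most exp(2μT).
  obtain ⟨μ, hμ, hμs⟩ := exists_small_rpow_sum J' (fun j => 2 * ν j) (fun j => β - α j) hJ'lt
    K hβ0 (ε := Λ / 2) (by positivity)
  refine ⟨Real.exp (2 * (μ * T)) * (2 / Λ), by positivity, 1 / (2 * μ), by positivity, ?_⟩
  intro τ hτ hττ N hN e s M he hres hM
  set y := μ * τ with hy
  have hy0 : 0 < y := by positivity
  have hy1 : y ≤ 1 / 2 := by
    rw [le_div_iff₀ (by positivity)] at hττ
    rw [hy]; linarith
  set x := 1 - y with hx
  have hx0 : 0 ≤ x := by linarith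
  have hx1 : x < 1 := by linarith
  obtain ⟨n, hn, hmax⟩ := Finset.exists_max_image (Finset.range (N + 1)) (fun k => |e k| * x ^ k)
    ⟨0, by simp⟩
  have hnN : n ≤ N := by simpa [Nat.lt_succ_iff] using hn
  set S := |e n| * x ^ n with hS
  have hSk : ∀ k ≤ N, |e k| * x ^ k ≤ S := fun k hk => hmax k (by simpa [Nat.lt_succ_iff] using hk)
  have hS0 : 0 ≤ S := by positivity
  have hM0 : 0 ≤ M := by simpa [fracSum] using hM 0 (Nat.zero_le _)
  have hpred : ∀ k ≤ n, |e (k - 1)| * x ^ k ≤ S := fun k hk =>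
    (mul_le_mul_of_nonneg_left (pow_le_pow_of_le_one hx0 hx1.le (Nat.sub_le k 1))
      (abs_nonneg _)).trans (hSk (k - 1) (by omega))
  have hxn1 : x ^ n ≤ 1 := pow_le_one₀ hx0 hx1.le
  have hxn0 : 0 ≤ x ^ n := pow_nonneg hx0 n
  set ρ : ℕ → ℝ := fun n => ∑ j, ν j * (1 / τ ^ α j) * wsglSum (α j) e n with hρ
  -- The residual at index 0 never enters `fracSum`; setting it to 0 allows writing the sum as a
  -- full convolution.
  set r : ℕ → ℝ := fun k => if k = 0 then 0 else ρ k - s k with hr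
  set D : Fin Q → ℝ := fun j => fracSum β (wsglSum (α j) e) n with hD
  have hr0 : r 0 = 0 := by simp [hr]
  have hsplit : fracSum β ρ n = fracSum β s n + fracSum β r n := by
    rw [← fracSum_add]
    refine Finset.sum_congr rfl fun k _ => ?_
    simp [hr]
  have hDle : ∀ j ∈ J', |D j| * x ^ n ≤ (1 - x) ^ (-(β - α j)) * (2 * S) := by
    intro j hj
    simp only [hD]
    rw [fracSum_wsglSum _ _ he]
    refine abs_sum_psi_mul_mul_pow_le (hJ'lt j hj).le hx0 hx1 fun k hk => ?_
    have h1 := hSk k (hk.trans hnN)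
    have h2 := hpred k hk
    have hj1 := hα j
    have hxk : 0 ≤ x ^ k := pow_nonneg hx0 k
    calc |(1 + α j / 2) * e k - α j / 2 * e (k - 1)| * x ^ k
        ≤ ((1 + α j / 2) * |e k| + α j / 2 * |e (k - 1)|) * x ^ k := by
          refine mul_le_mul_of_nonneg_right ((abs_sub _ _).trans (le_of_eq ?_)) hxk
          rw [abs_mul, abs_mul, abs_of_pos (by linarith : 0 < 1 + α j / 2),
            abs_of_pos (by linarith : 0 < α j / 2)]
      _ = (1 + α j / 2) * (|e k| * x ^ k) + α j / 2 * (|e (k - 1)| * x ^ k) := by ring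
      _ ≤ (1 + α j / 2) * S + α j / 2 * S := by
          have : 0 < α j / 2 := by linarith
          gcongr
      _ ≤ 2 * S := by nlinarith
  have hrle : |fracSum β r n| * x ^ n ≤ (1 - x) ^ (-β) * (K * S) := by
    rw [fracSum_eq_sum β hr0]
    refine abs_sum_psi_mul_mul_pow_le hβ0.le hx0 hx1 fun k hk => ?_
    rcases Nat.eq_zero_or_pos k with rfl | hk1
    · simp [hr0]; positivity
    · have h1 := hres k hk1 (hk.trans hnN)
      have h2 := hSk k (hk.trans hnN)
      have h3 : r k = ρ k - s k := by simp [hr, hk1.ne']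
      rw [h3]
      calc |ρ k - s k| * x ^ k ≤ K * |e k| * x ^ k :=
            mul_le_mul_of_nonneg_right h1 (pow_nonneg hx0 k)
        _ = K * (|e k| * x ^ k) := by ring
        _ ≤ K * S := by gcongr
  have hmain : ∀ j ∈ J, D j = (1 + β / 2) * e n - β / 2 * e (n - 1) := by
    intro j hj
    simp only [hD]
    rw [fracSum_wsglSum _ _ he, (Finset.mem_filter.1 hj).2, sub_self,
      sum_psi_zero_mul (fun k => (1 + β / 2) * e k - β / 2 * e (k - 1))]
  have hpow : ∀ j, τ ^ β * (ν j * (1 / τ ^ α j)) = ν j * τ ^ (β - α j) := by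
    intro j
    rw [Real.rpow_sub hτ]
    ring
  have hid : Λ * ((1 + β / 2) * e n - β / 2 * e (n - 1))
      = τ ^ β * fracSum β s n + τ ^ β * fracSum β r n - ∑ j ∈ J', ν j * τ ^ (β - α j) * D j := by
    have h1 : τ ^ β * fracSum β ρ n = ∑ j, ν j * τ ^ (β - α j) * D j := by
      rw [hρ, fracSum_sum Finset.univ β (fun j => ν j * (1 / τ ^ α j)) fun j => wsglSum (α j) e,
        Finset.mul_sum]
      exact Finset.sum_congr rfl fun j _ => by rw [← hpow j]; ring
    have h2 := Finset.sum_filter_add_sum_filter_not Finset.univ (fun j => α j = β)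
      fun j => ν j * τ ^ (β - α j) * D j
    have h3 : ∑ j ∈ J, ν j * τ ^ (β - α j) * D j
        = Λ * ((1 + β / 2) * e n - β / 2 * e (n - 1)) := by
      rw [hΛ, Finset.sum_mul]
      refine Finset.sum_congr rfl fun j hj => ?_
      rw [hmain j hj, (Finset.mem_filter.1 hj).2, sub_self, Real.rpow_zero, mul_one]
    rw [hsplit] at h1
    linarith
  -- At the maximising index the previous weighted error is at most S, so at least (1 + β/2)S -
  -- (β/2)S = S survives.
  have hlow : Λ * S ≤ |Λ * ((1 + β / 2) * e n - β / 2 * e (n - 1))| * x ^ n := by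
    have h1 := hpred n le_rfl
    have h2 : (1 + β / 2) * |e n| - β / 2 * |e (n - 1)|
        ≤ |(1 + β / 2) * e n - β / 2 * e (n - 1)| := by
      have := abs_sub_abs_le_abs_sub ((1 + β / 2) * e n) (β / 2 * e (n - 1))
      rwa [abs_mul, abs_mul, abs_of_pos (by linarith : 0 < 1 + β / 2),
        abs_of_pos (by linarith : 0 < β / 2)] at this
    rw [abs_mul, abs_of_pos hΛ0, mul_assoc]
    refine mul_le_mul_of_nonneg_left ?_ hΛ0.le
    calc S ≤ (1 + β / 2) * S - β / 2 * (|e (n - 1)| * x ^ n) := by nlinarith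
      _ = ((1 + β / 2) * |e n| - β / 2 * |e (n - 1)|) * x ^ n := by rw [hS]; ring
      _ ≤ _ := mul_le_mul_of_nonneg_right h2 hxn0
  -- The kernel norm (μτ)^(-δ) meets exactly the factor τ^δ, leaving a bound independent of τ.
  have hcancel : ∀ δ : ℝ, τ ^ δ * (1 - x) ^ (-δ) = μ ^ (-δ) := by
    intro δ
    rw [show 1 - x = μ * τ by simp [hx, hy], Real.mul_rpow hμ.le hτ.le, Real.rpow_neg hτ.le]
    have := (Real.rpow_pos_of_pos hτ δ).ne'
    field_simp
  have hup : |Λ * ((1 + β / 2) * e n - β / 2 * e (n - 1))| * x ^ n ≤ M + Λ / 2 * S := by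
    have hτβ : 0 < τ ^ β := Real.rpow_pos_of_pos hτ β
    have t1 : |τ ^ β * fracSum β s n| * x ^ n ≤ M := by
      rw [abs_mul, abs_of_pos hτβ]
      exact (mul_le_of_le_one_right (by positivity) hxn1).trans (hM n hnN)
    have t2 : |τ ^ β * fracSum β r n| * x ^ n ≤ K * μ ^ (-β) * S := by
      rw [abs_mul, abs_of_pos hτβ, mul_assoc]
      refine (mul_le_mul_of_nonneg_left hrle hτβ.le).trans (le_of_eq ?_)
      rw [← hcancel]; ring
    have t3 : |∑ j ∈ J', ν j * τ ^ (β - α j) * D j| * x ^ n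
        ≤ (∑ j ∈ J', 2 * ν j * μ ^ (-(β - α j))) * S := by
      rw [Finset.sum_mul]
      refine (mul_le_mul_of_nonneg_right (Finset.abs_sum_le_sum_abs _ _) hxn0).trans ?_
      rw [Finset.sum_mul]
      refine Finset.sum_le_sum fun j hj => ?_
      have p : 0 ≤ ν j * τ ^ (β - α j) := mul_nonneg (hν j) (Real.rpow_nonneg hτ.le _)
      rw [abs_mul, abs_of_nonneg p, mul_assoc]
      refine (mul_le_mul_of_nonneg_left (hDle j hj) p).trans (le_of_eq ?_)
      rw [← hcancel]; ring
    rw [hid]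
    have t4 := (abs_sub (τ ^ β * fracSum β s n + τ ^ β * fracSum β r n)
      (∑ j ∈ J', ν j * τ ^ (β - α j) * D j)).trans (add_le_add_left (abs_add_le _ _) _)
    refine (mul_le_mul_of_nonneg_right t4 hxn0).trans ?_
    have t5 := mul_le_mul_of_nonneg_right hμs hS0
    linarith
  have hSle : S ≤ 2 / Λ * M := by
    rw [div_mul_eq_mul_div, le_div_iff₀ hΛ0]
    linarith
  intro k hk
  have h1 := inv_one_sub_pow_le hy0.le hy1 k
  have h2 : Real.exp (2 * (k * y)) ≤ Real.exp (2 * (μ * T)) := by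
    refine Real.exp_le_exp.2 ?_
    have : (k : ℝ) * τ ≤ T := le_trans (mul_le_mul_of_nonneg_right (by exact_mod_cast hk) hτ.le) hN
    rw [hy]
    nlinarith
  calc |e k| ≤ |e k| * (Real.exp (2 * (k * y)) * x ^ k) :=
        le_mul_of_one_le_right (abs_nonneg _) h1
    _ = Real.exp (2 * (k * y)) * (|e k| * x ^ k) := by ring
    _ ≤ Real.exp (2 * (μ * T)) * (2 / Λ * M) :=
        mul_le_mul h2 ((hSk k hk).trans hSle) (by positivity) (by positivity)
    _ = _ := by ring

theorem abs_sum_mul_le_sum_abs_mul (w : ℕ → ℝ) {u : ℕ → ℝ} {n m : ℕ} (hnm : n ≤ m) {E : ℝ}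
    (hu : ∀ k ≤ n, |u k| ≤ E) :
    |∑ k ∈ Finset.range (n + 1), w (n - k) * u k| ≤ (∑ i ∈ Finset.range (m + 1), |w i|) * E := by
  have hE : 0 ≤ E := (abs_nonneg _).trans (hu 0 (Nat.zero_le _))
  calc |∑ k ∈ Finset.range (n + 1), w (n - k) * u k|
      ≤ ∑ k ∈ Finset.range (n + 1), |w (n - k)| * E := by
        refine (Finset.abs_sum_le_sum_abs _ _).trans (Finset.sum_le_sum fun k hk => ?_)
        rw [abs_mul]
        exact mul_le_mul_of_nonneg_left (hu k (by simpa [Nat.lt_succ_iff] using hk)) (abs_nonneg _)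
    _ = (∑ k ∈ Finset.range (n + 1), |w k|) * E := by
        rw [← Finset.sum_mul, ← Finset.sum_range_reflect (fun k => |w k|) (n + 1)]
        simp
    _ ≤ _ := mul_le_mul_of_nonneg_right (Finset.sum_le_sum_of_subset_of_nonneg
        (Finset.range_mono (by omega)) fun _ _ _ => abs_nonneg _) hE

theorem abs_fracSum_le_of_support {β : ℝ} (hβ0 : 0 ≤ β) (hβ1 : β ≤ 1) {d : ℕ → ℝ} {n m : ℕ}
    {B : ℝ} (hB : 0 ≤ B) (hd : ∀ k, 1 ≤ k → k ≤ n → k ≤ m → |d k| ≤ B) (hd0 : ∀ k, m < k → d k = 0) :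
    |fracSum β d n| ≤ m * B := by
  calc |fracSum β d n| ≤ ∑ k ∈ Finset.range n, if k < m then B else 0 := by
        refine (Finset.abs_sum_le_sum_abs _ _).trans (Finset.sum_le_sum fun k hk => ?_)
        split_ifs with h
        · rw [abs_mul, abs_of_nonneg (psi_nonneg hβ0 _)]
          have h1 := hd (k + 1) (by omega) (by simpa [Nat.succ_le_iff] using hk) (by omega)
          exact (mul_le_of_le_one_left (abs_nonneg _) (psi_le_one hβ0 hβ1 _)).trans h1
        · rw [hd0 (k + 1) (by omega), mul_zero, abs_zero]
    _ = ((Finset.range n).filter (· < m)).card * B := by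
        rw [← Finset.sum_filter, Finset.sum_const, nsmul_eq_mul]
    _ ≤ m * B := by
        refine mul_le_mul_of_nonneg_right ?_ hB
        have : ((Finset.range n).filter (· < m)).card ≤ (Finset.range m).card :=
          Finset.card_le_card fun k hk => by
            simpa using (Finset.mem_filter.1 hk).2
        rw [Finset.card_range] at this
        exact_mod_cast this

/-- Stability with respect to the source and to the starting values. -/
theorem stability {Q : ℕ} [NeZero Q] {ν α : Fin Q → ℝ} (hν₁ : 0 < ν 0) (hν : ∀ j, 0 ≤ ν j)
    (hα_anti : Antitone α) (hα : ∀ j, 0 < α j ∧ α j ≤ 1) (T : ℝ) {K : ℝ} (hK : 0 ≤ K) (m : ℕ) :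
    ∃ C > 0, ∃ τ₀ > 0, ∀ τ : ℝ, 0 < τ → τ ≤ τ₀ → ∀ N : ℕ, N * τ ≤ T →
      ∀ (e s : ℕ → ℝ) (M E : ℝ), e 0 = 0 → (∀ k ≤ m, |e k| ≤ E) →
      (∀ n, m < n → n ≤ N → |∑ j, ν j * (1 / τ ^ α j) * wsglSum (α j) e n - s n| ≤ K * |e n|) →
      (∀ n ≤ N, τ ^ α 0 * |fracSum (α 0) s n| ≤ M) → ∀ n ≤ N, |e n| ≤ C * (E + M) := by
  obtain ⟨C, hC, τ₀, hτ₀, hstab⟩ := stability_aux hν₁ hν hα_anti hα (T := T) hK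
  set β := α 0 with hβ
  have hβ0 : 0 < β := (hα 0).1
  have hβ1 : β ≤ 1 := (hα 0).2
  have hαβ : ∀ j, α j ≤ β := fun j => hα_anti (Fin.zero_le j)
  set C₁ : ℝ := ∑ j, ν j * ∑ i ∈ Finset.range (m + 1), |wsglWeight (α j) i| with hC₁
  set C₂ : ℝ := ∑ i ∈ Finset.range (m + 1), |glWeight β i| with hC₂
  have hC₁0 : 0 ≤ C₁ := Finset.sum_nonneg fun j _ => mul_nonneg (hν j)
    (Finset.sum_nonneg fun _ _ => abs_nonneg _)
  have hC₂0 : 0 ≤ C₂ := Finset.sum_nonneg fun _ _ => abs_nonneg _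
  refine ⟨C * (1 + m * (C₁ + C₂)), by positivity, min τ₀ 1, by positivity, ?_⟩
  intro τ hτ hττ N hN e s M E he hE hres hM
  have hτ1 : τ ≤ 1 := hττ.trans (min_le_right _ _)
  have hτβ : 0 < τ ^ β := Real.rpow_pos_of_pos hτ β
  have hM0 : 0 ≤ M := by simpa [fracSum] using hM 0 (Nat.zero_le _)
  have hE0 : 0 ≤ E := (abs_nonneg _).trans (hE 0 (Nat.zero_le _))
  set ρ : ℕ → ℝ := fun n => ∑ j, ν j * (1 / τ ^ α j) * wsglSum (α j) e n with hρ
  have hρle : ∀ k ≤ m, τ ^ β * |ρ k| ≤ C₁ * E := by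
    intro k hk
    rw [← abs_of_pos hτβ, ← abs_mul, hρ, Finset.mul_sum, hC₁, Finset.sum_mul]
    refine (Finset.abs_sum_le_sum_abs _ _).trans (Finset.sum_le_sum fun j _ => ?_)
    have h1 : τ ^ β * (ν j * (1 / τ ^ α j) * wsglSum (α j) e k)
        = ν j * τ ^ (β - α j) * wsglSum (α j) e k := by
      rw [Real.rpow_sub hτ]; ring
    have h2 : τ ^ (β - α j) ≤ 1 := Real.rpow_le_one hτ.le hτ1 (by linarith [hαβ j])
    have h3 : 0 ≤ τ ^ (β - α j) := Real.rpow_nonneg hτ.le _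
    have h4 := abs_sum_mul_le_sum_abs_mul (wsglWeight (α j)) hk
      (fun i hi => hE i (le_trans hi hk))
    rw [h1, abs_mul, abs_of_nonneg (mul_nonneg (hν j) h3), mul_assoc (ν j), mul_assoc (ν j)]
    exact mul_le_mul_of_nonneg_left
      ((mul_le_of_le_one_left (abs_nonneg _) h2).trans h4) (hν j)
  -- Only fractional sums of s are controlled; inverting them over at most m steps bounds its first
  -- values.
  have hsle : ∀ k, 1 ≤ k → k ≤ N → k ≤ m → τ ^ β * |s k| ≤ C₂ * M := by
    intro k hk1 hkN hkm
    obtain ⟨k, rfl⟩ := Nat.exists_eq_add_of_le' hk1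
    rw [← abs_of_pos hτβ, ← abs_mul, eq_sum_glWeight_mul_fracSum β s k,
      Finset.mul_sum]
    have h1 := abs_sum_mul_le_sum_abs_mul (glWeight β) (n := k) (m := m) (by omega)
      (u := fun i => τ ^ β * fracSum β s (i + 1)) (E := M) (fun i hi => by
        rw [abs_mul, abs_of_pos hτβ]
        exact hM _ (by omega))
    refine le_trans (le_of_eq ?_) h1
    congr 1
    exact Finset.sum_congr rfl fun i _ => by ring
  -- The artificial source makes the equation hold exactly for n ≤ m. It has at most m relevant
  -- entries and `psi β` is at most 1, so its fractional sum is bounded.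
  set d : ℕ → ℝ := fun k => if k ≤ m then ρ k - s k else 0 with hd
  have hdle : ∀ n ≤ N, τ ^ β * |fracSum β d n| ≤ m * (C₁ * E + C₂ * M) := by
    intro n hn
    have h1 := abs_fracSum_le_of_support hβ0.le hβ1 (d := d) (n := n) (m := m)
      (B := (C₁ * E + C₂ * M) / τ ^ β) (by positivity) (fun k hk1 hkn hkm => by
        rw [le_div_iff₀ hτβ, hd]
        simp only [hkm, if_true]
        have := hρle k hkm
        have := hsle k hk1 (hkn.trans hn) hkm
        have h3 := mul_le_mul_of_nonneg_left (abs_sub (ρ k) (s k)) hτβ.le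
        linarith) (fun k hk => by simp [hd, hk])
    calc τ ^ β * |fracSum β d n| ≤ τ ^ β * (m * ((C₁ * E + C₂ * M) / τ ^ β)) := by gcongr
      _ = _ := by field_simp
  have hfin := hstab τ hτ (hττ.trans (min_le_left _ _)) N hN e (fun k => s k + d k)
    (M + m * (C₁ * E + C₂ * M)) he (fun n hn1 hnN => by
      by_cases h : n ≤ m
      · have : ∑ j, ν j * (1 / τ ^ α j) * wsglSum (α j) e n - (s n + d n) = 0 := by
          simp [hd, h, hρ]
        rw [this, abs_zero]
        positivity
      · have : d n = 0 := by simp [hd, h]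
        rw [this, add_zero]
        exact hres n (by omega) hnN) (fun n hn => by
      rw [fracSum_add]
      have h1 := mul_le_mul_of_nonneg_left (abs_add_le (fracSum β s n) (fracSum β d n)) hτβ.le
      have := hM n hn
      have := hdle n hn
      linarith)
  intro n hn
  refine (hfin n hn).trans ?_
  rw [mul_assoc]
  refine mul_le_mul_of_nonneg_left ?_ hC.le
  have p1 : 0 ≤ m * C₁ * M := by positivity
  have p2 : 0 ≤ m * C₂ * E := by positivity
  nlinarith

/-! ### The starting weights -/

/-- The right-hand side of the linear system is `powErr` itself, and its matrix does not depend on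
the step. -/
theorem fracSum_startWeight (α β : ℝ) (σ : ℕ → ℝ) (m n : ℕ) (i : Fin m) :
    fracSum β (fun k => startWeight α σ m k i) n
      = ∑ r : Fin m, (startMatrix σ m)⁻¹ i r * powErrSum β α (σ (r + 1)) n := by
  have h : (fun k => startWeight α σ m k i)
      = fun k => ∑ r : Fin m, (startMatrix σ m)⁻¹ i r * powErr α (σ (r + 1)) k := rfl
  rw [h, fracSum_sum]
  rfl

theorem exists_abs_fracSum_startWeight_le {α β : ℝ} (hα : 0 < α) (hαβ : α ≤ β) (hβ : β ≤ 1)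
    {σ : ℕ → ℝ} (hσ_pos : ∀ k, 1 ≤ k → 0 < σ k) (m : ℕ) :
    ∃ C > 0, ∀ n : ℕ, 1 ≤ n → ∀ i : Fin m, |fracSum β (fun k => startWeight α σ m k i) n|
      ≤ C * ∑ r : Fin m, (1 + (n : ℝ) ^ (σ (r + 1) - 2 + β - α)) := by
  obtain ⟨C, hC, h⟩ := exists_abs_powErrSum_le hα hαβ hβ
  set A : ℝ := 1 + ∑ i : Fin m, ∑ r : Fin m,
    |(startMatrix σ m)⁻¹ i r| * (C * (1 + σ (r + 1)) ^ 3) with hA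
  have hterm : ∀ i r : Fin m, 0 ≤ |(startMatrix σ m)⁻¹ i r| * (C * (1 + σ (r + 1)) ^ 3) := by
    intro i r
    have := hσ_pos (r + 1) (by omega)
    positivity
  have hle : ∀ i r : Fin m, |(startMatrix σ m)⁻¹ i r| * (C * (1 + σ (r + 1)) ^ 3) ≤ A := by
    intro i r
    have h1 := Finset.single_le_sum (fun r _ => hterm i r) (Finset.mem_univ r)
    have h2 : ∑ r : Fin m, |(startMatrix σ m)⁻¹ i r| * (C * (1 + σ (r + 1)) ^ 3)
        ≤ ∑ i : Fin m, ∑ r : Fin m, |(startMatrix σ m)⁻¹ i r| * (C * (1 + σ (r + 1)) ^ 3) :=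
      Finset.single_le_sum (f := fun i : Fin m => ∑ r : Fin m,
        |(startMatrix σ m)⁻¹ i r| * (C * (1 + σ (r + 1)) ^ 3))
        (fun i _ => Finset.sum_nonneg fun r _ => hterm i r) (Finset.mem_univ i)
    linarith
  refine ⟨A, ?_, fun n hn i => ?_⟩
  · have := Finset.sum_nonneg fun i (_ : i ∈ Finset.univ) =>
      Finset.sum_nonneg fun r (_ : r ∈ Finset.univ) => hterm i r
    linarith
  rw [fracSum_startWeight, Finset.mul_sum]
  refine (Finset.abs_sum_le_sum_abs _ _).trans (Finset.sum_le_sum fun r _ => ?_)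
  rw [abs_mul]
  have p : 0 ≤ 1 + (n : ℝ) ^ (σ (r + 1) - 2 + β - α) := by positivity
  calc _ ≤ |(startMatrix σ m)⁻¹ i r|
        * (C * (1 + σ (r + 1)) ^ 3 * (1 + (n : ℝ) ^ (σ (r + 1) - 2 + β - α))) :=
        mul_le_mul_of_nonneg_left (h _ (hσ_pos _ (by omega)) n hn) (abs_nonneg _)
    _ = |(startMatrix σ m)⁻¹ i r| * (C * (1 + σ (r + 1)) ^ 3)
        * (1 + (n : ℝ) ^ (σ (r + 1) - 2 + β - α)) := by ring
    _ ≤ _ := mul_le_mul_of_nonneg_right (hle i r) p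

/-- The contribution of the starting values to the source. -/
theorem exists_start_source_le {α β T : ℝ} (hα : 0 < α) (hαβ : α ≤ β) (hβ : β ≤ 1) (hT : 0 < T)
    {σ : ℕ → ℝ} (hσ_pos : ∀ k, 1 ≤ k → 0 < σ k) (hσ_lt : ∀ k, 1 ≤ k → σ k < σ (k + 1)) {m : ℕ}
    (hσm : σ m ≤ 2) :
    ∃ C > 0, ∀ τ : ℝ, 0 < τ → ∀ n : ℕ, n * τ ≤ T → ∀ (e : ℕ → ℝ) (E : ℝ),
      (∀ k ≤ m, |e k| ≤ E) →
      τ ^ β * |fracSum β (fun n => 1 / τ ^ α * ∑ k : Fin m, startWeight α σ m n k * e (k + 1)) n|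
        ≤ C * E := by
  obtain ⟨A, hA, h⟩ := exists_abs_fracSum_startWeight_le hα hαβ hβ hσ_pos m
  refine ⟨m * (A * (m * 2)) * T ^ (β - α) + 1, by positivity, ?_⟩
  intro τ hτ n hn e E hE
  have hE0 : 0 ≤ E := (abs_nonneg _).trans (hE 0 (Nat.zero_le _))
  rcases Nat.eq_zero_or_pos n with rfl | hn1
  · simp only [fracSum, Finset.range_zero, Finset.sum_empty, abs_zero, mul_zero]
    positivity
  have hn0 : (1 : ℝ) ≤ n := by exact_mod_cast hn1
  have hW : ∀ i : Fin m, |fracSum β (fun k => startWeight α σ m k i) n|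
      ≤ A * (m * 2) * (n : ℝ) ^ (β - α) := by
    intro i
    refine (h n hn1 i).trans ?_
    rw [mul_assoc]
    refine mul_le_mul_of_nonneg_left ?_ hA.le
    -- Here σ_m ≤ 2 enters: every exponent is at most β - α, and n^(β-α) τ^(β-α) ≤ T^(β-α) later.
    have : ∀ r ∈ (Finset.univ : Finset (Fin m)),
        1 + (n : ℝ) ^ (σ (r + 1) - 2 + β - α) ≤ 2 * (n : ℝ) ^ (β - α) := by
      intro r _
      have hmono : σ (r + 1) ≤ σ m := by
        have := (strictMono_nat_of_lt_succ (f := fun k => σ (k + 1)) fun k => hσ_lt _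
          (by omega)).monotone (show (r : ℕ) ≤ m - 1 by have := r.2; omega)
        simpa [Nat.sub_add_cancel (by have := r.2; omega : 1 ≤ m)] using this
      have h1 : (n : ℝ) ^ (σ (r + 1) - 2 + β - α) ≤ (n : ℝ) ^ (β - α) :=
        Real.rpow_le_rpow_of_exponent_le hn0 (by linarith)
      have h2 : 1 ≤ (n : ℝ) ^ (β - α) := Real.one_le_rpow hn0 (by linarith)
      linarith
    refine (Finset.sum_le_sum this).trans (le_of_eq ?_)
    rw [Finset.sum_const, Finset.card_univ, Fintype.card_fin, nsmul_eq_mul]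
    ring
  have e1 : fracSum β (fun n => 1 / τ ^ α * ∑ k : Fin m, startWeight α σ m n k * e (k + 1)) n
      = ∑ k : Fin m, 1 / τ ^ α * e (k + 1) * fracSum β (fun n => startWeight α σ m n k) n := by
    rw [← fracSum_sum]
    congr 1
    funext k
    rw [Finset.mul_sum]
    exact Finset.sum_congr rfl fun i _ => by ring
  rw [e1]
  have hτβ : 0 < τ ^ β := Real.rpow_pos_of_pos hτ β
  have hτα : 0 < τ ^ α := Real.rpow_pos_of_pos hτ α
  calc τ ^ β * |∑ k : Fin m, 1 / τ ^ α * e (k + 1) * fracSum β (fun n => startWeight α σ m n k) n|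
      ≤ τ ^ β * ∑ k : Fin m, 1 / τ ^ α * E * (A * (m * 2) * (n : ℝ) ^ (β - α)) := by
        refine mul_le_mul_of_nonneg_left ((Finset.abs_sum_le_sum_abs _ _).trans
          (Finset.sum_le_sum fun k _ => ?_)) hτβ.le
        rw [abs_mul, abs_mul, abs_of_pos (by positivity : 0 < 1 / τ ^ α)]
        refine mul_le_mul ?_ (hW k) (abs_nonneg _) (by positivity)
        exact mul_le_mul_of_nonneg_left (hE _ (by have := k.2; omega)) (by positivity)
    _ = m * (A * (m * 2)) * (n * τ) ^ (β - α) * E := by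
        rw [Finset.sum_const, Finset.card_univ, Fintype.card_fin, nsmul_eq_mul,
          Real.mul_rpow (by positivity) hτ.le, Real.rpow_sub hτ]
        field_simp
    _ ≤ m * (A * (m * 2)) * T ^ (β - α) * E := by
        have : ((n : ℝ) * τ) ^ (β - α) ≤ T ^ (β - α) :=
          Real.rpow_le_rpow (by positivity) hn (by linarith)
        gcongr
    _ ≤ _ := mul_le_mul_of_nonneg_right (by linarith) hE0

/-! ### The truncation error -/

theorem hasSum_truncation {α T τ : ℝ} (hα : 0 < α) (hα1 : α ≤ 1) (hτ : 0 < τ)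
    {c σ : ℕ → ℝ} {Y : ℝ → ℝ} (hT : 0 < T)
    (hσ_pos : ∀ k, 1 ≤ k → 0 < σ k) (hσ_lt : ∀ k, 1 ≤ k → σ k < σ (k + 1))
    (hexp : HasExpansion c σ T Y) (hYc : ContinuousOn Y (Icc 0 T)) {m n : ℕ} (hm : m * τ ≤ T)
    (hn : 1 ≤ n) (hnT : n * τ ≤ T) :
    HasSum (fun l => c (l + 1) * τ ^ (σ (l + 1) - α) * (powErr α (σ (l + 1)) n
        - ∑ i : Fin m, ((i : ℕ) + 1 : ℝ) ^ σ (l + 1) * startWeight α σ m n i))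
      (caputo α Y (n * τ) - corrected α σ m τ (fun k => Y (k * τ) - Y 0) n) := by
  have hn0 : (0 : ℝ) < n := by exact_mod_cast hn
  have h1 := hasSum_caputo (a := fun k => c (k + 1)) (S := fun k => σ (k + 1)) hα hα1
    (fun k => hσ_pos _ (by omega)) (hexp.summable_one_add hT hσ_pos hσ_lt) hexp.hasSum hYc
    (t := n * τ) ⟨by positivity, hnT⟩
  have hU : ∀ k : ℕ, k * τ ≤ T →
      HasSum (fun l => c (l + 1) * ((k : ℝ) ^ σ (l + 1) * τ ^ σ (l + 1))) (Y (k * τ) - Y 0) := by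
    intro k hk
    have h := hexp.hasSum (k * τ) ⟨by positivity, hk⟩
    have e : (fun l => c (l + 1) * ((k : ℝ) ^ σ (l + 1) * τ ^ σ (l + 1)))
        = fun l => c (l + 1) * ((k : ℝ) * τ) ^ σ (l + 1) := by
      funext l
      rw [Real.mul_rpow (by positivity) hτ.le]
    rw [e]
    exact h
  have h2 := hasSum_sum (s := Finset.range (n + 1)) (f := fun k l => wsglWeight α (n - k)
      * (c (l + 1) * ((k : ℝ) ^ σ (l + 1) * τ ^ σ (l + 1)))) fun k hk =>
    (hU k (le_trans (mul_le_mul_of_nonneg_right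
      (by exact_mod_cast Nat.lt_succ_iff.1 (Finset.mem_range.1 hk)) hτ.le) hnT)).mul_left
      (wsglWeight α (n - k))
  have h3 := hasSum_sum (s := (Finset.univ : Finset (Fin m))) (f := fun i l =>
      startWeight α σ m n i * (c (l + 1) * (((i + 1 : ℕ) : ℝ) ^ σ (l + 1) * τ ^ σ (l + 1))))
      fun i _ => (hU (i + 1) (le_trans (mul_le_mul_of_nonneg_right
      (by exact_mod_cast i.2) hτ.le) hm)).mul_left (startWeight α σ m n i)
  have h4 := h1.sub ((h2.add h3).mul_left (1 / τ ^ α))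
  have e : (fun l => c (l + 1) * τ ^ (σ (l + 1) - α) * (powErr α (σ (l + 1)) n
        - ∑ i : Fin m, ((i : ℕ) + 1 : ℝ) ^ σ (l + 1) * startWeight α σ m n i))
      = fun l => c (l + 1) * (Real.Gamma (σ (l + 1) + 1) / Real.Gamma (σ (l + 1) + 1 - α)
          * (n * τ) ^ (σ (l + 1) - α)) - 1 / τ ^ α * (∑ k ∈ Finset.range (n + 1),
          wsglWeight α (n - k) * (c (l + 1) * ((k : ℝ) ^ σ (l + 1) * τ ^ σ (l + 1)))
          + ∑ i : Fin m, startWeight α σ m n i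
            * (c (l + 1) * (((i + 1 : ℕ) : ℝ) ^ σ (l + 1) * τ ^ σ (l + 1)))) := by
    funext l
    have e1 : ∑ k ∈ Finset.range (n + 1),
        wsglWeight α (n - k) * (c (l + 1) * ((k : ℝ) ^ σ (l + 1) * τ ^ σ (l + 1)))
        = c (l + 1) * τ ^ σ (l + 1)
          * ∑ k ∈ Finset.range (n + 1), wsglWeight α (n - k) * (k : ℝ) ^ σ (l + 1) := by
      rw [Finset.mul_sum]
      exact Finset.sum_congr rfl fun k _ => by ring
    have e2 : ∑ i : Fin m, startWeight α σ m n i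
            * (c (l + 1) * (((i + 1 : ℕ) : ℝ) ^ σ (l + 1) * τ ^ σ (l + 1)))
        = c (l + 1) * τ ^ σ (l + 1)
          * ∑ i : Fin m, ((i : ℕ) + 1 : ℝ) ^ σ (l + 1) * startWeight α σ m n i := by
      rw [Finset.mul_sum]
      exact Finset.sum_congr rfl fun k _ => by push_cast; ring
    rw [e1, e2, Real.mul_rpow hn0.le hτ.le, Real.rpow_sub hτ, powErr]
    ring
  rw [e]
  exact h4

/-- For y ≤ 2 the power of n is at most 1. For y > 2 one has τ^y n^(y-2) = (nτ)^(y-2) τ², which is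
the saturation at order two. -/
theorem rpow_mul_one_add_rpow_le {T τ x y p : ℝ} (hT : 0 < T) (hτ : 0 < τ) (hτ1 : τ ≤ 1) {n : ℕ}
    (hn : 1 ≤ n) (hnT : n * τ ≤ T) (hyx : y ≤ x) (hpx : p ≤ x) (hp : p ≤ 2) :
    τ ^ x * (1 + (n : ℝ) ^ (y - 2)) ≤ (2 + T ^ (y - 2)) * τ ^ p := by
  have hn1 : (1 : ℝ) ≤ n := by exact_mod_cast hn
  have h1 : τ ^ x ≤ τ ^ p := Real.rpow_le_rpow_of_exponent_ge hτ hτ1 hpx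
  have hp0 : 0 ≤ τ ^ p := Real.rpow_nonneg hτ.le _
  have hx0 : 0 ≤ τ ^ x := Real.rpow_nonneg hτ.le _
  have hT0 : 0 ≤ T ^ (y - 2) := Real.rpow_nonneg hT.le _
  rcases le_or_gt y 2 with hy | hy
  · have h2 : (n : ℝ) ^ (y - 2) ≤ 1 := Real.rpow_le_one_of_one_le_of_nonpos hn1 (by linarith)
    have h3 := mul_le_mul_of_nonneg_left h2 hx0
    nlinarith [mul_nonneg hT0 hp0]
  · have h2 : τ ^ x * (n : ℝ) ^ (y - 2) ≤ T ^ (y - 2) * τ ^ p := by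
      calc τ ^ x * (n : ℝ) ^ (y - 2) ≤ τ ^ y * (n : ℝ) ^ (y - 2) :=
            mul_le_mul_of_nonneg_right (Real.rpow_le_rpow_of_exponent_ge hτ hτ1 hyx) (by positivity)
        _ = (n * τ) ^ (y - 2) * τ ^ (2 : ℝ) := by
            rw [Real.mul_rpow (by positivity) hτ.le, mul_assoc, ← Real.rpow_add hτ]
            ring_nf
        _ ≤ T ^ (y - 2) * τ ^ p := mul_le_mul
            (Real.rpow_le_rpow (by positivity) hnT (by linarith))
            (Real.rpow_le_rpow_of_exponent_ge hτ hτ1 hp) (Real.rpow_nonneg hτ.le _) hT0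
    nlinarith

/-- Since iτ/T ≤ 1, its powers decrease with the exponent. The exponent S survives only in T^S, the
factor that the expansion makes summable. -/
theorem mul_rpow_le_mul_rpow {T τ s S i : ℝ} (hT : 0 < T) (hτ : 0 < τ) (hi : 0 < i)
    (hiT : i * τ ≤ T) (hsS : s ≤ S) :
    i ^ S * τ ^ S ≤ T ^ S * (T ^ (-s) * i ^ s) * τ ^ s := by
  have h := Real.rpow_le_rpow_of_exponent_ge (x := i * τ / T) (by positivity)
    (by rw [div_le_one hT]; exact hiT) hsS
  rw [Real.div_rpow (by positivity) hT.le, Real.div_rpow (by positivity) hT.le,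
    div_le_iff₀ (by positivity), Real.mul_rpow hi.le hτ.le, Real.mul_rpow hi.le hτ.le] at h
  refine h.trans (le_of_eq ?_)
  rw [Real.rpow_neg hT.le]
  field_simp

/-- The variant of `rpow_mul_one_add_rpow_le` that is uniform over the tail of the expansion: the
constant depends on S through T^S alone. -/
theorem rpow_mul_one_add_rpow_le_mul {T τ S s δ p : ℝ} (hT : 0 < T) (hτ : 0 < τ) (hτ1 : τ ≤ 1)
    (hτT : τ ≤ T) {n : ℕ} (hn : 1 ≤ n) (hnT : n * τ ≤ T) (hsS : s ≤ S) (hps : p ≤ s + δ)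
    (hp : p ≤ 2) :
    τ ^ (S + δ) * (1 + (n : ℝ) ^ (S + δ - 2)) ≤ (2 * T ^ (-s) + T ^ (δ - 2)) * T ^ S * τ ^ p := by
  have hn1 : (1 : ℝ) ≤ n := by exact_mod_cast hn
  have h1 : τ ^ (S + δ) ≤ T ^ (-s) * T ^ S * τ ^ p := by
    have h := mul_rpow_le_mul_rpow (i := 1) hT hτ one_pos (by rwa [one_mul]) hsS
    simp only [Real.one_rpow, one_mul, mul_one] at h
    rw [Real.rpow_add hτ]
    calc τ ^ S * τ ^ δ ≤ T ^ S * T ^ (-s) * τ ^ s * τ ^ δ :=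
          mul_le_mul_of_nonneg_right h (Real.rpow_nonneg hτ.le _)
      _ = T ^ (-s) * T ^ S * τ ^ (s + δ) := by rw [Real.rpow_add hτ]; ring
      _ ≤ _ := mul_le_mul_of_nonneg_left (Real.rpow_le_rpow_of_exponent_ge hτ hτ1 hps)
          (by positivity)
  have hx0 : 0 ≤ τ ^ (S + δ) := Real.rpow_nonneg hτ.le _
  have hq : 0 ≤ T ^ (δ - 2) * T ^ S * τ ^ p := by positivity
  rcases le_or_gt (S + δ) 2 with hy | hy
  · have h2 : (n : ℝ) ^ (S + δ - 2) ≤ 1 := Real.rpow_le_one_of_one_le_of_nonpos hn1 (by linarith)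
    have h3 := mul_le_mul_of_nonneg_left h2 hx0
    nlinarith
  · have h2 : τ ^ (S + δ) * (n : ℝ) ^ (S + δ - 2) ≤ T ^ (δ - 2) * T ^ S * τ ^ p := by
      calc τ ^ (S + δ) * (n : ℝ) ^ (S + δ - 2) = (n * τ) ^ (S + δ - 2) * τ ^ (2 : ℝ) := by
            rw [Real.mul_rpow (by positivity) hτ.le, mul_assoc, ← Real.rpow_add hτ]
            ring_nf
        _ ≤ T ^ (S + δ - 2) * τ ^ p := mul_le_mul
            (Real.rpow_le_rpow (by positivity) hnT (by linarith))
            (Real.rpow_le_rpow_of_exponent_ge hτ hτ1 hp) (Real.rpow_nonneg hτ.le _) (by positivity)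
        _ = _ := by rw [← Real.rpow_add hT]; ring_nf
    have h3 : 0 ≤ T ^ (-s) * T ^ S * τ ^ p := by positivity
    nlinarith

theorem fracSum_truncation_term (α β : ℝ) (σ : ℕ → ℝ) (m n : ℕ) (S b : ℝ) :
    fracSum β (fun k => b * (powErr α S k
        - ∑ i : Fin m, ((i : ℕ) + 1 : ℝ) ^ S * startWeight α σ m k i)) n
      = b * (powErrSum β α S n
        - ∑ i : Fin m, ((i : ℕ) + 1 : ℝ) ^ S * fracSum β (fun k => startWeight α σ m k i) n) := by
  rw [← fracSum_sum]
  simp only [fracSum, powErrSum]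
  rw [← Finset.sum_sub_distrib, Finset.mul_sum]
  exact Finset.sum_congr rfl fun k _ => by ring

/-- The contribution of the truncation error to the source. -/
theorem exists_truncation_source_le {α β T p : ℝ} (hα : 0 < α) (hαβ : α ≤ β) (hβ : β ≤ 1)
    (hT : 0 < T) {c σ : ℕ → ℝ} {Y : ℝ → ℝ} (hσ_pos : ∀ k, 1 ≤ k → 0 < σ k)
    (hσ_lt : ∀ k, 1 ≤ k → σ k < σ (k + 1)) (hexp : HasExpansion c σ T Y)
    (hYc : ContinuousOn Y (Icc 0 T)) {m : ℕ} (hp : p ≤ 2) (hpσ : p ≤ σ (m + 1) + β - α) :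
    ∃ C > 0, ∀ τ : ℝ, 0 < τ → τ ≤ 1 → (m + 1) * τ ≤ T → ∀ n : ℕ, n * τ ≤ T →
      τ ^ β * |fracSum β (fun n => caputo α Y (n * τ)
        - corrected α σ m τ (fun k => Y (k * τ) - Y 0) n) n| ≤ C * τ ^ p := by
  obtain ⟨A, hA, hAle⟩ := exists_abs_fracSum_startWeight_le hα hαβ hβ hσ_pos m
  obtain ⟨C, hC, hCle⟩ := exists_abs_powErrSum_le hα hαβ hβ
  have hsm : StrictMono fun k : ℕ => σ (k + 1) := strictMono_nat_of_lt_succ fun k => hσ_lt _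
    (by omega)
  set s := σ (m + 1) with hs
  set δ := β - α with hδ
  have hsum := hexp.summable_one_add hT hσ_pos hσ_lt
  set G : ℝ := ∑ i : Fin m, T ^ (-s) * ((i : ℕ) + 1 : ℝ) ^ s
    * (A * ∑ r : Fin m, (2 + T ^ (σ (r + 1) + δ - 2))) with hG
  have hG0 : 0 ≤ G := Finset.sum_nonneg fun i _ => by
    have : 0 ≤ ∑ r : Fin m, (2 + T ^ (σ (r + 1) + δ - 2)) :=
      Finset.sum_nonneg fun r _ => by positivity
    positivity
  set B : ℝ := C * (2 * T ^ (-s) + T ^ (δ - 2)) + G with hB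
  have hB0 : 0 < B := by positivity
  set V := ∑' l, |c (l + 1)| * (1 + σ (l + 1)) ^ 3 * T ^ σ (l + 1) with hV
  have hV0 : 0 ≤ V := tsum_nonneg fun l => by
    have := hσ_pos (l + 1) (by omega)
    positivity
  refine ⟨V * B + 1, by positivity, ?_⟩
  intro τ hτ hτ1 hmT n hnT
  have hτp : 0 < τ ^ p := Real.rpow_pos_of_pos hτ p
  have hτβ : 0 < τ ^ β := Real.rpow_pos_of_pos hτ β
  have hm0 : (0 : ℝ) ≤ m := Nat.cast_nonneg m
  rcases Nat.eq_zero_or_pos n with rfl | hn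
  · simp only [fracSum, Finset.range_zero, Finset.sum_empty, abs_zero, mul_zero]
    positivity
  set Z : ℕ → ℝ := fun l => c (l + 1) * τ ^ (σ (l + 1) - α) * (powErrSum β α (σ (l + 1)) n
        - ∑ i : Fin m, ((i : ℕ) + 1 : ℝ) ^ σ (l + 1)
          * fracSum β (fun k => startWeight α σ m k i) n) with hZ
  have hZsum : HasSum Z (fracSum β (fun n => caputo α Y (n * τ)
        - corrected α σ m τ (fun k => Y (k * τ) - Y 0) n) n) := by
    have h1 := hasSum_sum (s := Finset.range n) fun k hk =>
      (hasSum_truncation hα (hαβ.trans hβ) hτ hT hσ_pos hσ_lt hexp hYc (m := m) (n := k + 1)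
        (by nlinarith) (by omega) (le_trans (mul_le_mul_of_nonneg_right
          (by exact_mod_cast Finset.mem_range.1 hk) hτ.le) hnT)).mul_left (psi β (n - 1 - k))
    have e : Z = fun l => fracSum β (fun k => c (l + 1) * τ ^ (σ (l + 1) - α)
        * (powErr α (σ (l + 1)) k
        - ∑ i : Fin m, ((i : ℕ) + 1 : ℝ) ^ σ (l + 1) * startWeight α σ m k i)) n := by
      funext l
      rw [fracSum_truncation_term]
    rw [e]
    exact h1
  -- The starting weights make the formula exact on the first m powers, so the leading exponent left
  -- is σ (m + 1).
  have hZ0 : ∀ l < m, Z l = 0 := by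
    intro l hl
    have e : ∀ k, powErr α (σ (l + 1)) k
        - ∑ i : Fin m, ((i : ℕ) + 1 : ℝ) ^ σ (l + 1) * startWeight α σ m k i = 0 := by
      intro k
      have h := startWeight_spec hσ_lt α m k ⟨l, hl⟩
      simp only [startRhs] at h
      rw [powErr, ← h, sub_eq_zero]
      exact Finset.sum_congr rfl fun i _ => mul_comm _ _
    have h := fracSum_truncation_term α β σ m n (σ (l + 1)) (c (l + 1) * τ ^ (σ (l + 1) - α))
    simp only [hZ]
    rw [← h]
    simp [fracSum, e]
  have hpow : ∀ S : ℝ, τ ^ β * τ ^ (S - α) = τ ^ (S + δ) := by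
    intro S
    rw [← Real.rpow_add hτ, hδ]
    ring_nf
  have hexpo : ∀ S : ℝ, S - 2 + β - α = S + δ - 2 := fun S => by rw [hδ]; ring
  have hZle : ∀ l, ‖τ ^ β * Z l‖
      ≤ |c (l + 1)| * (1 + σ (l + 1)) ^ 3 * T ^ σ (l + 1) * (B * τ ^ p) := by
    intro l
    have hS0 := hσ_pos (l + 1) (by omega)
    rcases lt_or_ge l m with hl | hl
    · rw [hZ0 l hl, mul_zero, norm_zero]
      positivity
    have hsS : s ≤ σ (l + 1) := hsm.monotone hl
    set S := σ (l + 1) with hSdef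
    have h1 : τ ^ (S + δ) * |powErrSum β α S n|
        ≤ (1 + S) ^ 3 * T ^ S * (C * (2 * T ^ (-s) + T ^ (δ - 2)) * τ ^ p) := by
      have h := rpow_mul_one_add_rpow_le_mul (δ := δ) hT hτ hτ1 (by nlinarith) hn hnT hsS
        (by rw [hδ]; linarith) hp
      have h' := hCle S hS0 n hn
      rw [hexpo] at h'
      calc τ ^ (S + δ) * |powErrSum β α S n|
          ≤ τ ^ (S + δ) * (C * (1 + S) ^ 3 * (1 + (n : ℝ) ^ (S + δ - 2))) :=
            mul_le_mul_of_nonneg_left h' (Real.rpow_nonneg hτ.le _)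
        _ = C * (1 + S) ^ 3 * (τ ^ (S + δ) * (1 + (n : ℝ) ^ (S + δ - 2))) := by ring
        _ ≤ C * (1 + S) ^ 3 * ((2 * T ^ (-s) + T ^ (δ - 2)) * T ^ S * τ ^ p) :=
            mul_le_mul_of_nonneg_left h (by positivity)
        _ = _ := by ring
    have h2 : τ ^ (S + δ) * |∑ i : Fin m, ((i : ℕ) + 1 : ℝ) ^ S
          * fracSum β (fun k => startWeight α σ m k i) n| ≤ T ^ S * (G * τ ^ p) := by
      have hle := Finset.abs_sum_le_sum_abs (fun i : Fin m => ((i : ℕ) + 1 : ℝ) ^ S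
          * fracSum β (fun k => startWeight α σ m k i) n) Finset.univ
      refine (mul_le_mul_of_nonneg_left hle (Real.rpow_nonneg hτ.le _)).trans ?_
      rw [Finset.mul_sum, hG, Finset.sum_mul, Finset.mul_sum]
      refine Finset.sum_le_sum fun i _ => ?_
      have hi : (0 : ℝ) < (i : ℕ) + 1 := by positivity
      have him : ((i : ℕ) : ℝ) + 1 ≤ m := by exact_mod_cast i.2
      have h3 := mul_rpow_le_mul_rpow hT hτ hi (by nlinarith) hsS
      have h4 : τ ^ (s + δ) * |fracSum β (fun k => startWeight α σ m k i) n|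
          ≤ A * (∑ r : Fin m, (2 + T ^ (σ (r + 1) + δ - 2))) * τ ^ p := by
        refine (mul_le_mul_of_nonneg_left (hAle n hn i) (Real.rpow_nonneg hτ.le _)).trans ?_
        rw [mul_left_comm, mul_assoc]
        refine mul_le_mul_of_nonneg_left ?_ hA.le
        rw [Finset.mul_sum, Finset.sum_mul]
        refine Finset.sum_le_sum fun r _ => ?_
        rw [hexpo]
        have hrs : σ (r + 1) ≤ s := hsm.monotone r.2.le
        exact rpow_mul_one_add_rpow_le hT hτ hτ1 hn hnT (by linarith) (by rw [hδ]; linarith) hp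
      rw [abs_mul, abs_of_pos (Real.rpow_pos_of_pos hi S)]
      calc τ ^ (S + δ) * (((i : ℕ) + 1 : ℝ) ^ S * |fracSum β (fun k => startWeight α σ m k i) n|)
          = ((i : ℕ) + 1 : ℝ) ^ S * τ ^ S
            * (τ ^ δ * |fracSum β (fun k => startWeight α σ m k i) n|) := by
            rw [Real.rpow_add hτ]; ring
        _ ≤ T ^ S * (T ^ (-s) * ((i : ℕ) + 1 : ℝ) ^ s) * τ ^ s
            * (τ ^ δ * |fracSum β (fun k => startWeight α σ m k i) n|) :=
            mul_le_mul_of_nonneg_right h3 (by positivity)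
        _ = T ^ S * (T ^ (-s) * ((i : ℕ) + 1 : ℝ) ^ s)
            * (τ ^ (s + δ) * |fracSum β (fun k => startWeight α σ m k i) n|) := by
            rw [Real.rpow_add hτ]; ring
        _ ≤ T ^ S * (T ^ (-s) * ((i : ℕ) + 1 : ℝ) ^ s)
            * (A * (∑ r : Fin m, (2 + T ^ (σ (r + 1) + δ - 2))) * τ ^ p) :=
            mul_le_mul_of_nonneg_left h4 (by positivity)
        _ = _ := by ring
    have h3 : 1 ≤ (1 + S) ^ 3 := one_le_pow₀ (by linarith)
    have e : τ ^ β * Z l = c (l + 1) * (τ ^ (S + δ) * powErrSum β α S n - τ ^ (S + δ)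
        * ∑ i : Fin m, ((i : ℕ) + 1 : ℝ) ^ S
          * fracSum β (fun k => startWeight α σ m k i) n) := by
      rw [← hpow S]
      simp only [hZ]
      ring
    have hτS : 0 ≤ τ ^ (S + δ) := Real.rpow_nonneg hτ.le _
    have h4 := abs_sub (τ ^ (S + δ) * powErrSum β α S n) (τ ^ (S + δ)
        * ∑ i : Fin m, ((i : ℕ) + 1 : ℝ) ^ S * fracSum β (fun k => startWeight α σ m k i) n)
    rw [abs_mul, abs_mul, abs_of_nonneg hτS] at h4
    rw [e, Real.norm_eq_abs, abs_mul, mul_assoc, mul_assoc]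
    refine mul_le_mul_of_nonneg_left (h4.trans ?_) (abs_nonneg _)
    have h5 : T ^ S * (G * τ ^ p) ≤ (1 + S) ^ 3 * (T ^ S * (G * τ ^ p)) :=
      le_mul_of_one_le_left (by positivity) h3
    calc _ ≤ (1 + S) ^ 3 * T ^ S * (C * (2 * T ^ (-s) + T ^ (δ - 2)) * τ ^ p)
          + (1 + S) ^ 3 * (T ^ S * (G * τ ^ p)) := add_le_add h1 (h2.trans h5)
      _ = _ := by rw [hB]; ring
  have hfin := tsum_of_norm_bounded (hsum.hasSum.mul_right (B * τ ^ p)) hZle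
  rw [(hZsum.mul_left (τ ^ β)).tsum_eq, Real.norm_eq_abs, abs_mul, abs_of_pos hτβ] at hfin
  refine hfin.trans ?_
  rw [← hV]
  nlinarith

/-! ### Convergence -/

theorem corrected_eq_add (α : ℝ) (σ : ℕ → ℝ) (m : ℕ) (τ : ℝ) (u e : ℕ → ℝ) (n : ℕ) :
    corrected α σ m τ (fun k => u k + e k) n = corrected α σ m τ u n
      + (1 / τ ^ α * wsglSum α e n
        + 1 / τ ^ α * ∑ k : Fin m, startWeight α σ m n k * e (k + 1)) := by
  simp only [corrected, wsglSum, mul_add, Finset.sum_add_distrib]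
  ring

/-- The error equation as pure algebra. Once the differential equation and the scheme are inserted,
the right side becomes f at Y minus f at y, ready for the Lipschitz bound. -/
theorem sum_corrected_error_eq {Q : ℕ} (ν α : Fin Q → ℝ) (σ : ℕ → ℝ) (m : Fin Q → ℕ) (τ : ℝ)
    (Y : ℝ → ℝ) (y : ℕ → ℝ) (hy : y 0 = Y 0) (n : ℕ) :
    ∑ j, ν j * (1 / τ ^ α j) * wsglSum (α j) (fun k => Y (k * τ) - y k) n
      - ∑ j, -ν j * ((caputo (α j) Y (n * τ)
          - corrected (α j) σ (m j) τ (fun k => Y (k * τ) - Y 0) n)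
        + 1 / τ ^ α j * ∑ k : Fin (m j), startWeight (α j) σ (m j) n k
          * (Y ((k + 1 : ℕ) * τ) - y (k + 1)))
      = ∑ j, ν j * caputo (α j) Y (n * τ)
        - ∑ j, ν j * corrected (α j) σ (m j) τ (fun k => y k - y 0) n := by
  rw [← Finset.sum_sub_distrib, ← Finset.sum_sub_distrib]
  refine Finset.sum_congr rfl fun j _ => ?_
  have e : (fun k : ℕ => Y (k * τ) - Y 0)
      = fun k : ℕ => (y k - y 0) + (Y (k * τ) - y k) := by
    funext k
    rw [hy]
    ring
  rw [e, corrected_eq_add]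
  ring

end

end MultiTermFODE

theorem mainTheorem4 {Q : ℕ} [NeZero Q] (ν α : Fin Q → ℝ) (σ c : ℕ → ℝ) (m : Fin Q → ℕ)
    (f : ℝ → ℝ → ℝ) (T Y₀ L : ℝ) (Y : ℝ → ℝ)
    (hT : 0 < T)
    (hν₁ : 0 < ν 0) (hν : ∀ j, 0 ≤ ν j)
    (hα_anti : Antitone α) (hα : ∀ j, 0 < α j ∧ α j ≤ 1)
    (hσ_pos : ∀ k, 1 ≤ k → 0 < σ k) (hσ_lt : ∀ k, 1 ≤ k → σ k < σ (k + 1))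
    (hm : ∀ j, 1 ≤ m j) (hσm : ∀ j, σ (m j) ≤ 2)
    (hf : ∀ t ∈ Set.Ioc 0 T, ∀ u v : ℝ, |f t u - f t v| ≤ L * |u - v|)
    (hY : MultiTermFODE.IsSolution ν α f T Y₀ Y)
    (hexp : MultiTermFODE.HasExpansion c σ T Y) :
    ∃ C > 0, ∃ τ₀ > 0, ∀ (N : ℕ) (τ : ℝ), 0 < N → τ = T / N → τ ≤ τ₀ →
      ∀ y : ℕ → ℝ, MultiTermFODE.IsSchemeSolution ν α σ m f Y₀ τ N y →
        ∀ n ≤ N, |Y (n * τ) - y n| ≤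
          C * (∑ k ∈ Finset.range (Finset.univ.sup m + 1), |Y (k * τ) - y k|
            + τ ^ min 2 (⨅ j, (σ (m j + 1) + α 0 - α j))) := by
  set p : ℝ := min 2 (⨅ j, (σ (m j + 1) + α 0 - α j)) with hp
  set μ : ℕ := Finset.univ.sup m with hμ
  have hmμ : ∀ j, m j ≤ μ := fun j => Finset.le_sup (Finset.mem_univ j)
  have hα0 : ∀ j, α j ≤ α 0 := fun j => hα_anti (Fin.zero_le j)
  have hpj : ∀ j, p ≤ σ (m j + 1) + α 0 - α j := fun j =>
    (min_le_right _ _).trans (ciInf_le (Set.finite_range _).bddBelow j)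
  choose A hA hAle using fun j => MultiTermFODE.exists_start_source_le (hα j).1 (hα0 j) (hα 0).2 hT
    hσ_pos hσ_lt (hσm j)
  choose B hB hBle using fun j => MultiTermFODE.exists_truncation_source_le (hα j).1 (hα0 j)
    (hα 0).2 hT hσ_pos hσ_lt hexp hY.continuousOn (min_le_left _ _ : p ≤ 2) (hpj j)
  -- L carries no sign hypothesis, hence |L|.
  obtain ⟨C, hC, τ₁, hτ₁, hstab⟩ := MultiTermFODE.stability hν₁ hν hα_anti hα T (abs_nonneg L) μ
  have hA0 : 0 ≤ ∑ j, ν j * A j := Finset.sum_nonneg fun j _ => mul_nonneg (hν j) (hA j).le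
  have hB0 : 0 ≤ ∑ j, ν j * B j := Finset.sum_nonneg fun j _ => mul_nonneg (hν j) (hB j).le
  -- The bound T/(μ+1) on τ keeps all starting nodes in [0, T], and τ ≤ 1 orders the powers of τ.
  refine ⟨C * (1 + ∑ j, ν j * A j + ∑ j, ν j * B j), by positivity,
    min τ₁ (min 1 (T / (μ + 1))), by positivity, ?_⟩
  intro N τ hN hτN hττ y hy
  have hN0 : (0 : ℝ) < N := by exact_mod_cast hN
  have hτ : 0 < τ := by rw [hτN]; positivity
  have hNT : N * τ = T := by rw [hτN]; field_simp
  have hτ1 : τ ≤ 1 := hττ.trans ((min_le_right _ _).trans (min_le_left _ _))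
  have hμT : (μ + 1) * τ ≤ T := by
    have := hττ.trans ((min_le_right _ _).trans (min_le_right _ _))
    rwa [le_div_iff₀ (by positivity), mul_comm] at this
  have hyY : y 0 = Y 0 := hy.init.trans hY.init.symm
  set e : ℕ → ℝ := fun k => Y (k * τ) - y k with he
  set E : ℝ := ∑ k ∈ Finset.range (μ + 1), |Y (k * τ) - y k| with hE
  have hE0 : 0 ≤ E := Finset.sum_nonneg fun _ _ => abs_nonneg _
  have hτp : 0 < τ ^ p := Real.rpow_pos_of_pos hτ p
  have heE : ∀ k ≤ μ, |e k| ≤ E := fun k hk =>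
    Finset.single_le_sum (f := fun k : ℕ => |Y (k * τ) - y k|) (fun _ _ => abs_nonneg _)
      (Finset.mem_range.2 (by omega))
  have hfin := hstab τ hτ (hττ.trans (min_le_left _ _)) N hNT.le e
    (fun n => ∑ j, -ν j * ((MultiTermFODE.caputo (α j) Y (n * τ)
          - MultiTermFODE.corrected (α j) σ (m j) τ (fun k => Y (k * τ) - Y 0) n)
        + 1 / τ ^ α j * ∑ k : Fin (m j), MultiTermFODE.startWeight (α j) σ (m j) n k
          * e (k + 1)))
    ((∑ j, ν j * A j) * E + (∑ j, ν j * B j) * τ ^ p) E (by simp [he, hyY]) heE ?_ ?_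
  · intro n hn
    refine (hfin n hn).trans ?_
    rw [mul_assoc]
    refine mul_le_mul_of_nonneg_left ?_ hC.le
    nlinarith [mul_nonneg hA0 hτp.le, mul_nonneg hB0 hE0]
  · intro n hn hnN
    have ht : (n * τ) ∈ Set.Ioc 0 T := by
      have : (0 : ℝ) < n := by exact_mod_cast (Nat.zero_le _).trans_lt hn
      refine ⟨by positivity, ?_⟩
      rw [← hNT]
      exact mul_le_mul_of_nonneg_right (by exact_mod_cast hnN) hτ.le
    have h := MultiTermFODE.sum_corrected_error_eq ν α σ m τ Y y hyY n
    rw [hY.equation _ ht, hy.step n hn hnN] at h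
    refine (le_of_eq (congrArg abs h)).trans ((hf _ ht _ _).trans ?_)
    exact mul_le_mul_of_nonneg_right (le_abs_self L) (abs_nonneg _)
  · intro n hnN
    have hnT : n * τ ≤ T := by
      rw [← hNT]
      exact mul_le_mul_of_nonneg_right (by exact_mod_cast hnN) hτ.le
    rw [MultiTermFODE.fracSum_sum Finset.univ (α 0) (fun j => -ν j), Finset.sum_mul,
      Finset.sum_mul, ← Finset.sum_add_distrib]
    have hτβ : 0 < τ ^ α 0 := Real.rpow_pos_of_pos hτ _
    refine (mul_le_mul_of_nonneg_left (Finset.abs_sum_le_sum_abs _ _) hτβ.le).trans ?_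
    rw [Finset.mul_sum]
    refine Finset.sum_le_sum fun j _ => ?_
    rw [MultiTermFODE.fracSum_add, abs_mul, abs_neg, abs_of_nonneg (hν j)]
    have hmj : (m j : ℝ) ≤ μ := by exact_mod_cast hmμ j
    have h1 := hAle j τ hτ n hnT e E fun k hk => heE k (hk.trans (hmμ j))
    have h2 := hBle j τ hτ hτ1 (by nlinarith) n hnT
    have h3 := mul_le_mul_of_nonneg_left (abs_add_le
      (MultiTermFODE.fracSum (α 0) (fun n => MultiTermFODE.caputo (α j) Y (n * τ)
        - MultiTermFODE.corrected (α j) σ (m j) τ (fun k => Y (k * τ) - Y 0) n) n)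
      (MultiTermFODE.fracSum (α 0) (fun n => 1 / τ ^ α j * ∑ k : Fin (m j),
        MultiTermFODE.startWeight (α j) σ (m j) n k * e (k + 1)) n)) hτβ.le
    rw [mul_add] at h3
    rw [← hp] at h2
    have h4 := mul_le_mul_of_nonneg_left (h3.trans (add_le_add h2 h1)) (hν j)
    refine (le_of_eq (mul_left_comm _ _ _)).trans (h4.trans (le_of_eq ?_))
    ring
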